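/- All algebras are associative algebras over $\mathbb C$, not necessarily unital. For an algebra $A$, the multiplier algebra $M(A)$ consists of the pairs of linear maps $b\mapsto mb$ and $a\mapsto am$ on $A$ with $(am)b=a(mb)$ for all $a,b$; for $A$ non-degenerate we regard $A\subseteq M(A)$. A weak multiplier Hopf algebra is a pair $(A,\Delta)$ of a non-degenerate idempotent algebra $A$ (that is, $A^2=A$) and a homomorphism $\Delta:A\to M(A\otimes A)$ such that: (1) $T_1(a\otimes b)=\Delta(a)(1\otimes b)$ and $T_2(a\otimes b)=(a\otimes 1)\Delta(b)$ lie in $A\otimes A$, and $\Delta$ is coassociative: $(a\otimes1\otimes1)(\Delta\otimes\iota)(\Delta(b)(1\otimes c))=(\iota\otimes\Delta)((a\otimes1)\Delta(b))(1\otimes1\otimes c)$; (2) $\Delta$ is full: $A$ is spanned by the elements $(\iota\otimes\omega)T_1(a\otimes b)$, and also by the elements $(\omega\otimes\iota)T_2(a\otimes b)$, with $a,b\in A$ and $\omega$ a linear functional on $A$; (3) there is a counit, a linear functional $\varepsilon$ with $(\varepsilon\otimes\iota)T_1(a\otimes b)=ab=(\iota\otimes\varepsilon)T_2(a\otimes b)$;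 (4) there is an idempotent $E\in M(A\otimes A)$ with $T_1(A\otimes A)=E(A\otimes A)$, $T_2(A\otimes A)=(A\otimes A)E$ and $(\Delta\otimes\iota)E=(E\otimes1)(1\otimes E)=(1\otimes E)(E\otimes1)$; (5) $\operatorname{Ker}T_1=(1-G_1)(A\otimes A)$ and $\operatorname{Ker}T_2=(1-G_2)(A\otimes A)$, where $G_1,G_2$ are the linear maps on $A\otimes A$ with $(G_1\otimes\iota)(\Delta_{13}(a)(1\otimes b\otimes c))=\Delta_{13}(a)(1\otimes E)(1\otimes b\otimes c)$ and $(\iota\otimes G_2)((a\otimes b\otimes 1)\Delta_{13}(c))=(a\otimes b\otimes1)(E\otimes1)\Delta_{13}(c)$. Let $R_1,R_2$ be the unique linear maps on $A\otimes A$ with $T_1R_1=E\,\cdot\,$, $R_1T_1=G_1$, $R_1T_1R_1=R_1$ and $T_2R_2=\,\cdot\,E$, $R_2T_2=G_2$, $R_2T_2R_2=R_2$. The antipode $S$ is given by $S(a)b=(\varepsilon\otimes\iota)R_1(a\otimes b)$ and $bS(a)=(\iota\otimes\varepsilon)R_2(b\otimes a)$. The pair $(A,\Delta)$ is called regular if $S$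 is a bijective map from $A$ to itself. The source and target algebras are the images $\varepsilon_s(A),\varepsilon_t(A)\subseteq M(A)$ of the maps $\varepsilon_s(a)=\sum_{(a)}S(a_{(1)})a_{(2)}$ and $\varepsilon_t(a)=\sum_{(a)}a_{(1)}S(a_{(2)})$. Their multiplier algebras, in $M(A)$, are $A_s=\{y\in M(A): y\,\varepsilon_s(A)\subseteq\varepsilon_s(A),\ \varepsilon_s(A)\,y\subseteq\varepsilon_s(A)\}$ and, similarly, $A_t$. For a linear functional $\varphi$ on $A$ and $a\in A$, $(\iota\otimes\varphi)\Delta(a)$ is the multiplier $x$ of $A$ with $bx=(\iota\otimes\varphi)((b\otimes1)\Delta(a))$ and $xb=(\iota\otimes\varphi)(\Delta(a)(b\otimes1))$ for all $b$. A left integral is a non-zero linear functional $\varphi$ on $A$ such that $(\iota\otimes\varphi)\Delta(a)\in A_t$ for all $a\in A$. A linear functional $\varphi$ is faithful if $a=0$ whenever $\varphi(ab)=0$ for all $b\in A$, and also whenever $\varphi(ba)=0$ for all $b\in A$. **Proposition.** Let $(A,\Delta)$ be a regular weak multiplier Hopf algebra, and let $\varphi$ and $\varphi_1$ be left integrals on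 $A$ with $\varphi$ faithful. Then there is an element $y\in A_s$ such that $\varphi_1(x)=\varphi(xy)$ for all $x\in A$. -/

import Mathlib

open scoped TensorProduct

noncomputable section

namespace WMHopf

section Multipliers

variable {A B : Type*}
  [NonUnitalRing A] [Module ℂ A] [IsScalarTower ℂ A A] [SMulCommClass ℂ A A]
  [NonUnitalRing B] [Module ℂ B] [IsScalarTower ℂ B B] [SMulCommClass ℂ B B]

variable (A) in
/-- The multiplier algebra `M(A)`: a multiplier `m` is a pair of linear maps `b ↦ m b` and
`a ↦ a m` from `A` to `A` such that `(a m) b = a (m b)` for all `a, b`.  The product of multipliers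
is the composition (in the reversed order for the maps `a ↦ a m`). -/
def multiplierAlgebra : Subalgebra ℂ (Module.End ℂ A × (Module.End ℂ A)ᵐᵒᵖ) where
  carrier := {m | ∀ a b : A, (m.2.unop a) * b = a * (m.1 b)}
  mul_mem' := by
    intro m n hm hn a b
    simp only [Prod.snd_mul, Prod.fst_mul, MulOpposite.unop_mul, Module.End.mul_apply]
    rw [hn, hm]
  add_mem' := by
    intro m n hm hn a b
    simp only [Prod.snd_add, Prod.fst_add, MulOpposite.unop_add, LinearMap.add_apply]
    rw [add_mul, mul_add, hm, hn]
  algebraMap_mem' := by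
    intro r a b
    simp [Algebra.algebraMap_eq_smul_one, smul_mul_assoc, mul_smul_comm]

variable (A) in
/-- The multiplier algebra as a type. -/
abbrev Mult : Type _ := multiplierAlgebra A

/-- The map `b ↦ m b`. -/
def Mult.left (m : Mult A) : A →ₗ[ℂ] A := m.1.1

/-- The map `a ↦ a m`. -/
def Mult.right (m : Mult A) : A →ₗ[ℂ] A := m.1.2.unop

/-- A multiplier from its two actions. -/
def Mult.mk (l r : A →ₗ[ℂ] A) (h : ∀ a b, r a * b = a * l b) : Mult A :=
  ⟨(l, MulOpposite.op r), h⟩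

theorem Mult.compat (m : Mult A) (a b : A) : m.right a * b = a * m.left b := m.2 a b

theorem Mult.ext' {m n : Mult A} (hl : m.left = n.left) (hr : m.right = n.right) : m = n :=
  Subtype.ext (Prod.ext hl (MulOpposite.unop_injective hr))

variable (A) in
/-- The canonical map `A → M(A)`. -/
def incl : A →ₗ[ℂ] Mult A where
  toFun a := Mult.mk (LinearMap.mulLeft ℂ a) (LinearMap.mulRight ℂ a)
    (fun x y => by simp [mul_assoc])
  map_add' a b := Mult.ext' (by ext; simp [Mult.mk, Mult.left, add_mul])
    (by ext; simp [Mult.mk, Mult.right, mul_add])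
  map_smul' r a := Mult.ext' (by ext; simp [Mult.mk, Mult.left, smul_mul_assoc])
    (by ext; simp [Mult.mk, Mult.right, mul_smul_comm])

theorem tmul_compat (m : Mult A) (n : Mult B) (x y : A ⊗[ℂ] B) :
    TensorProduct.map m.right n.right x * y = x * TensorProduct.map m.left n.left y := by
  induction x with
  | zero => simp
  | add x x' hx hx' => simp only [map_add, add_mul, hx, hx']
  | tmul a b =>
    induction y with
    | zero => simp
    | add y y' hy hy' => simp only [map_add, mul_add, hy, hy']
    | tmul c d => simp [Mult.compat]

variable (A B) in
/-- The multiplier `m ⊗ n` of `A ⊗ B`, for multipliers `m` of `A` and `n` of `B`. -/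
def tmul : Mult A →ₗ[ℂ] Mult B →ₗ[ℂ] Mult (A ⊗[ℂ] B) :=
  LinearMap.mk₂ ℂ
    (fun m n => Mult.mk (TensorProduct.map m.left n.left) (TensorProduct.map m.right n.right)
      (tmul_compat m n))
    (fun _ _ _ => Mult.ext' (TensorProduct.map_add_left _ _ _) (TensorProduct.map_add_left _ _ _))
    (fun _ _ _ => Mult.ext' (TensorProduct.map_smul_left _ _ _) (TensorProduct.map_smul_left _ _ _))
    (fun _ _ _ => Mult.ext' (TensorProduct.map_add_right _ _ _)
      (TensorProduct.map_add_right _ _ _))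
    (fun _ _ _ => Mult.ext' (TensorProduct.map_smul_right _ _ _)
      (TensorProduct.map_smul_right _ _ _))

/-- Transport of multipliers along an isomorphism of algebras. -/
def Mult.transport (e : A ≃ₗ[ℂ] B) (he : ∀ x y, e (x * y) = e x * e y) (m : Mult A) : Mult B :=
  Mult.mk (e.toLinearMap ∘ₗ m.left ∘ₗ e.symm.toLinearMap)
    (e.toLinearMap ∘ₗ m.right ∘ₗ e.symm.toLinearMap) (fun x y => by
      have h := congrArg e (m.compat (e.symm x) (e.symm y))
      simpa [he] using h)

/-- For a subspace `B` of `M(A)`, the multipliers `y` with `y B ⊆ B` and `B y ⊆ B`.  If `B` is a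
subalgebra with `B A = A = A B`, then every multiplier of the algebra `B` extends uniquely to a
multiplier of `A`, and this is the copy of `M(B)` in `M(A)`. -/
def multipliersOf (B : Submodule ℂ (Mult A)) : Subalgebra ℂ (Mult A) where
  carrier := {y | ∀ x ∈ B, y * x ∈ B ∧ x * y ∈ B}
  mul_mem' := by
    intro y z hy hz x hx
    refine ⟨?_, ?_⟩
    · rw [mul_assoc]; exact (hy _ (hz x hx).1).1
    · rw [← mul_assoc]; exact (hz _ (hy x hx).2).2
  add_mem' := by
    intro y z hy hz x hx
    rw [add_mul, mul_add]
    exact ⟨B.add_mem (hy x hx).1 (hz x hx).1, B.add_mem (hy x hx).2 (hz x hx).2⟩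
  algebraMap_mem' := by
    intro r x hx
    rw [← Algebra.commutes, ← Algebra.smul_def]
    exact ⟨B.smul_mem r hx, B.smul_mem r hx⟩

end Multipliers

section Legs

variable {A : Type*} [AddCommGroup A] [Module ℂ A]

/-- The map `ι ⊗ ω : A ⊗ A → A`. -/
def sliceRight (ω : A →ₗ[ℂ] ℂ) : A ⊗[ℂ] A →ₗ[ℂ] A :=
  (TensorProduct.rid ℂ A).toLinearMap ∘ₗ LinearMap.lTensor A ω

/-- The map `ω ⊗ ι : A ⊗ A → A`. -/
def sliceLeft (ω : A →ₗ[ℂ] ℂ) : A ⊗[ℂ] A →ₗ[ℂ] A :=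
  (TensorProduct.lid ℂ A).toLinearMap ∘ₗ LinearMap.rTensor A ω

/-- A linear map on `A ⊗ A`, acting on the legs 1 and 2 of `A ⊗ A ⊗ A`. -/
def leg12 (f : A ⊗[ℂ] A →ₗ[ℂ] A ⊗[ℂ] A) : (A ⊗[ℂ] A) ⊗[ℂ] A →ₗ[ℂ] (A ⊗[ℂ] A) ⊗[ℂ] A :=
  LinearMap.rTensor A f

/-- A linear map on `A ⊗ A`, acting on the legs 2 and 3 of `A ⊗ A ⊗ A`. -/
def leg23 (f : A ⊗[ℂ] A →ₗ[ℂ] A ⊗[ℂ] A) : (A ⊗[ℂ] A) ⊗[ℂ] A →ₗ[ℂ] (A ⊗[ℂ] A) ⊗[ℂ] A :=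
  (TensorProduct.assoc ℂ A A A).symm.toLinearMap ∘ₗ LinearMap.lTensor A f ∘ₗ
    (TensorProduct.assoc ℂ A A A).toLinearMap

/-- A linear map on `A ⊗ A`, acting on the legs 1 and 3 of `A ⊗ A ⊗ A`. -/
def leg13 (f : A ⊗[ℂ] A →ₗ[ℂ] A ⊗[ℂ] A) : (A ⊗[ℂ] A) ⊗[ℂ] A →ₗ[ℂ] (A ⊗[ℂ] A) ⊗[ℂ] A :=
  (TensorProduct.rightComm ℂ A A A).toLinearMap ∘ₗ LinearMap.rTensor A f ∘ₗ
    (TensorProduct.rightComm ℂ A A A).toLinearMap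

end Legs

variable {A : Type*}
  [NonUnitalRing A] [Module ℂ A] [IsScalarTower ℂ A A] [SMulCommClass ℂ A A]

theorem assoc_symm_mul (x y : A ⊗[ℂ] (A ⊗[ℂ] A)) :
    (TensorProduct.assoc ℂ A A A).symm (x * y) =
      (TensorProduct.assoc ℂ A A A).symm x * (TensorProduct.assoc ℂ A A A).symm y := by
  induction x with
  | zero => simp
  | add x x' hx hx' => simp only [map_add, add_mul, hx, hx']
  | tmul a s =>
    induction y with
    | zero => simp
    | add y y' hy hy' => simp only [map_add, mul_add, hy, hy']
    | tmul b t =>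
      induction s with
      | zero => simp
      | add s s' hs hs' =>
        simp only [TensorProduct.tmul_add, add_mul, map_add, hs, hs']
      | tmul c d =>
        induction t with
        | zero => simp
        | add t t' ht ht' =>
          simp only [TensorProduct.tmul_add, mul_add, map_add, ht, ht']
        | tmul e f => simp

/-- The multiplier `E ⊗ 1` of `A ⊗ A ⊗ A`. -/
def tmulOne (E : Mult (A ⊗[ℂ] A)) : Mult ((A ⊗[ℂ] A) ⊗[ℂ] A) := tmul (A ⊗[ℂ] A) A E 1

/-- The multiplier `1 ⊗ E` of `A ⊗ A ⊗ A`. -/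
def oneTmul (E : Mult (A ⊗[ℂ] A)) : Mult ((A ⊗[ℂ] A) ⊗[ℂ] A) :=
  (tmul A (A ⊗[ℂ] A) 1 E).transport (TensorProduct.assoc ℂ A A A).symm assoc_symm_mul

/-- The map `Δ ⊗ ι : A ⊗ A → M(A ⊗ A ⊗ A)`. -/
def deltaId (Δ : A →ₙₐ[ℂ] Mult (A ⊗[ℂ] A)) : A ⊗[ℂ] A →ₗ[ℂ] Mult ((A ⊗[ℂ] A) ⊗[ℂ] A) :=
  TensorProduct.lift
    (((tmul (A ⊗[ℂ] A) A).compl₂ (incl A)) ∘ₗ (Δ : A →ₗ[ℂ] Mult (A ⊗[ℂ] A)))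

variable (A) in
/-- A weak multiplier Hopf algebra with underlying algebra `A`.  The datum is the coproduct `Δ`;
the canonical maps `T₁`, `T₂`, the counit `ε`, the canonical idempotent `E` and the projection maps
`G₁`, `G₂` are uniquely determined by `Δ` through the laws below. -/
structure WeakMultiplierHopfAlgebra where
  /-- The product of `A` is non-degenerate. -/
  nondeg_left : ∀ a : A, (∀ b : A, a * b = 0) → a = 0
  nondeg_right : ∀ a : A, (∀ b : A, b * a = 0) → a = 0
  /-- The algebra `A` is idempotent: it is spanned by products. -/
  idempotent : LinearMap.range (LinearMap.mul' ℂ A) = ⊤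
  /-- The coproduct, a homomorphism from `A` to `M(A ⊗ A)`. -/
  Δ : A →ₙₐ[ℂ] Mult (A ⊗[ℂ] A)
  /-- `T₁(a ⊗ b) = Δ(a)(1 ⊗ b)`, which is required to be in `A ⊗ A`. -/
  T₁ : A ⊗[ℂ] A →ₗ[ℂ] A ⊗[ℂ] A
  T₁_spec : ∀ a b : A, incl (A ⊗[ℂ] A) (T₁ (a ⊗ₜ b)) = Δ a * tmul A A 1 (incl A b)
  /-- `T₂(a ⊗ b) = (a ⊗ 1)Δ(b)`, which is required to be in `A ⊗ A`. -/
  T₂ : A ⊗[ℂ] A →ₗ[ℂ] A ⊗[ℂ] A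
  T₂_spec : ∀ a b : A, incl (A ⊗[ℂ] A) (T₂ (a ⊗ₜ b)) = tmul A A (incl A a) 1 * Δ b
  /-- Coassociativity:
  `(a ⊗ 1 ⊗ 1)(Δ ⊗ ι)(Δ(b)(1 ⊗ c)) = (ι ⊗ Δ)((a ⊗ 1)Δ(b))(1 ⊗ 1 ⊗ c)`. -/
  coassoc : leg12 T₂ ∘ₗ leg23 T₁ = leg23 T₁ ∘ₗ leg12 T₂
  /-- The coproduct is full: its left leg and its right leg are all of `A`. -/
  full_left : Submodule.span ℂ
    {x : A | ∃ (ω : A →ₗ[ℂ] ℂ) (a b : A), x = sliceRight ω (T₁ (a ⊗ₜ b))} = ⊤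
  full_right : Submodule.span ℂ
    {x : A | ∃ (ω : A →ₗ[ℂ] ℂ) (a b : A), x = sliceLeft ω (T₂ (a ⊗ₜ b))} = ⊤
  /-- The counit. -/
  ε : A →ₗ[ℂ] ℂ
  counit_left : ∀ a b : A, sliceLeft ε (T₁ (a ⊗ₜ b)) = a * b
  counit_right : ∀ a b : A, sliceRight ε (T₂ (a ⊗ₜ b)) = a * b
  /-- The canonical idempotent. -/
  E : Mult (A ⊗[ℂ] A)
  E_idem : E * E = E
  /-- `T₁(A ⊗ A) = E(A ⊗ A)` and `T₂(A ⊗ A) = (A ⊗ A)E`. -/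
  range_T₁ : LinearMap.range T₁ = LinearMap.range E.left
  range_T₂ : LinearMap.range T₂ = LinearMap.range E.right
  /-- `(Δ ⊗ ι)E = (E ⊗ 1)(1 ⊗ E) = (1 ⊗ E)(E ⊗ 1)`.  Here `(Δ ⊗ ι)E` is the unique multiplier `X`
  of `A ⊗ A ⊗ A` with `X = X(E ⊗ 1) = (E ⊗ 1)X`, with `X (Δ ⊗ ι)(z) = (Δ ⊗ ι)(E z)` and with
  `(Δ ⊗ ι)(z) X = (Δ ⊗ ι)(z E)` for all `z` in `A ⊗ A`. -/
  E_comm : tmulOne E * oneTmul E = oneTmul E * tmulOne E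
  delta_E_left : ∀ z : A ⊗[ℂ] A,
    tmulOne E * oneTmul E * deltaId Δ z = deltaId Δ (E.left z)
  delta_E_right : ∀ z : A ⊗[ℂ] A,
    deltaId Δ z * (tmulOne E * oneTmul E) = deltaId Δ (E.right z)
  /-- `(G₁ ⊗ ι)(Δ₁₃(a)(1 ⊗ b ⊗ c)) = Δ₁₃(a)(1 ⊗ E)(1 ⊗ b ⊗ c)`, and `Ker T₁ = (1 - G₁)(A ⊗ A)`. -/
  G₁ : A ⊗[ℂ] A →ₗ[ℂ] A ⊗[ℂ] A
  G₁_spec : leg12 G₁ ∘ₗ leg13 T₁ = leg13 T₁ ∘ₗ leg23 E.left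
  ker_T₁ : LinearMap.ker T₁ = LinearMap.range (LinearMap.id - G₁)
  /-- `(ι ⊗ G₂)((a ⊗ b ⊗ 1)Δ₁₃(c)) = (a ⊗ b ⊗ 1)(E ⊗ 1)Δ₁₃(c)`, and
  `Ker T₂ = (1 - G₂)(A ⊗ A)`. -/
  G₂ : A ⊗[ℂ] A →ₗ[ℂ] A ⊗[ℂ] A
  G₂_spec : leg23 G₂ ∘ₗ leg13 T₂ = leg13 T₂ ∘ₗ leg12 E.right
  ker_T₂ : LinearMap.ker T₂ = LinearMap.range (LinearMap.id - G₂)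

/-- A linear map `T` with range the range of an idempotent `P`, and with kernel the range of
`1 - G` for an idempotent `G`, has a unique generalized inverse for these two idempotents. -/
theorem existsUnique_generalizedInverse {V : Type*} [AddCommGroup V] [Module ℂ V]
    (T P G : V →ₗ[ℂ] V) (hP : P ∘ₗ P = P) (hG : G ∘ₗ G = G)
    (hr : LinearMap.range T = LinearMap.range P)
    (hk : LinearMap.ker T = LinearMap.range (LinearMap.id - G)) :
    ∃! R : V →ₗ[ℂ] V, T ∘ₗ R = P ∧ R ∘ₗ T = G ∧ R ∘ₗ T ∘ₗ R = R := by
  have hPT : ∀ w, P (T w) = T w := by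
    intro w
    obtain ⟨u, hu⟩ : T w ∈ LinearMap.range P := hr ▸ LinearMap.mem_range_self T w
    rw [← hu]; exact LinearMap.congr_fun hP u
  have hTG : ∀ w, T (G w) = T w := by
    intro w
    have : w - G w ∈ LinearMap.ker T := by
      rw [hk]; exact ⟨w, by simp⟩
    have h2 : T (w - G w) = 0 := this
    rw [map_sub, sub_eq_zero] at h2
    exact h2.symm
  have hGk : ∀ w, T w = 0 → G w = 0 := by
    intro w hw
    have : w ∈ LinearMap.range (LinearMap.id - G) := by rw [← hk]; exact hw
    obtain ⟨u, rfl⟩ := this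
    have h3 : G (G u) = G u := LinearMap.congr_fun hG u
    simp [h3]
  have hGG : ∀ w, G (G w) = G w := fun w => LinearMap.congr_fun hG w
  obtain ⟨s, hs⟩ := LinearMap.exists_rightInverse_of_surjective T.rangeRestrict
    (LinearMap.range_rangeRestrict T)
  have hs' : ∀ v : LinearMap.range T, T (s v) = v := fun v =>
    congrArg Subtype.val (LinearMap.congr_fun hs v)
  have hmem : ∀ z, P z ∈ LinearMap.range T := fun z => hr ▸ LinearMap.mem_range_self P z
  refine ⟨G ∘ₗ s ∘ₗ P.codRestrict _ hmem, ⟨?_, ?_, ?_⟩, ?_⟩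
  · ext z
    simp [hTG, hs']
  · ext w
    have h4 : T (s (P.codRestrict _ hmem (T w)) - w) = 0 := by
      rw [map_sub, hs']; simp [hPT]
    have h5 := hGk _ h4
    rw [map_sub, sub_eq_zero] at h5
    exact h5
  · ext z
    have h6 : ∀ w, G (s (P.codRestrict _ hmem (T w))) = G w := by
      intro w
      have h4 : T (s (P.codRestrict _ hmem (T w)) - w) = 0 := by
        rw [map_sub, hs']; simp [hPT]
      have h5 := hGk _ h4
      rw [map_sub, sub_eq_zero] at h5
      exact h5
    simp only [LinearMap.comp_apply]
    rw [h6, hGG]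
  · rintro R' ⟨h1, h2, h3⟩
    have hz : ∀ z, R' z = G (R' z) := fun z => by
      rw [← h2]; exact (LinearMap.congr_fun h3 z).symm
    ext z
    have h4 : T (R' z - s (P.codRestrict _ hmem z)) = 0 := by
      rw [map_sub, hs']
      have := LinearMap.congr_fun h1 z
      simp only [LinearMap.comp_apply] at this
      simp [this]
    have h5 := hGk _ h4
    rw [map_sub, sub_eq_zero] at h5
    rw [hz z, h5]; rfl

namespace WeakMultiplierHopfAlgebra

variable (H : WeakMultiplierHopfAlgebra A)

theorem G₁_idem : H.G₁ ∘ₗ H.G₁ = H.G₁ := by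
  have hE : leg23 H.E.left ∘ₗ leg23 H.E.left = leg23 H.E.left := by
    have h1 : H.E.left ∘ₗ H.E.left = H.E.left := congrArg Mult.left H.E_idem
    have h2 : ∀ z, LinearMap.lTensor A H.E.left (LinearMap.lTensor A H.E.left z) =
        LinearMap.lTensor A H.E.left z := fun z => by
      rw [← LinearMap.comp_apply, ← LinearMap.lTensor_comp, h1]
    apply LinearMap.ext; intro z
    simp [leg23, h2]
  have hsp := H.G₁_spec
  have key : leg12 H.G₁ ∘ₗ leg12 H.G₁ ∘ₗ leg13 H.T₁ = leg12 H.G₁ ∘ₗ leg13 H.T₁ := by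
    rw [hsp, ← LinearMap.comp_assoc, hsp, LinearMap.comp_assoc, hE]
  have slice : ∀ (G : A ⊗[ℂ] A →ₗ[ℂ] A ⊗[ℂ] A) (ω : A →ₗ[ℂ] ℂ) (z : A ⊗[ℂ] A) (b : A),
      TensorProduct.rid ℂ (A ⊗[ℂ] A) (LinearMap.lTensor (A ⊗[ℂ] A) ω
        (leg12 G (TensorProduct.rightComm ℂ A A A (z ⊗ₜ b)))) = G (sliceRight ω z ⊗ₜ b) := by
    intro G ω z b
    induction z with
    | zero => simp
    | add z z' hz hz' => simp only [TensorProduct.add_tmul, map_add, hz, hz']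
    | tmul p q =>
      have h : (ω q • p) ⊗ₜ[ℂ] b = ω q • (p ⊗ₜ[ℂ] b) := TensorProduct.smul_tmul' _ _ _
      simp [leg12, sliceRight, h]
  have hx : ∀ (x b : A), H.G₁ (H.G₁ (x ⊗ₜ b)) = H.G₁ (x ⊗ₜ b) := by
    intro x b
    have hxs : x ∈ Submodule.span ℂ
      {x : A | ∃ (ω : A →ₗ[ℂ] ℂ) (a b : A), x = sliceRight ω (H.T₁ (a ⊗ₜ b))} := by
      rw [H.full_left]; trivial
    induction hxs using Submodule.span_induction with
    | mem x hx =>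
      obtain ⟨ω, a, c, rfl⟩ := hx
      have := congrArg (fun t => TensorProduct.rid ℂ (A ⊗[ℂ] A)
        (LinearMap.lTensor (A ⊗[ℂ] A) ω t)) (LinearMap.congr_fun key ((a ⊗ₜ b) ⊗ₜ c))
      have e1 : leg13 H.T₁ ((a ⊗ₜ b) ⊗ₜ c) =
        TensorProduct.rightComm ℂ A A A (H.T₁ (a ⊗ₜ c) ⊗ₜ b) := by simp [leg13]
      have e2 : ∀ z, leg12 H.G₁ (leg12 H.G₁ z) = leg12 (H.G₁ ∘ₗ H.G₁) z := fun z => by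
        simp [leg12, LinearMap.rTensor_comp]
      simp only [LinearMap.comp_apply, e2, e1, slice] at this
      exact this
    | zero => simp
    | add x y _ _ hx hy => simp only [TensorProduct.add_tmul, map_add, hx, hy]
    | smul r x _ hx => simp only [← TensorProduct.smul_tmul', map_smul, hx]
  ext x b
  exact hx x b

theorem G₂_idem : H.G₂ ∘ₗ H.G₂ = H.G₂ := by
  have hE : leg12 H.E.right ∘ₗ leg12 H.E.right = leg12 H.E.right := by
    have h1 : H.E.right ∘ₗ H.E.right = H.E.right := congrArg Mult.right H.E_idem
    rw [leg12, ← LinearMap.rTensor_comp, h1]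
  have hsp := H.G₂_spec
  have key : leg23 H.G₂ ∘ₗ leg23 H.G₂ ∘ₗ leg13 H.T₂ = leg23 H.G₂ ∘ₗ leg13 H.T₂ := by
    rw [hsp, ← LinearMap.comp_assoc, hsp, LinearMap.comp_assoc, hE]
  have slice : ∀ (G : A ⊗[ℂ] A →ₗ[ℂ] A ⊗[ℂ] A) (ω : A →ₗ[ℂ] ℂ) (z : A ⊗[ℂ] A) (b : A),
      TensorProduct.lid ℂ (A ⊗[ℂ] A) (LinearMap.rTensor (A ⊗[ℂ] A) ω
        (TensorProduct.assoc ℂ A A A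
          (leg23 G (TensorProduct.rightComm ℂ A A A (z ⊗ₜ b))))) = G (b ⊗ₜ sliceLeft ω z) := by
    intro G ω z b
    induction z with
    | zero => simp
    | add z z' hz hz' => simp only [TensorProduct.add_tmul, TensorProduct.tmul_add, map_add, hz, hz']
    | tmul p q => simp [leg23, sliceLeft]
  have hx : ∀ (x b : A), H.G₂ (H.G₂ (b ⊗ₜ x)) = H.G₂ (b ⊗ₜ x) := by
    intro x b
    have hxs : x ∈ Submodule.span ℂ
      {x : A | ∃ (ω : A →ₗ[ℂ] ℂ) (a b : A), x = sliceLeft ω (H.T₂ (a ⊗ₜ b))} := by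
      rw [H.full_right]; trivial
    induction hxs using Submodule.span_induction with
    | mem x hx =>
      obtain ⟨ω, a, c, rfl⟩ := hx
      have := congrArg (fun t => TensorProduct.lid ℂ (A ⊗[ℂ] A)
        (LinearMap.rTensor (A ⊗[ℂ] A) ω (TensorProduct.assoc ℂ A A A t)))
        (LinearMap.congr_fun key ((a ⊗ₜ b) ⊗ₜ c))
      have e1 : leg13 H.T₂ ((a ⊗ₜ b) ⊗ₜ c) =
        TensorProduct.rightComm ℂ A A A (H.T₂ (a ⊗ₜ c) ⊗ₜ b) := by simp [leg13]
      have e2 : ∀ z, leg23 H.G₂ (leg23 H.G₂ z) = leg23 (H.G₂ ∘ₗ H.G₂) z := fun z => by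
        simp [leg23, LinearMap.lTensor_comp]
      simp only [LinearMap.comp_apply, e2, e1, slice] at this
      exact this
    | zero => simp
    | add x y _ _ hx hy => simp only [TensorProduct.tmul_add, map_add, hx, hy]
    | smul r x _ hx => simp only [TensorProduct.tmul_smul, map_smul, hx]
  ext b x
  exact hx x b

theorem existsUnique_R₁ : ∃! R : A ⊗[ℂ] A →ₗ[ℂ] A ⊗[ℂ] A,
    H.T₁ ∘ₗ R = H.E.left ∧ R ∘ₗ H.T₁ = H.G₁ ∧ R ∘ₗ H.T₁ ∘ₗ R = R :=
  existsUnique_generalizedInverse H.T₁ H.E.left H.G₁ (congrArg Mult.left H.E_idem) H.G₁_idem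
    H.range_T₁ H.ker_T₁

theorem existsUnique_R₂ : ∃! R : A ⊗[ℂ] A →ₗ[ℂ] A ⊗[ℂ] A,
    H.T₂ ∘ₗ R = H.E.right ∧ R ∘ₗ H.T₂ = H.G₂ ∧ R ∘ₗ H.T₂ ∘ₗ R = R :=
  existsUnique_generalizedInverse H.T₂ H.E.right H.G₂ (congrArg Mult.right H.E_idem) H.G₂_idem
    H.range_T₂ H.ker_T₂

/-- The generalized inverse of `T₁`; in Sweedler notation `R₁(a ⊗ b) = ∑ a₁ ⊗ S(a₂)b`. -/
def R₁ : A ⊗[ℂ] A →ₗ[ℂ] A ⊗[ℂ] A := H.existsUnique_R₁.choose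

/-- The generalized inverse of `T₂`; in Sweedler notation `R₂(a ⊗ b) = ∑ a S(b₁) ⊗ b₂`. -/
def R₂ : A ⊗[ℂ] A →ₗ[ℂ] A ⊗[ℂ] A := H.existsUnique_R₂.choose

/-- The antipode `S`, as a multiplier acting from the left: the map `a ⊗ b ↦ S(a)b`, given by
`S(a)b = (ε ⊗ ι)R₁(a ⊗ b)`. -/
def antipodeLeft : A ⊗[ℂ] A →ₗ[ℂ] A := sliceLeft H.ε ∘ₗ H.R₁

/-- The antipode `S`, as a multiplier acting from the right: the map `b ⊗ a ↦ b S(a)`, given by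
`b S(a) = (ι ⊗ ε)R₂(b ⊗ a)`. -/
def antipodeRight : A ⊗[ℂ] A →ₗ[ℂ] A := sliceRight H.ε ∘ₗ H.R₂

/-- A weak multiplier Hopf algebra is regular if its antipode is a bijective map from `A` to
itself. -/
def IsRegular : Prop :=
  ∃ S : A ≃ₗ[ℂ] A, ∀ a b : A,
    H.antipodeLeft (a ⊗ₜ b) = S a * b ∧ H.antipodeRight (b ⊗ₜ a) = b * S a

/-- The source algebra `ε_s(A)`: the multipliers `x = ε_s(a) = ∑ S(a₁)a₂`, that is
`x b = ∑ S(a₁)(a₂ b)` for all `b`, with `a` in `A`. -/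
def sourceAlgebra : Submodule ℂ (Mult A) where
  carrier := {x | ∃ a : A, ∀ b : A, x.left b = H.antipodeLeft (H.T₁ (a ⊗ₜ b))}
  zero_mem' := ⟨0, fun b => by simp [Mult.left]⟩
  add_mem' := by
    rintro x y ⟨a, ha⟩ ⟨a', ha'⟩
    refine ⟨a + a', fun b => ?_⟩
    rw [TensorProduct.add_tmul, map_add, map_add, ← ha, ← ha']; rfl
  smul_mem' := by
    rintro r x ⟨a, ha⟩
    refine ⟨r • a, fun b => ?_⟩
    rw [← TensorProduct.smul_tmul', map_smul, map_smul, ← ha]; rfl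

/-- The target algebra `ε_t(A)`: the multipliers `x = ε_t(a) = ∑ a₁S(a₂)`, that is
`b x = ∑ (b a₁)S(a₂)` for all `b`, with `a` in `A`. -/
def targetAlgebra : Submodule ℂ (Mult A) where
  carrier := {x | ∃ a : A, ∀ b : A, x.right b = H.antipodeRight (H.T₂ (b ⊗ₜ a))}
  zero_mem' := ⟨0, fun b => by simp [Mult.right]⟩
  add_mem' := by
    rintro x y ⟨a, ha⟩ ⟨a', ha'⟩
    refine ⟨a + a', fun b => ?_⟩
    rw [TensorProduct.tmul_add, map_add, map_add, ← ha, ← ha']; rfl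
  smul_mem' := by
    rintro r x ⟨a, ha⟩
    refine ⟨r • a, fun b => ?_⟩
    rw [TensorProduct.tmul_smul, map_smul, map_smul, ← ha]; rfl

/-- The multiplier algebra `A_s = M(ε_s(A))` of the source algebra, inside `M(A)`. -/
def As : Subalgebra ℂ (Mult A) := multipliersOf H.sourceAlgebra

/-- The multiplier algebra `A_t = M(ε_t(A))` of the target algebra, inside `M(A)`. -/
def At : Subalgebra ℂ (Mult A) := multipliersOf H.targetAlgebra

/-- The multiplier `x` of `A` is `(ι ⊗ ω)Δ(a)`: for all `b` we have
`b x = (ι ⊗ ω)((b ⊗ 1)Δ(a))` and `x b = (ι ⊗ ω)(Δ(a)(b ⊗ 1))`. -/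
def IsRightSlice (ω : A →ₗ[ℂ] ℂ) (a : A) (x : Mult A) : Prop :=
  (∀ b : A, x.right b = sliceRight ω (H.T₂ (b ⊗ₜ a))) ∧
  ∀ b : A, ∃ z : A ⊗[ℂ] A,
    incl (A ⊗[ℂ] A) z = H.Δ a * tmul A A (incl A b) 1 ∧ x.left b = sliceRight ω z

/-- A linear functional `φ` is left invariant if `(ι ⊗ φ)Δ(a)` is in `A_t` for all `a`. -/
def IsLeftInvariant (φ : A →ₗ[ℂ] ℂ) : Prop :=
  ∀ a : A, ∃ x ∈ H.At, H.IsRightSlice φ a x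

/-- A left integral is a non-zero left invariant linear functional. -/
def IsLeftIntegral (φ : A →ₗ[ℂ] ℂ) : Prop := φ ≠ 0 ∧ H.IsLeftInvariant φ

end WeakMultiplierHopfAlgebra

/-- A linear functional `φ` is faithful if `a = 0` whenever `φ(ab) = 0` for all `b`, and also
whenever `φ(ba) = 0` for all `b`. -/
def IsFaithful (φ : A →ₗ[ℂ] ℂ) : Prop :=
  ∀ a : A, ((∀ b : A, φ (a * b) = 0) ∨ (∀ b : A, φ (b * a) = 0)) → a = 0

end WMHopf

end

noncomputable section

namespace WMHopf

/-! ### Separation of tensors by functionals on one leg. -/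

section Separation

variable {V W : Type*} [AddCommGroup V] [Module ℂ V] [AddCommGroup W] [Module ℂ W]

/-! Put ψ = φ∘S. Left invariance implies strong invariance: S((ι⊗φ)(Δ(a)(1⊗b))) = (ι⊗φ)((1⊗a)Δ(b))
(`LeftInvariant.mul_S_tau`), with a mirror form for ψ (`LeftInvariant.S_lam_mul`). Pairing the two
legs of one tensor with ψ and φ₁, and using one formula for each, gives explicit p and q with φ₁(·
p) = ψ(· q), and others with φ₁(p ·) = ψ(· q) (`mulRight_S_symm`, `mulLeft_S`). As φ is faithful,
the p span A, so all functionals φ₁(· p) and φ₁(p ·) have the form ψ(· q). For φ₁ = φ the q span A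
too, so the spaces φ(· A), ψ(· A) and φ(A ·) coincide.

Hence each p has a unique θ(p) with φ₁(· p) = φ(· θ(p)). Comparison with the functionals φ₁(p ·)
shows that θ is the right action of a multiplier y, and φ₁ = φ(· y) follows from A² = A
(`exists_multiplier`).

It remains to see that y is in A_s. Strong invariance of both integrals and faithfulness of φ give
Δ(by) = Δ(b)(1⊗y) (`T₂_tmul_right`), so that ε_s(a)y = ε_s(ay). It also follows that y commutes with
the target algebra, so 1⊗y commutes with E and Δ(yx) = (1⊗y)Δ(x) (`T₁_left_tmul`). Through the
antipode this becomes yε_s(a) = ε_s(S⁻¹(yS(a))) (`left_esL`).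

Sweedler notation is replaced by linear maps on tensor powers. `CanonicalMaps` and `HopfMaps` are
symmetric under `op`, so mirror images of statements need no second proof. The axioms describe E
under Δ⊗ι only; the relations for ι⊗Δ are derived. The antipode is shown to reverse products
(`S_mul_mul`) and coproducts (`T₁_S`). -/

theorem eq_zero_of_forall_functional (v : V) (h : ∀ ξ : V →ₗ[ℂ] ℂ, ξ v = 0) : v = 0 :=
  (Module.forall_dual_apply_eq_zero_iff ℂ v).1 h

theorem functional_eq_zero_of_span {s : Set V} (hs : Submodule.span ℂ s = ⊤)
    {U : Type*} [AddCommGroup U] [Module ℂ U] {f : V →ₗ[ℂ] U} (h : ∀ v ∈ s, f v = 0) : f = 0 :=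
  LinearMap.ext_on hs (fun v hv => by simpa using h v hv)

/-- A set of vectors spans if only the zero functional vanishes on it. -/
theorem span_eq_top_of_functional {s : Set V}
    (h : ∀ ξ : V →ₗ[ℂ] ℂ, (∀ v ∈ s, ξ v = 0) → ξ = 0) : Submodule.span ℂ s = ⊤ := by
  by_contra hne
  obtain ⟨f, hf, hle⟩ := Submodule.exists_le_ker_of_lt_top _ (lt_top_iff_ne_top.2 hne)
  exact hf (h f fun v hv => hle (Submodule.subset_span hv))

theorem functional_slice_comm (ξ : V →ₗ[ℂ] ℂ) (ω : W →ₗ[ℂ] ℂ) (z : V ⊗[ℂ] W) :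
    ω (TensorProduct.lid ℂ W (LinearMap.rTensor W ξ z)) =
      ξ (TensorProduct.rid ℂ V (LinearMap.lTensor V ω z)) := by
  induction z with
  | zero => simp
  | add x y hx hy => simp only [map_add, hx, hy]
  | tmul a b => simp [mul_comm]

/-- In a basis of V, the coefficients of z are its slices by the coordinate functionals. -/
theorem eq_zero_of_rTensor_functional (z : V ⊗[ℂ] W)
    (h : ∀ ξ : V →ₗ[ℂ] ℂ, TensorProduct.lid ℂ W (LinearMap.rTensor W ξ z) = 0) : z = 0 := by
  classical
  let b := Module.Basis.ofVectorSpace ℂ V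
  apply (TensorProduct.equivFinsuppOfBasisLeft b).injective
  rw [map_zero]
  ext i
  have key : ∀ z : V ⊗[ℂ] W, TensorProduct.equivFinsuppOfBasisLeft b z i =
      TensorProduct.lid ℂ W (LinearMap.rTensor W (b.coord i) z) := by
    intro z
    induction z with
    | zero => simp
    | add x y hx hy => simp only [map_add, Finsupp.add_apply, hx, hy]
    | tmul x y => simp
  rw [key, h, Finsupp.zero_apply]

/-- The point is that the family need not contain all functionals. It is applied to the functionals
ρ(c ·), which separate by non-degeneracy, and to φ(c ·), which separate by faithfulness. -/
theorem eq_zero_of_separating_right {ι : Type*} (F : ι → W →ₗ[ℂ] ℂ)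
    (hF : ∀ w, (∀ i, F i w = 0) → w = 0) (z : V ⊗[ℂ] W)
    (h : ∀ i, TensorProduct.rid ℂ V (LinearMap.lTensor V (F i) z) = 0) : z = 0 :=
  eq_zero_of_rTensor_functional z fun ξ => hF _ fun i => by
    rw [functional_slice_comm, h, map_zero]

theorem eq_zero_of_separating_left {ι : Type*} (F : ι → V →ₗ[ℂ] ℂ)
    (hF : ∀ v, (∀ i, F i v = 0) → v = 0) (z : V ⊗[ℂ] W)
    (h : ∀ i, TensorProduct.lid ℂ W (LinearMap.rTensor W (F i) z) = 0) : z = 0 := by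
  refine eq_zero_of_rTensor_functional z fun ξ => ?_
  refine eq_zero_of_forall_functional _ fun ω => ?_
  rw [functional_slice_comm]
  have : TensorProduct.rid ℂ V (LinearMap.lTensor V ω z) = 0 := hF _ fun i => by
    rw [← functional_slice_comm, h, map_zero]
  rw [this, map_zero]

end Separation

/-! ### Slices, leg numbering and flips. -/

section Slices

variable {A : Type*} [AddCommGroup A] [Module ℂ A]

@[simp] theorem sliceLeft_tmul (ω : A →ₗ[ℂ] ℂ) (a b : A) : sliceLeft ω (a ⊗ₜ b) = ω a • b := by
  simp [sliceLeft]

@[simp] theorem sliceRight_tmul (ω : A →ₗ[ℂ] ℂ) (a b : A) : sliceRight ω (a ⊗ₜ b) = ω b • a := by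
  simp [sliceRight]

@[simp] theorem leg12_tmul (f : A ⊗[ℂ] A →ₗ[ℂ] A ⊗[ℂ] A) (z : A ⊗[ℂ] A) (c : A) :
    leg12 f (z ⊗ₜ c) = f z ⊗ₜ c := by simp [leg12]

@[simp] theorem leg23_tmul (f : A ⊗[ℂ] A →ₗ[ℂ] A ⊗[ℂ] A) (a b c : A) :
    leg23 f ((a ⊗ₜ b) ⊗ₜ c) = (TensorProduct.assoc ℂ A A A).symm (a ⊗ₜ f (b ⊗ₜ c)) := by
  simp [leg23]

@[simp] theorem leg23_assoc_symm (f : A ⊗[ℂ] A →ₗ[ℂ] A ⊗[ℂ] A) (a : A) (z : A ⊗[ℂ] A) :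
    leg23 f ((TensorProduct.assoc ℂ A A A).symm (a ⊗ₜ z)) =
      (TensorProduct.assoc ℂ A A A).symm (a ⊗ₜ f z) := by
  simp [leg23]

@[simp] theorem leg13_tmul (f : A ⊗[ℂ] A →ₗ[ℂ] A ⊗[ℂ] A) (a b c : A) :
    leg13 f ((a ⊗ₜ b) ⊗ₜ c) = TensorProduct.rightComm ℂ A A A (f (a ⊗ₜ c) ⊗ₜ b) := by
  simp [leg13]

@[simp] theorem leg13_rightComm (f : A ⊗[ℂ] A →ₗ[ℂ] A ⊗[ℂ] A) (b : A) (z : A ⊗[ℂ] A) :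
    leg13 f (TensorProduct.rightComm ℂ A A A (z ⊗ₜ b)) =
      TensorProduct.rightComm ℂ A A A (f z ⊗ₜ b) := by
  have h : ∀ w : (A ⊗[ℂ] A) ⊗[ℂ] A,
      TensorProduct.rightComm ℂ A A A (TensorProduct.rightComm ℂ A A A w) = w :=
    fun w => (TensorProduct.rightComm ℂ A A A).symm_apply_apply w
  simp [leg13, h]

theorem leg12_mul (f g : Module.End ℂ (A ⊗[ℂ] A)) : leg12 (f * g) = leg12 f * leg12 g := by
  ext a b c; simp

theorem leg23_mul (f g : Module.End ℂ (A ⊗[ℂ] A)) : leg23 (f * g) = leg23 f * leg23 g := by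
  ext a b c; simp

theorem leg13_mul (f g : Module.End ℂ (A ⊗[ℂ] A)) : leg13 (f * g) = leg13 f * leg13 g := by
  ext a b c; simp

/-- The map `ρ ⊗ ι ⊗ ι`. -/
def slice1 (ρ : A →ₗ[ℂ] ℂ) : (A ⊗[ℂ] A) ⊗[ℂ] A →ₗ[ℂ] A ⊗[ℂ] A :=
  LinearMap.rTensor A (sliceLeft ρ)

/-- The map `ι ⊗ ι ⊗ ω`. -/
def slice3 (ω : A →ₗ[ℂ] ℂ) : (A ⊗[ℂ] A) ⊗[ℂ] A →ₗ[ℂ] A ⊗[ℂ] A :=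
  (TensorProduct.rid ℂ (A ⊗[ℂ] A)).toLinearMap ∘ₗ LinearMap.lTensor (A ⊗[ℂ] A) ω

@[simp] theorem slice1_tmul (ρ : A →ₗ[ℂ] ℂ) (z : A ⊗[ℂ] A) (c : A) :
    slice1 ρ (z ⊗ₜ c) = sliceLeft ρ z ⊗ₜ c := by simp [slice1]

@[simp] theorem slice3_tmul (ω : A →ₗ[ℂ] ℂ) (z : A ⊗[ℂ] A) (c : A) :
    slice3 ω (z ⊗ₜ c) = ω c • z := by simp [slice3]

@[simp] theorem slice1_assoc_symm (ρ : A →ₗ[ℂ] ℂ) (a : A) (z : A ⊗[ℂ] A) :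
    slice1 ρ ((TensorProduct.assoc ℂ A A A).symm (a ⊗ₜ z)) = ρ a • z := by
  induction z with
  | zero => simp
  | add x y hx hy => simp only [TensorProduct.tmul_add, map_add, hx, hy, smul_add]
  | tmul x y => simp [TensorProduct.smul_tmul']

@[simp] theorem slice3_assoc_symm (ω : A →ₗ[ℂ] ℂ) (a : A) (z : A ⊗[ℂ] A) :
    slice3 ω ((TensorProduct.assoc ℂ A A A).symm (a ⊗ₜ z)) = a ⊗ₜ sliceRight ω z := by
  induction z with
  | zero => simp
  | add x y hx hy => simp only [TensorProduct.tmul_add, map_add, hx, hy]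
  | tmul x y => simp

@[simp] theorem slice1_rightComm (ρ : A →ₗ[ℂ] ℂ) (b : A) (z : A ⊗[ℂ] A) :
    slice1 ρ (TensorProduct.rightComm ℂ A A A (z ⊗ₜ b)) = b ⊗ₜ sliceLeft ρ z := by
  induction z with
  | zero => simp
  | add x y hx hy => simp only [TensorProduct.tmul_add, TensorProduct.add_tmul, map_add, hx, hy]
  | tmul x y => simp [TensorProduct.smul_tmul]

@[simp] theorem slice3_rightComm (ω : A →ₗ[ℂ] ℂ) (b : A) (z : A ⊗[ℂ] A) :
    slice3 ω (TensorProduct.rightComm ℂ A A A (z ⊗ₜ b)) = sliceRight ω z ⊗ₜ b := by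
  induction z with
  | zero => simp
  | add x y hx hy => simp only [TensorProduct.add_tmul, map_add, hx, hy]
  | tmul x y => simp [TensorProduct.smul_tmul']

theorem slice3_leg12 (ω : A →ₗ[ℂ] ℂ) (f : A ⊗[ℂ] A →ₗ[ℂ] A ⊗[ℂ] A) (w : (A ⊗[ℂ] A) ⊗[ℂ] A) :
    slice3 ω (leg12 f w) = f (slice3 ω w) := by
  induction w with
  | zero => simp
  | add x y hx hy => simp only [map_add, hx, hy]
  | tmul x y => simp

theorem slice1_leg23 (ρ : A →ₗ[ℂ] ℂ) (f : A ⊗[ℂ] A →ₗ[ℂ] A ⊗[ℂ] A) (w : (A ⊗[ℂ] A) ⊗[ℂ] A) :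
    slice1 ρ (leg23 f w) = f (slice1 ρ w) := by
  obtain ⟨w, rfl⟩ := (TensorProduct.assoc ℂ A A A).symm.surjective w
  induction w with
  | zero => simp
  | add x y hx hy => simp only [map_add, hx, hy]
  | tmul x y => simp

theorem sliceLeft_rTensor (ρ : A →ₗ[ℂ] ℂ) (f : A →ₗ[ℂ] A) (z : A ⊗[ℂ] A) :
    sliceLeft ρ (LinearMap.rTensor A f z) = sliceLeft (ρ ∘ₗ f) z := by
  simp [sliceLeft, LinearMap.rTensor_comp]

theorem sliceRight_lTensor (ρ : A →ₗ[ℂ] ℂ) (f : A →ₗ[ℂ] A) (z : A ⊗[ℂ] A) :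
    sliceRight ρ (LinearMap.lTensor A f z) = sliceRight (ρ ∘ₗ f) z := by
  simp [sliceRight, LinearMap.lTensor_comp]

theorem sliceLeft_lTensor (ρ : A →ₗ[ℂ] ℂ) (f : A →ₗ[ℂ] A) (z : A ⊗[ℂ] A) :
    sliceLeft ρ (LinearMap.lTensor A f z) = f (sliceLeft ρ z) := by
  induction z with
  | zero => simp
  | add x y hx hy => simp only [map_add, hx, hy]
  | tmul x y => simp

theorem sliceRight_rTensor (ρ : A →ₗ[ℂ] ℂ) (f : A →ₗ[ℂ] A) (z : A ⊗[ℂ] A) :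
    sliceRight ρ (LinearMap.rTensor A f z) = f (sliceRight ρ z) := by
  induction z with
  | zero => simp
  | add x y hx hy => simp only [map_add, hx, hy]
  | tmul x y => simp

theorem functional_sliceLeft (ξ ω : A →ₗ[ℂ] ℂ) (z : A ⊗[ℂ] A) :
    ω (sliceLeft ξ z) = ξ (sliceRight ω z) :=
  functional_slice_comm ξ ω z

theorem sliceLeft_ext {ι : Type*} (F : ι → A →ₗ[ℂ] ℂ) (hF : ∀ a, (∀ i, F i a = 0) → a = 0)
    {z w : A ⊗[ℂ] A} (h : ∀ i, sliceLeft (F i) z = sliceLeft (F i) w) : z = w :=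
  sub_eq_zero.1 (eq_zero_of_separating_left F hF _ fun i => by
    have := h i
    rw [← sub_eq_zero, ← map_sub] at this
    exact this)

theorem sliceRight_ext {ι : Type*} (F : ι → A →ₗ[ℂ] ℂ) (hF : ∀ a, (∀ i, F i a = 0) → a = 0)
    {z w : A ⊗[ℂ] A} (h : ∀ i, sliceRight (F i) z = sliceRight (F i) w) : z = w :=
  sub_eq_zero.1 (eq_zero_of_separating_right F hF _ fun i => by
    have := h i
    rw [← sub_eq_zero, ← map_sub] at this
    exact this)

theorem slice3_ext {ι : Type*} (F : ι → A →ₗ[ℂ] ℂ) (hF : ∀ a, (∀ i, F i a = 0) → a = 0)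
    {z w : (A ⊗[ℂ] A) ⊗[ℂ] A} (h : ∀ i, slice3 (F i) z = slice3 (F i) w) : z = w :=
  sub_eq_zero.1 (eq_zero_of_separating_right F hF _ fun i => by
    have := h i
    rw [← sub_eq_zero, ← map_sub] at this
    exact this)

theorem slice1_ext {ι : Type*} (F : ι → A →ₗ[ℂ] ℂ) (hF : ∀ a, (∀ i, F i a = 0) → a = 0)
    {z w : (A ⊗[ℂ] A) ⊗[ℂ] A} (h : ∀ i, slice1 (F i) z = slice1 (F i) w) : z = w := by
  have key : ∀ (ρ : A →ₗ[ℂ] ℂ) (z : (A ⊗[ℂ] A) ⊗[ℂ] A), slice1 ρ z =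
      TensorProduct.lid ℂ _ (LinearMap.rTensor _ ρ (TensorProduct.assoc ℂ A A A z)) := by
    intro ρ z
    obtain ⟨z, rfl⟩ := (TensorProduct.assoc ℂ A A A).symm.surjective z
    induction z with
    | zero => simp
    | add x y hx hy => simp only [map_add, hx, hy]
    | tmul x y => simp
  rw [← sub_eq_zero]
  apply (TensorProduct.assoc ℂ A A A).injective
  rw [map_zero]
  refine eq_zero_of_separating_left F hF _ fun i => ?_
  rw [← key, map_sub, h, sub_self]

/-- The endomorphism `σ f σ` of `A ⊗ A`, for the flip `σ`. -/
def flipConj (f : Module.End ℂ (A ⊗[ℂ] A)) : Module.End ℂ (A ⊗[ℂ] A) :=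
  (TensorProduct.comm ℂ A A).toLinearMap ∘ₗ f ∘ₗ (TensorProduct.comm ℂ A A).toLinearMap

@[simp] theorem flipConj_tmul (f : Module.End ℂ (A ⊗[ℂ] A)) (a b : A) :
    flipConj f (a ⊗ₜ b) = TensorProduct.comm ℂ A A (f (b ⊗ₜ a)) := by simp [flipConj]

theorem flipConj_apply (f : Module.End ℂ (A ⊗[ℂ] A)) (z : A ⊗[ℂ] A) :
    flipConj f z = TensorProduct.comm ℂ A A (f (TensorProduct.comm ℂ A A z)) := rfl

@[simp] theorem comm_comm_apply (z : A ⊗[ℂ] A) :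
    TensorProduct.comm ℂ A A (TensorProduct.comm ℂ A A z) = z :=
  (TensorProduct.comm ℂ A A).symm_apply_apply z

theorem flipConj_mul (f g : Module.End ℂ (A ⊗[ℂ] A)) :
    flipConj (f * g) = flipConj f * flipConj g := by
  ext a b; simp [flipConj]

theorem comm_rTensor (f : A →ₗ[ℂ] A) (z : A ⊗[ℂ] A) :
    TensorProduct.comm ℂ A A (LinearMap.rTensor A f z) =
      LinearMap.lTensor A f (TensorProduct.comm ℂ A A z) := by
  induction z with
  | zero => simp
  | add x y hx hy => simp only [map_add, hx, hy]
  | tmul x y => simp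

theorem comm_lTensor (f : A →ₗ[ℂ] A) (z : A ⊗[ℂ] A) :
    TensorProduct.comm ℂ A A (LinearMap.lTensor A f z) =
      LinearMap.rTensor A f (TensorProduct.comm ℂ A A z) := by
  induction z with
  | zero => simp
  | add x y hx hy => simp only [map_add, hx, hy]
  | tmul x y => simp

@[simp] theorem sliceLeft_comm (ω : A →ₗ[ℂ] ℂ) (z : A ⊗[ℂ] A) :
    sliceLeft ω (TensorProduct.comm ℂ A A z) = sliceRight ω z := by
  induction z with
  | zero => simp
  | add x y hx hy => simp only [map_add, hx, hy]
  | tmul x y => simp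

@[simp] theorem sliceRight_comm (ω : A →ₗ[ℂ] ℂ) (z : A ⊗[ℂ] A) :
    sliceRight ω (TensorProduct.comm ℂ A A z) = sliceLeft ω z := by
  induction z with
  | zero => simp
  | add x y hx hy => simp only [map_add, hx, hy]
  | tmul x y => simp

variable (A) in
/-- The map `a ⊗ b ⊗ c ↦ c ⊗ b ⊗ a`. -/
def flip3 : Module.End ℂ ((A ⊗[ℂ] A) ⊗[ℂ] A) :=
  (TensorProduct.assoc ℂ A A A).symm.toLinearMap ∘ₗ
    LinearMap.lTensor A (TensorProduct.comm ℂ A A).toLinearMap ∘ₗ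
    (TensorProduct.comm ℂ (A ⊗[ℂ] A) A).toLinearMap

@[simp] theorem flip3_tmul (z : A ⊗[ℂ] A) (c : A) : flip3 A (z ⊗ₜ c) =
    (TensorProduct.assoc ℂ A A A).symm (c ⊗ₜ TensorProduct.comm ℂ A A z) := by simp [flip3]

@[simp] theorem flip3_assoc_symm (a : A) (z : A ⊗[ℂ] A) :
    flip3 A ((TensorProduct.assoc ℂ A A A).symm (a ⊗ₜ z)) = TensorProduct.comm ℂ A A z ⊗ₜ a := by
  induction z with
  | zero => simp
  | add x y hx hy => simp only [map_add, TensorProduct.tmul_add, TensorProduct.add_tmul, hx, hy]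
  | tmul x y => simp

@[simp] theorem flip3_rightComm (b : A) (z : A ⊗[ℂ] A) :
    flip3 A (TensorProduct.rightComm ℂ A A A (z ⊗ₜ b)) =
      TensorProduct.rightComm ℂ A A A (TensorProduct.comm ℂ A A z ⊗ₜ b) := by
  induction z with
  | zero => simp
  | add x y hx hy => simp only [map_add, TensorProduct.add_tmul, hx, hy]
  | tmul x y => simp

theorem flip3_mul_self : flip3 A * flip3 A = 1 := by
  ext a b c; simp

@[simp] theorem flip3_flip3 (v : (A ⊗[ℂ] A) ⊗[ℂ] A) : flip3 A (flip3 A v) = v :=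
  LinearMap.congr_fun flip3_mul_self v

/-- Passage to the opposite structure reverses the order of the three legs, so it swaps 12 with 23
and fixes 13. Conjugation by `flip3` thus carries an equation between leg maps to its mirror image.
-/
theorem leg12_flipConj (f : Module.End ℂ (A ⊗[ℂ] A)) :
    leg12 (flipConj f) = flip3 A * leg23 f * flip3 A := by
  ext a b c; simp

theorem leg23_flipConj (f : Module.End ℂ (A ⊗[ℂ] A)) :
    leg23 (flipConj f) = flip3 A * leg12 f * flip3 A := by
  ext a b c; simp

theorem leg13_flipConj (f : Module.End ℂ (A ⊗[ℂ] A)) :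
    leg13 (flipConj f) = flip3 A * leg13 f * flip3 A := by
  ext a b c; simp

theorem flip3_conj_mul (f g : Module.End ℂ ((A ⊗[ℂ] A) ⊗[ℂ] A)) :
    (flip3 A * f * flip3 A) * (flip3 A * g * flip3 A) = flip3 A * (f * g) * flip3 A := by
  have h : ∀ x, flip3 A * (flip3 A * x) = x := fun x => by rw [← mul_assoc, flip3_mul_self, one_mul]
  simp only [mul_assoc, h]

theorem flip3_conj_flip3_conj (f : Module.End ℂ ((A ⊗[ℂ] A) ⊗[ℂ] A)) :
    flip3 A * (flip3 A * f * flip3 A) * flip3 A = f := by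
  have h : ∀ x, flip3 A * (flip3 A * x) = x := fun x => by rw [← mul_assoc, flip3_mul_self, one_mul]
  simp only [mul_assoc, h, flip3_mul_self, mul_one]

end Slices

/-! ### Products of legs for a bilinear product. -/

section
variable {A : Type*} [AddCommGroup A] [Module ℂ A]

/-- The map `a ⊗ b ⊗ c ↦ ab ⊗ c`. -/
def mulLegs12 (μ : A →ₗ[ℂ] A →ₗ[ℂ] A) : (A ⊗[ℂ] A) ⊗[ℂ] A →ₗ[ℂ] A ⊗[ℂ] A :=
  LinearMap.rTensor A (TensorProduct.lift μ)

/-- The map `a ⊗ b ⊗ c ↦ a ⊗ bc`. -/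
def mulLegs23 (μ : A →ₗ[ℂ] A →ₗ[ℂ] A) : (A ⊗[ℂ] A) ⊗[ℂ] A →ₗ[ℂ] A ⊗[ℂ] A :=
  LinearMap.lTensor A (TensorProduct.lift μ) ∘ₗ (TensorProduct.assoc ℂ A A A).toLinearMap

@[simp] theorem mulLegs12_tmul (μ : A →ₗ[ℂ] A →ₗ[ℂ] A) (z : A ⊗[ℂ] A) (c : A) :
    mulLegs12 μ (z ⊗ₜ c) = TensorProduct.lift μ z ⊗ₜ c := by simp [mulLegs12]

@[simp] theorem mulLegs12_rightComm (μ : A →ₗ[ℂ] A →ₗ[ℂ] A) (z : A ⊗[ℂ] A) (c : A) :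
    mulLegs12 μ (TensorProduct.rightComm ℂ A A A (z ⊗ₜ c)) = LinearMap.rTensor A (μ.flip c) z := by
  induction z with
  | zero => simp
  | add x y hx hy => simp only [map_add, TensorProduct.add_tmul, hx, hy]
  | tmul x y => simp

@[simp] theorem mulLegs12_assoc_symm (μ : A →ₗ[ℂ] A →ₗ[ℂ] A) (z : A ⊗[ℂ] A) (c : A) :
    mulLegs12 μ ((TensorProduct.assoc ℂ A A A).symm (c ⊗ₜ z)) = LinearMap.rTensor A (μ c) z := by
  induction z with
  | zero => simp
  | add x y hx hy => simp only [map_add, TensorProduct.tmul_add, hx, hy]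
  | tmul x y => simp

@[simp] theorem mulLegs23_assoc_symm (μ : A →ₗ[ℂ] A →ₗ[ℂ] A) (z : A ⊗[ℂ] A) (c : A) :
    mulLegs23 μ ((TensorProduct.assoc ℂ A A A).symm (c ⊗ₜ z)) = c ⊗ₜ TensorProduct.lift μ z := by
  simp [mulLegs23]

theorem lift_flip (μ : A →ₗ[ℂ] A →ₗ[ℂ] A) (z : A ⊗[ℂ] A) :
    TensorProduct.lift μ.flip z = TensorProduct.lift μ (TensorProduct.comm ℂ A A z) := by
  induction z with
  | zero => simp
  | add x y hx hy => simp only [map_add, hx, hy]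
  | tmul x y => simp

theorem mulLegs12_flip (μ : A →ₗ[ℂ] A →ₗ[ℂ] A) (v : (A ⊗[ℂ] A) ⊗[ℂ] A) :
    mulLegs12 μ.flip v = TensorProduct.comm ℂ A A (mulLegs23 μ (flip3 A v)) := by
  induction v with
  | zero => simp
  | add x y hx hy => simp only [map_add, hx, hy]
  | tmul x y => simp [lift_flip]

theorem mulLegs23_flip (μ : A →ₗ[ℂ] A →ₗ[ℂ] A) (v : (A ⊗[ℂ] A) ⊗[ℂ] A) :
    mulLegs23 μ.flip v = TensorProduct.comm ℂ A A (mulLegs12 μ (flip3 A v)) := by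
  obtain ⟨v, rfl⟩ := (TensorProduct.assoc ℂ A A A).symm.surjective v
  induction v with
  | zero => simp
  | add x y hx hy => simp only [map_add, hx, hy]
  | tmul x y => simp [lift_flip]

theorem map₂_flip (μ : A →ₗ[ℂ] A →ₗ[ℂ] A) (z w : A ⊗[ℂ] A) :
    TensorProduct.map₂ μ.flip μ.flip z w =
      TensorProduct.comm ℂ A A (TensorProduct.map₂ μ μ
        (TensorProduct.comm ℂ A A w) (TensorProduct.comm ℂ A A z)) := by
  induction z with
  | zero => simp
  | add x y hx hy => simp only [map_add, LinearMap.add_apply, hx, hy]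
  | tmul a b =>
    induction w with
    | zero => simp
    | add x y hx hy => simp only [map_add, LinearMap.add_apply, hx, hy]
    | tmul c d => simp

end

/-! ### Canonical maps, the opposite structure and the pentagon equations. -/

/-- The canonical maps of a weak multiplier Hopf algebra, as linear maps on tensor powers of a vector
space `A` with a bilinear product.  The axioms are symmetric under the passage to the opposite
product and the opposite coproduct, which exchanges the maps with index `1` and `2`. -/
structure CanonicalMaps (A : Type*) [AddCommGroup A] [Module ℂ A] where
  mul : A →ₗ[ℂ] A →ₗ[ℂ] A
  assoc : ∀ a b c, mul (mul a b) c = mul a (mul b c)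
  nondeg_left : ∀ a, (∀ b, mul a b = 0) → a = 0
  nondeg_right : ∀ a, (∀ b, mul b a = 0) → a = 0
  mul_span : Submodule.span ℂ {x | ∃ a b, x = mul a b} = ⊤
  ε : A →ₗ[ℂ] ℂ
  T₁ : Module.End ℂ (A ⊗[ℂ] A)
  T₂ : Module.End ℂ (A ⊗[ℂ] A)
  E₁ : Module.End ℂ (A ⊗[ℂ] A)
  E₂ : Module.End ℂ (A ⊗[ℂ] A)
  G₁ : Module.End ℂ (A ⊗[ℂ] A)
  G₂ : Module.End ℂ (A ⊗[ℂ] A)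
  R₁ : Module.End ℂ (A ⊗[ℂ] A)
  R₂ : Module.End ℂ (A ⊗[ℂ] A)
  T₁_lTensor : ∀ c z, T₁ (LinearMap.lTensor A (mul.flip c) z) =
    LinearMap.lTensor A (mul.flip c) (T₁ z)
  T₂_rTensor : ∀ c z, T₂ (LinearMap.rTensor A (mul c) z) = LinearMap.rTensor A (mul c) (T₂ z)
  -- For v = a⊗b⊗c both sides are Δ(a)Δ(b)(1⊗c). Likewise `compat` is associativity of
  -- (c⊗1)Δ(a)(1⊗b), and `E_compat` makes `E₁` and `E₂` the two actions of one multiplier.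
  T₁_mul : ∀ v, T₁ (mulLegs12 mul v) = mulLegs12 mul (leg13 T₁ (leg23 T₁ v))
  T₂_mul : ∀ v, T₂ (mulLegs23 mul v) = mulLegs23 mul (leg13 T₂ (leg12 T₂ v))
  compat : ∀ a b c, LinearMap.rTensor A (mul c) (T₁ (a ⊗ₜ b)) =
    LinearMap.lTensor A (mul.flip b) (T₂ (c ⊗ₜ a))
  coassoc : leg12 T₂ * leg23 T₁ = leg23 T₁ * leg12 T₂
  full_left : Submodule.span ℂ {x | ∃ ω a b, x = sliceRight ω (T₁ (a ⊗ₜ b))} = ⊤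
  full_right : Submodule.span ℂ {x | ∃ ω a b, x = sliceLeft ω (T₂ (a ⊗ₜ b))} = ⊤
  counit_left : ∀ z, sliceLeft ε (T₁ z) = TensorProduct.lift mul z
  counit_right : ∀ z, sliceRight ε (T₂ z) = TensorProduct.lift mul z
  T₁_R₁ : T₁ * R₁ = E₁
  R₁_T₁ : R₁ * T₁ = G₁
  R₁_E₁ : R₁ * E₁ = R₁
  E₁_T₁ : E₁ * T₁ = T₁
  T₂_R₂ : T₂ * R₂ = E₂
  R₂_T₂ : R₂ * T₂ = G₂
  R₂_E₂ : R₂ * E₂ = R₂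
  E₂_T₂ : E₂ * T₂ = T₂
  G₁_spec : leg12 G₁ * leg13 T₁ = leg13 T₁ * leg23 E₁
  G₂_spec : leg23 G₂ * leg13 T₂ = leg13 T₂ * leg12 E₂
  E_compat : ∀ z w, TensorProduct.map₂ mul mul (E₂ z) w = TensorProduct.map₂ mul mul z (E₁ w)
  E₁_comm : leg12 E₁ * leg23 E₁ = leg23 E₁ * leg12 E₁
  E₂_comm : leg12 E₂ * leg23 E₂ = leg23 E₂ * leg12 E₂

namespace CanonicalMaps
variable {A : Type*} [AddCommGroup A] [Module ℂ A] (C : CanonicalMaps A)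

/-- The opposite product with the opposite coproduct. -/
def op : CanonicalMaps A where
  mul := C.mul.flip
  assoc a b c := by simp [C.assoc]
  nondeg_left a h := C.nondeg_right a h
  nondeg_right a h := C.nondeg_left a h
  mul_span := by
    rw [← C.mul_span]; congr 1; ext x
    exact ⟨fun ⟨a, b, h⟩ => ⟨b, a, h⟩, fun ⟨a, b, h⟩ => ⟨b, a, h⟩⟩
  ε := C.ε
  T₁ := flipConj C.T₂
  T₂ := flipConj C.T₁
  E₁ := flipConj C.E₂
  E₂ := flipConj C.E₁
  G₁ := flipConj C.G₂
  G₂ := flipConj C.G₁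
  R₁ := flipConj C.R₂
  R₂ := flipConj C.R₁
  T₁_lTensor c z := by
    simp only [flipConj_apply, comm_lTensor, LinearMap.flip_flip, C.T₂_rTensor, comm_rTensor]
  T₂_rTensor c z := by
    simp only [flipConj_apply, comm_lTensor, C.T₁_lTensor, comm_rTensor]
  T₁_mul v := by
    simp only [flipConj_apply, mulLegs12_flip, comm_comm_apply, C.T₂_mul, leg13_flipConj,
      leg23_flipConj, Module.End.mul_apply, flip3_flip3]
  T₂_mul v := by
    simp only [flipConj_apply, mulLegs23_flip, comm_comm_apply, C.T₁_mul, leg13_flipConj,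
      leg12_flipConj, Module.End.mul_apply, flip3_flip3]
  compat a b c := by
    have := C.compat a c b
    simp only [flipConj_tmul, ← comm_lTensor, ← comm_rTensor, LinearMap.flip_flip, this]
  coassoc := by
    rw [leg12_flipConj, leg23_flipConj, flip3_conj_mul, flip3_conj_mul, C.coassoc]
  full_left := by
    rw [← C.full_right]; congr 1; ext x
    simp only [flipConj_tmul, sliceRight_comm, Set.mem_ofPred_eq]
    exact ⟨fun ⟨ω, a, b, h⟩ => ⟨ω, b, a, h⟩, fun ⟨ω, a, b, h⟩ => ⟨ω, b, a, h⟩⟩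
  full_right := by
    rw [← C.full_left]; congr 1; ext x
    simp only [flipConj_tmul, sliceLeft_comm, Set.mem_ofPred_eq]
    exact ⟨fun ⟨ω, a, b, h⟩ => ⟨ω, b, a, h⟩, fun ⟨ω, a, b, h⟩ => ⟨ω, b, a, h⟩⟩
  counit_left z := by simp only [flipConj_apply, sliceLeft_comm, C.counit_right, lift_flip]
  counit_right z := by simp only [flipConj_apply, sliceRight_comm, C.counit_left, lift_flip]
  T₁_R₁ := by rw [← flipConj_mul, C.T₂_R₂]
  R₁_T₁ := by rw [← flipConj_mul, C.R₂_T₂]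
  R₁_E₁ := by rw [← flipConj_mul, C.R₂_E₂]
  E₁_T₁ := by rw [← flipConj_mul, C.E₂_T₂]
  T₂_R₂ := by rw [← flipConj_mul, C.T₁_R₁]
  R₂_T₂ := by rw [← flipConj_mul, C.R₁_T₁]
  R₂_E₂ := by rw [← flipConj_mul, C.R₁_E₁]
  E₂_T₂ := by rw [← flipConj_mul, C.E₁_T₁]
  G₁_spec := by
    simp only [leg12_flipConj, leg13_flipConj, leg23_flipConj, flip3_conj_mul, C.G₂_spec]
  G₂_spec := by
    simp only [leg12_flipConj, leg13_flipConj, leg23_flipConj, flip3_conj_mul, C.G₁_spec]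
  E_compat z w := by
    simp only [map₂_flip, flipConj_apply, comm_comm_apply, C.E_compat]
  E₁_comm := by
    simp only [leg12_flipConj, leg23_flipConj, flip3_conj_mul, C.E₂_comm]
  E₂_comm := by
    simp only [leg12_flipConj, leg23_flipConj, flip3_conj_mul, C.E₁_comm]

/-- The map `b ↦ (ρ ⊗ ι)((a ⊗ 1)Δ(b))`. -/
def lam (a : A) (ρ : A →ₗ[ℂ] ℂ) : A →ₗ[ℂ] A := sliceLeft ρ ∘ₗ C.T₂ ∘ₗ TensorProduct.mk ℂ A A a

/-- The map `b ↦ (ι ⊗ ω)(Δ(b)(1 ⊗ c))`. -/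
def tau (c : A) (ω : A →ₗ[ℂ] ℂ) : A →ₗ[ℂ] A :=
  sliceRight ω ∘ₗ C.T₁ ∘ₗ (TensorProduct.mk ℂ A A).flip c

theorem lam_apply (a : A) (ρ : A →ₗ[ℂ] ℂ) (b : A) : C.lam a ρ b = sliceLeft ρ (C.T₂ (a ⊗ₜ b)) := rfl

theorem tau_apply (c : A) (ω : A →ₗ[ℂ] ℂ) (b : A) : C.tau c ω b = sliceRight ω (C.T₁ (b ⊗ₜ c)) :=
  rfl

theorem op_lam (a : A) (ρ : A →ₗ[ℂ] ℂ) : C.op.lam a ρ = C.tau a ρ := by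
  ext b; simp [lam_apply, tau_apply, op]

theorem op_tau (a : A) (ρ : A →ₗ[ℂ] ℂ) : C.op.tau a ρ = C.lam a ρ := by
  ext b; simp [lam_apply, tau_apply, op]

/-- The left action of `Δ(a)` on `A ⊗ A`. -/
def deltaLeft : A →ₗ[ℂ] Module.End ℂ (A ⊗[ℂ] A) :=
  TensorProduct.curry (mulLegs12 C.mul ∘ₗ leg13 C.T₁ ∘ₗ
    (TensorProduct.assoc ℂ A A A).symm.toLinearMap)

theorem deltaLeft_tmul (a x y : A) :
    C.deltaLeft a (x ⊗ₜ y) = LinearMap.rTensor A (C.mul.flip x) (C.T₁ (a ⊗ₜ y)) := by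
  simp [deltaLeft]

theorem T₁_mul_tmul (a b c : A) : C.T₁ (C.mul a b ⊗ₜ c) = C.deltaLeft a (C.T₁ (b ⊗ₜ c)) := by
  simpa [deltaLeft] using C.T₁_mul ((a ⊗ₜ b) ⊗ₜ c)

theorem ext_of_mul_left {a b : A} (h : ∀ c, C.mul c a = C.mul c b) : a = b :=
  sub_eq_zero.1 (C.nondeg_right _ fun c => by rw [map_sub, h, sub_self])

theorem ext_of_mul_right {a b : A} (h : ∀ c, C.mul a c = C.mul b c) : a = b :=
  sub_eq_zero.1 (C.nondeg_left _ fun c => by rw [map_sub, LinearMap.sub_apply, h, sub_self])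

theorem separating_mul_left (a : A)
    (h : ∀ i : A × (A →ₗ[ℂ] ℂ), (i.2 ∘ₗ C.mul i.1) a = 0) : a = 0 :=
  C.nondeg_right a fun b => eq_zero_of_forall_functional _ fun ρ => h (b, ρ)

theorem separating_mul_right (a : A)
    (h : ∀ i : A × (A →ₗ[ℂ] ℂ), (i.2 ∘ₗ C.mul.flip i.1) a = 0) : a = 0 :=
  C.op.separating_mul_left a h

theorem sliceLeft_ext_mul {z w : A ⊗[ℂ] A}
    (h : ∀ ρ c, sliceLeft (ρ ∘ₗ C.mul c) z = sliceLeft (ρ ∘ₗ C.mul c) w) : z = w :=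
  sliceLeft_ext (fun i : A × (A →ₗ[ℂ] ℂ) => i.2 ∘ₗ C.mul i.1) C.separating_mul_left
    fun i => h i.2 i.1

theorem sliceRight_ext_mul {z w : A ⊗[ℂ] A}
    (h : ∀ ρ c, sliceRight (ρ ∘ₗ C.mul c) z = sliceRight (ρ ∘ₗ C.mul c) w) : z = w :=
  sliceRight_ext (fun i : A × (A →ₗ[ℂ] ℂ) => i.2 ∘ₗ C.mul i.1) C.separating_mul_left
    fun i => h i.2 i.1

theorem sliceRight_ext_mul_right {z w : A ⊗[ℂ] A}
    (h : ∀ ρ c, sliceRight (ρ ∘ₗ C.mul.flip c) z = sliceRight (ρ ∘ₗ C.mul.flip c) w) : z = w :=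
  sliceRight_ext (fun i : A × (A →ₗ[ℂ] ℂ) => i.2 ∘ₗ C.mul.flip i.1) C.separating_mul_right
    fun i => h i.2 i.1

theorem sliceLeft_ext_mul_right {z w : A ⊗[ℂ] A}
    (h : ∀ ρ c, sliceLeft (ρ ∘ₗ C.mul.flip c) z = sliceLeft (ρ ∘ₗ C.mul.flip c) w) : z = w :=
  sliceLeft_ext (fun i : A × (A →ₗ[ℂ] ℂ) => i.2 ∘ₗ C.mul.flip i.1) C.separating_mul_right
    fun i => h i.2 i.1

/-- `z w` in the algebra `A ⊗ A`. -/
abbrev mul₂ : A ⊗[ℂ] A →ₗ[ℂ] A ⊗[ℂ] A →ₗ[ℂ] A ⊗[ℂ] A := TensorProduct.map₂ C.mul C.mul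

theorem ext_of_mul₂_left {z w : A ⊗[ℂ] A} (h : ∀ v, C.mul₂ v z = C.mul₂ v w) : z = w := by
  refine C.sliceLeft_ext_mul fun ρ c => ?_
  refine C.ext_of_mul_left fun d => ?_
  have key : ∀ z, C.mul d (sliceLeft (ρ ∘ₗ C.mul c) z) = sliceLeft ρ (C.mul₂ (c ⊗ₜ d) z) := by
    intro z
    induction z with
    | zero => simp
    | add x y hx hy => simp only [map_add, hx, hy]
    | tmul x y => simp
  rw [key, key, h]

theorem ext_of_mul₂_right {z w : A ⊗[ℂ] A} (h : ∀ v, C.mul₂ z v = C.mul₂ w v) : z = w := by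
  apply (TensorProduct.comm ℂ A A).injective
  refine C.op.ext_of_mul₂_left fun v => ?_
  simpa [mul₂, op, map₂_flip] using h (TensorProduct.comm ℂ A A v)

theorem slice1_leg12_T₂ (a : A) (ρ : A →ₗ[ℂ] ℂ) (t : A ⊗[ℂ] A) :
    slice1 ρ (leg12 C.T₂ ((TensorProduct.assoc ℂ A A A).symm (a ⊗ₜ t))) =
      LinearMap.rTensor A (C.lam a ρ) t := by
  induction t with
  | zero => simp
  | add x y hx hy => simp only [TensorProduct.tmul_add, map_add, hx, hy]
  | tmul x y => simp [lam_apply]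

theorem slice3_leg23_T₁ (c : A) (ω : A →ₗ[ℂ] ℂ) (t : A ⊗[ℂ] A) :
    slice3 ω (leg23 C.T₁ (t ⊗ₜ c)) = LinearMap.lTensor A (C.tau c ω) t := by
  induction t with
  | zero => simp
  | add x y hx hy => simp only [TensorProduct.add_tmul, map_add, hx, hy]
  | tmul x y => simp [tau_apply]

/-- Slicing off the first leg turns T₂ on legs 1, 2 into `lam`. Coassociativity is the case X = T₁.
-/
theorem lam_comm_of_leg {X : Module.End ℂ (A ⊗[ℂ] A)}
    (hX : leg12 C.T₂ * leg23 X = leg23 X * leg12 C.T₂) (a : A) (ρ : A →ₗ[ℂ] ℂ) (z : A ⊗[ℂ] A) :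
    X (LinearMap.rTensor A (C.lam a ρ) z) = LinearMap.rTensor A (C.lam a ρ) (X z) := by
  rw [← slice1_leg12_T₂, ← slice1_leg12_T₂, ← slice1_leg23, ← Module.End.mul_apply, ← hX,
    Module.End.mul_apply, leg23_assoc_symm]

theorem T₁_lam (a : A) (ρ : A →ₗ[ℂ] ℂ) (z : A ⊗[ℂ] A) :
    C.T₁ (LinearMap.rTensor A (C.lam a ρ) z) = LinearMap.rTensor A (C.lam a ρ) (C.T₁ z) :=
  C.lam_comm_of_leg C.coassoc a ρ z

theorem T₂_tau (c : A) (ω : A →ₗ[ℂ] ℂ) (z : A ⊗[ℂ] A) :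
    C.T₂ (LinearMap.lTensor A (C.tau c ω) z) = LinearMap.lTensor A (C.tau c ω) (C.T₂ z) := by
  have := C.op.T₁_lam c ω (TensorProduct.comm ℂ A A z)
  simp only [op_lam] at this
  simpa only [op, flipConj_apply, ← comm_lTensor, comm_comm_apply,
    (TensorProduct.comm ℂ A A).injective.eq_iff] using this

/-- This is the counit law. It lets ε composed with `lam` replace the functionals ρ(a ·), which
separate points. -/
theorem ε_lam (a : A) (ρ : A →ₗ[ℂ] ℂ) : C.ε ∘ₗ C.lam a ρ = ρ ∘ₗ C.mul a := by
  ext b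
  simp only [LinearMap.comp_apply, lam_apply]
  rw [functional_sliceLeft, counit_right, TensorProduct.lift.tmul]

/-- By `ε_lam`, a map commuting with every `lam` on the first leg is determined by its composite
with ε there. Identities on three legs are thereby reduced to two legs. -/
theorem ext_of_lam {X Y : Module.End ℂ ((A ⊗[ℂ] A) ⊗[ℂ] A)}
    (hX : ∀ a ρ, Commute X (leg12 (LinearMap.rTensor A (C.lam a ρ))))
    (hY : ∀ a ρ, Commute Y (leg12 (LinearMap.rTensor A (C.lam a ρ))))
    (h : ∀ v, slice1 C.ε (X v) = slice1 C.ε (Y v)) : X = Y := by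
  have key : ∀ (a : A) (ρ : A →ₗ[ℂ] ℂ) v,
      slice1 (ρ ∘ₗ C.mul a) v = slice1 C.ε (leg12 (LinearMap.rTensor A (C.lam a ρ)) v) := by
    intro a ρ v
    induction v with
    | zero => simp
    | add x y hx hy => simp only [map_add, hx, hy]
    | tmul x y => simp [sliceLeft_rTensor, C.ε_lam]
  ext1; ext1; ext a b c
  refine slice1_ext (fun i : A × (A →ₗ[ℂ] ℂ) => i.2 ∘ₗ C.mul i.1) C.separating_mul_left fun i => ?_
  simp only [key]
  have h1 := LinearMap.congr_fun (hX i.1 i.2).eq ((a ⊗ₜ b) ⊗ₜ c)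
  have h2 := LinearMap.congr_fun (hY i.1 i.2).eq ((a ⊗ₜ b) ⊗ₜ c)
  simp only [Module.End.mul_apply] at h1 h2
  simp only [TensorProduct.AlgebraTensorModule.curry_apply, LinearMap.restrictScalars_self,
    TensorProduct.curry_apply]
  rw [← h1, ← h2, h]

@[simp] theorem leg12_rTensor_assoc_symm (f : A →ₗ[ℂ] A) (a : A) (z : A ⊗[ℂ] A) :
    leg12 (LinearMap.rTensor A f) ((TensorProduct.assoc ℂ A A A).symm (a ⊗ₜ z)) =
      (TensorProduct.assoc ℂ A A A).symm (f a ⊗ₜ z) := by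
  induction z with
  | zero => simp
  | add x y hx hy => simp only [TensorProduct.tmul_add, map_add, hx, hy]
  | tmul x y => simp

theorem leg13_rTensor_comm (f : A →ₗ[ℂ] A) {X : Module.End ℂ (A ⊗[ℂ] A)}
    (hX : ∀ z, X (LinearMap.rTensor A f z) = LinearMap.rTensor A f (X z)) :
    Commute (leg13 X) (leg12 (LinearMap.rTensor A f)) := by
  have key : ∀ (z : A ⊗[ℂ] A) (b : A), leg12 (LinearMap.rTensor A f)
      (TensorProduct.rightComm ℂ A A A (z ⊗ₜ b)) =
      TensorProduct.rightComm ℂ A A A (LinearMap.rTensor A f z ⊗ₜ b) := by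
    intro z b
    induction z with
    | zero => simp
    | add x y hx hy => simp only [TensorProduct.add_tmul, map_add, hx, hy]
    | tmul x y => simp
  rw [Commute, SemiconjBy]
  ext a b c
  have := hX (a ⊗ₜ c)
  simp only [LinearMap.rTensor_tmul] at this
  simp [key, this]

theorem leg23_rTensor_comm (f : A →ₗ[ℂ] A) (X : Module.End ℂ (A ⊗[ℂ] A)) :
    Commute (leg23 X) (leg12 (LinearMap.rTensor A f)) := by
  rw [Commute, SemiconjBy]
  ext a b c
  simp

theorem leg12_comm {X Y : Module.End ℂ (A ⊗[ℂ] A)} (h : ∀ z, X (Y z) = Y (X z)) :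
    Commute (leg12 X) (leg12 Y) := by
  rw [Commute, SemiconjBy, ← leg12_mul, ← leg12_mul]
  exact congrArg leg12 (LinearMap.ext h)

theorem slice1_ε_leg12_T₁ (v : (A ⊗[ℂ] A) ⊗[ℂ] A) :
    slice1 C.ε (leg12 C.T₁ v) = mulLegs12 C.mul v := by
  induction v with
  | zero => simp
  | add x y hx hy => simp only [map_add, hx, hy]
  | tmul x y => simp [C.counit_left]

/-- By coassociativity both sides commute with `lam` on the first leg; applying ε to that leg leaves
the multiplicativity of Δ. -/
theorem pentagon₁ : leg12 C.T₁ * leg13 C.T₁ * leg23 C.T₁ = leg23 C.T₁ * leg12 C.T₁ := by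
  have h12 := fun a ρ => leg12_comm (C.T₁_lam a ρ)
  have h13 := fun a ρ => leg13_rTensor_comm (C.lam a ρ) (C.T₁_lam a ρ)
  have h23 := fun a ρ => leg23_rTensor_comm (C.lam a ρ) C.T₁
  refine C.ext_of_lam (fun a ρ => ((h12 a ρ).mul_left (h13 a ρ)).mul_left (h23 a ρ))
    (fun a ρ => (h23 a ρ).mul_left (h12 a ρ)) (fun v => ?_)
  simp only [Module.End.mul_apply, slice1_ε_leg12_T₁, slice1_leg23, C.T₁_mul]

theorem pentagon₂ : leg23 C.T₂ * leg13 C.T₂ * leg12 C.T₂ = leg12 C.T₂ * leg23 C.T₂ := by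
  have := congrArg (fun x => flip3 A * x * flip3 A) C.op.pentagon₁
  simpa only [op, leg12_flipConj, leg13_flipConj, leg23_flipConj, flip3_conj_mul,
    flip3_conj_flip3_conj] using this

theorem T₁_G₁ : C.T₁ * C.G₁ = C.T₁ := by rw [← C.R₁_T₁, ← mul_assoc, C.T₁_R₁, C.E₁_T₁]

theorem G₁_R₁ : C.G₁ * C.R₁ = C.R₁ := by rw [← C.R₁_T₁, mul_assoc, C.T₁_R₁, C.R₁_E₁]

/-- Multiply the pentagon by R₁ on legs 2, 3: the E₁ that arises there passes through T₁ on legs 1,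
3 as G₁ on legs 1, 2, which T₁ absorbs. -/
theorem leg12_T₁_leg13_T₁ : leg12 C.T₁ * leg13 C.T₁ = leg23 C.T₁ * leg12 C.T₁ * leg23 C.R₁ := by
  rw [← C.pentagon₁, mul_assoc _ (leg23 C.T₁), ← leg23_mul, C.T₁_R₁, mul_assoc, ← C.G₁_spec,
    ← mul_assoc, ← leg12_mul, C.T₁_G₁]

theorem leg23_T₂_leg13_T₂ : leg23 C.T₂ * leg13 C.T₂ = leg12 C.T₂ * leg23 C.T₂ * leg12 C.R₂ := by
  have := congrArg (fun x => flip3 A * x * flip3 A) C.op.leg12_T₁_leg13_T₁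
  simpa only [op, leg12_flipConj, leg13_flipConj, leg23_flipConj, flip3_conj_mul,
    flip3_conj_flip3_conj] using this

end CanonicalMaps

/-! ### The canonical idempotent under ι⊗Δ. -/

namespace CanonicalMaps
variable {A : Type*} [AddCommGroup A] [Module ℂ A] (C : CanonicalMaps A)

theorem E₁_mul_E₁ : C.E₁ * C.E₁ = C.E₁ := by
  rw [← C.T₁_R₁, ← _root_.mul_assoc, C.T₁_R₁, C.E₁_T₁, C.T₁_R₁]

theorem E₂_mul_E₂ : C.E₂ * C.E₂ = C.E₂ := by
  rw [← C.T₂_R₂, ← _root_.mul_assoc, C.T₂_R₂, C.E₂_T₂, C.T₂_R₂]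

/-- `h1` says that Y preserves the range of P, and `h2` that it preserves the kernel. -/
theorem commute_of_projection {V : Type*} [AddCommGroup V] [Module ℂ V] {P Y : Module.End ℂ V}
    (hP : P * P = P) (h1 : P * Y * P = Y * P) (h2 : ∀ w, P w = 0 → P (Y w) = 0) :
    P * Y = Y * P := by
  ext w
  have h3 := h2 (w - P w) (by
    rw [map_sub, ← Module.End.mul_apply, hP, sub_self])
  rw [map_sub, map_sub, sub_eq_zero] at h3
  exact h3.trans (LinearMap.congr_fun h1 w)

theorem ext_of_rTensor_mul {z w : A ⊗[ℂ] A}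
    (h : ∀ c, LinearMap.rTensor A (C.mul c) z = LinearMap.rTensor A (C.mul c) w) : z = w :=
  C.sliceLeft_ext_mul fun ρ c => by rw [← sliceLeft_rTensor, ← sliceLeft_rTensor, h]

theorem ext_of_rTensor_mul_flip {z w : A ⊗[ℂ] A}
    (h : ∀ c, LinearMap.rTensor A (C.mul.flip c) z = LinearMap.rTensor A (C.mul.flip c) w) :
    z = w :=
  C.sliceLeft_ext_mul_right fun ρ c => by rw [← sliceLeft_rTensor, ← sliceLeft_rTensor, h]

theorem ext_of_lTensor_mul_flip {z w : A ⊗[ℂ] A}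
    (h : ∀ c, LinearMap.lTensor A (C.mul.flip c) z = LinearMap.lTensor A (C.mul.flip c) w) :
    z = w :=
  C.sliceRight_ext_mul_right fun ρ c => by rw [← sliceRight_lTensor, ← sliceRight_lTensor, h]

/-- `z (x ⊗ y) = (z (1 ⊗ y)) (x ⊗ 1)`. -/
theorem mul₂_tmul (z : A ⊗[ℂ] A) (x y : A) : C.mul₂ z (x ⊗ₜ y) =
    LinearMap.rTensor A (C.mul.flip x) (LinearMap.lTensor A (C.mul.flip y) z) := by
  induction z with
  | zero => simp
  | add x y hx hy => simp only [map_add, LinearMap.add_apply, hx, hy]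
  | tmul x y => simp

theorem rTensor_mul_rTensor_mul_flip (c x : A) (z : A ⊗[ℂ] A) :
    LinearMap.rTensor A (C.mul c) (LinearMap.rTensor A (C.mul.flip x) z) =
      LinearMap.rTensor A (C.mul.flip x) (LinearMap.rTensor A (C.mul c) z) := by
  induction z with
  | zero => simp
  | add x y hx hy => simp only [map_add, hx, hy]
  | tmul x y => simp [C.assoc]

/-- `((c ⊗ 1)Δ(a)) z = (c ⊗ 1)(Δ(a) z)`. -/
theorem mul₂_T₂ (c a : A) (z : A ⊗[ℂ] A) :
    C.mul₂ (C.T₂ (c ⊗ₜ a)) z = LinearMap.rTensor A (C.mul c) (C.deltaLeft a z) := by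
  induction z with
  | zero => simp
  | add x y hx hy => simp only [map_add, hx, hy]
  | tmul x y => rw [deltaLeft_tmul, rTensor_mul_rTensor_mul_flip, C.compat, mul₂_tmul]

/-- Since (c⊗1)Δ(a) is in the range of T₂, right multiplication by E does not change it. -/
theorem deltaLeft_E₁ (a : A) (z : A ⊗[ℂ] A) : C.deltaLeft a (C.E₁ z) = C.deltaLeft a z :=
  C.ext_of_rTensor_mul fun c => by
    rw [← mul₂_T₂, ← mul₂_T₂, ← C.E_compat, ← Module.End.mul_apply, C.E₂_T₂]

theorem leg12_add (f g : Module.End ℂ (A ⊗[ℂ] A)) : leg12 (f + g) = leg12 f + leg12 g :=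
  LinearMap.rTensor_add _ _ _

theorem leg12_smul (r : ℂ) (f : Module.End ℂ (A ⊗[ℂ] A)) : leg12 (r • f) = r • leg12 f :=
  LinearMap.rTensor_smul _ _ _

/-- The left action of `(ι ⊗ Δ)(w)` on `A ⊗ A ⊗ A`. -/
def deltaLeft23 : A ⊗[ℂ] A →ₗ[ℂ] Module.End ℂ ((A ⊗[ℂ] A) ⊗[ℂ] A) :=
  TensorProduct.lift (LinearMap.mk₂ ℂ
    (fun w₁ w₂ => leg12 (LinearMap.rTensor A (C.mul w₁)) * leg23 (C.deltaLeft w₂))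
    (fun _ _ _ => by
      rw [map_add, LinearMap.rTensor_add, leg12_add, add_mul])
    (fun _ _ _ => by
      rw [map_smul, LinearMap.rTensor_smul, leg12_smul, smul_mul_assoc])
    (fun _ _ _ => by ext; simp [TensorProduct.tmul_add])
    (fun _ _ _ => by ext; simp))

theorem deltaLeft23_tmul (a b : A) : C.deltaLeft23 (a ⊗ₜ b) =
    leg12 (LinearMap.rTensor A (C.mul a)) * leg23 (C.deltaLeft b) := rfl

theorem deltaLeft23_T₁ (w : A ⊗[ℂ] A) :
    C.deltaLeft23 w * leg23 C.T₁ = leg23 C.T₁ * leg12 (C.mul₂ w) := by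
  induction w with
  | zero => ext; simp
  | add x y hx hy =>
    have : leg12 (C.mul₂ (x + y)) = leg12 (C.mul₂ x) + leg12 (C.mul₂ y) := by
      ext; simp [TensorProduct.add_tmul]
    rw [map_add, add_mul, hx, hy, this, mul_add]
  | tmul x y => ext s q t; simp [deltaLeft23_tmul, C.T₁_mul_tmul]

theorem deltaLeft23_E₁ (w : A ⊗[ℂ] A) : C.deltaLeft23 w * leg23 C.E₁ = C.deltaLeft23 w := by
  induction w with
  | zero => ext; simp
  | add x y hx hy => rw [map_add, add_mul, hx, hy]
  | tmul x y => ext s q t; simp [deltaLeft23_tmul, C.deltaLeft_E₁]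

theorem slice3_deltaLeft23 (ω : A →ₗ[ℂ] ℂ) (w z : A ⊗[ℂ] A) (c : A) :
    slice3 ω (C.deltaLeft23 w (z ⊗ₜ c)) = C.mul₂ (LinearMap.lTensor A (C.tau c ω) w) z := by
  induction w with
  | zero => simp
  | add x y hx hy => simp only [map_add, LinearMap.add_apply, hx, hy]
  | tmul x y =>
    induction z with
    | zero => simp
    | add x y hx hy => simp only [map_add, TensorProduct.add_tmul, hx, hy]
    | tmul s q => simp [deltaLeft23_tmul, deltaLeft_tmul, tau_apply, sliceRight_rTensor]

/-- After slicing the third leg, the claim is that right multiplication by E commutes with ι⊗`tau`.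
The range of E₂ is preserved because `tau` commutes with T₂. The kernel is preserved because wE = 0
forces (ι⊗Δ)(w)(E⊗1) = 0. -/
theorem E₂_T₁_of_T₁_E₁ (h : leg12 C.T₁ * leg13 C.E₁ = leg23 C.E₁ * leg12 C.T₁) :
    leg12 C.E₂ * leg23 C.T₁ = leg23 C.T₁ * leg12 C.E₂ := by
  -- Insert E on legs 2, 3, move it to legs 1, 3 by `h` and write it there as T₁R₁. By
  -- `leg12_T₁_leg13_T₁` a T₁ on legs 2, 3 then stands next to (ι⊗Δ)(w); moving it to the left
  -- leaves w times the range of T₁, which is zero because that range is fixed by E.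
  have ker : ∀ w, C.E₂ w = 0 → C.deltaLeft23 w * leg12 C.T₁ = 0 := by
    intro w hw
    have h1 : leg12 (C.mul₂ w) * leg12 C.T₁ = 0 := by
      rw [← leg12_mul]
      have : C.mul₂ w * C.T₁ = 0 := by
        rw [← C.E₁_T₁]
        ext1; ext a b
        simp [← C.E_compat, hw]
      rw [this]; ext; simp
    calc C.deltaLeft23 w * leg12 C.T₁
        = C.deltaLeft23 w * (leg12 C.T₁ * leg13 C.E₁) := by
          rw [h, ← _root_.mul_assoc, deltaLeft23_E₁]
      _ = C.deltaLeft23 w * (leg23 C.T₁ * leg12 C.T₁ * leg23 C.R₁) * leg13 C.R₁ := by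
          rw [← C.T₁_R₁, leg13_mul, ← C.leg12_T₁_leg13_T₁]; simp only [_root_.mul_assoc]
      _ = leg23 C.T₁ * (leg12 (C.mul₂ w) * leg12 C.T₁) * leg23 C.R₁ * leg13 C.R₁ := by
          simp only [← _root_.mul_assoc, deltaLeft23_T₁]
      _ = 0 := by rw [h1]; simp
  have tau : ∀ w c ω, C.E₂ w = 0 → C.E₂ (LinearMap.lTensor A (C.tau c ω) w) = 0 := by
    intro w c ω hw
    refine C.ext_of_mul₂_right fun v => ?_
    have h2 : C.deltaLeft23 w * leg12 C.E₁ = 0 := by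
      rw [← C.T₁_R₁, leg12_mul, ← _root_.mul_assoc, ker w hw, zero_mul]
    have h3 := congrArg (slice3 ω) (LinearMap.congr_fun h2 (v ⊗ₜ c))
    rw [Module.End.mul_apply, leg12_tmul, slice3_deltaLeft23] at h3
    rw [C.E_compat, h3]; simp
  have key : ∀ c ω, C.E₂ * LinearMap.lTensor A (C.tau c ω) =
      LinearMap.lTensor A (C.tau c ω) * C.E₂ := by
    intro c ω
    refine commute_of_projection C.E₂_mul_E₂ ?_ (fun w hw => tau w c ω hw)
    have h4 : LinearMap.lTensor A (C.tau c ω) * C.T₂ = C.T₂ * LinearMap.lTensor A (C.tau c ω) :=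
      LinearMap.ext fun z => (C.T₂_tau c ω z).symm
    have h5 : LinearMap.lTensor A (C.tau c ω) * C.E₂ =
        C.T₂ * (LinearMap.lTensor A (C.tau c ω) * C.R₂) := by
      rw [← C.T₂_R₂, ← _root_.mul_assoc, h4, _root_.mul_assoc]
    rw [_root_.mul_assoc, h5, ← _root_.mul_assoc, C.E₂_T₂]
  refine TensorProduct.ext' fun z c => ?_
  refine slice3_ext (fun ω => ω) eq_zero_of_forall_functional fun ω => ?_
  have h6 := LinearMap.congr_fun (key c ω) (z)
  simp only [Module.End.mul_apply] at h6
  rw [Module.End.mul_apply, Module.End.mul_apply, slice3_leg12, slice3_leg23_T₁, leg12_tmul,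
    slice3_leg23_T₁, h6]

/-- `z w` in the algebra `A ⊗ A ⊗ A`. -/
abbrev mul₃ : (A ⊗[ℂ] A) ⊗[ℂ] A →ₗ[ℂ] (A ⊗[ℂ] A) ⊗[ℂ] A →ₗ[ℂ] (A ⊗[ℂ] A) ⊗[ℂ] A :=
  TensorProduct.map₂ C.mul₂ C.mul

theorem mul₃_assoc_symm (a b : A) (z w : A ⊗[ℂ] A) :
    C.mul₃ ((TensorProduct.assoc ℂ A A A).symm (a ⊗ₜ z))
      ((TensorProduct.assoc ℂ A A A).symm (b ⊗ₜ w)) =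
      (TensorProduct.assoc ℂ A A A).symm (C.mul a b ⊗ₜ C.mul₂ z w) := by
  induction z with
  | zero => simp
  | add x y hx hy => simp only [map_add, LinearMap.add_apply, TensorProduct.tmul_add, hx, hy]
  | tmul x y =>
    induction w with
    | zero => simp
    | add x y hx hy => simp only [map_add, TensorProduct.tmul_add, hx, hy]
    | tmul s t => simp

theorem mul₃_leg12 (v w : (A ⊗[ℂ] A) ⊗[ℂ] A) :
    C.mul₃ (leg12 C.E₂ v) w = C.mul₃ v (leg12 C.E₁ w) := by
  induction v with
  | zero => simp
  | add x y hx hy => simp only [map_add, LinearMap.add_apply, hx, hy]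
  | tmul x y =>
    induction w with
    | zero => simp
    | add x y hx hy => simp only [map_add, hx, hy]
    | tmul s t => simp [C.E_compat]

theorem mul₃_leg23 (v w : (A ⊗[ℂ] A) ⊗[ℂ] A) :
    C.mul₃ (leg23 C.E₂ v) w = C.mul₃ v (leg23 C.E₁ w) := by
  obtain ⟨v, rfl⟩ := (TensorProduct.assoc ℂ A A A).symm.surjective v
  obtain ⟨w, rfl⟩ := (TensorProduct.assoc ℂ A A A).symm.surjective w
  induction v with
  | zero => simp
  | add x y hx hy => simp only [map_add, LinearMap.add_apply, hx, hy]
  | tmul x y =>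
    induction w with
    | zero => simp
    | add x y hx hy => simp only [map_add, hx, hy]
    | tmul s t =>
      rw [leg23_assoc_symm, leg23_assoc_symm, mul₃_assoc_symm, mul₃_assoc_symm, C.E_compat]

theorem eq_zero_of_mul₃_left {w : (A ⊗[ℂ] A) ⊗[ℂ] A} (h : ∀ v, C.mul₃ v w = 0) : w = 0 := by
  refine slice3_ext (fun i : A × (A →ₗ[ℂ] ℂ) => i.2 ∘ₗ C.mul i.1) C.separating_mul_left fun i => ?_
  refine C.ext_of_mul₂_left fun v => ?_
  have key : ∀ w, C.mul₂ v (slice3 (i.2 ∘ₗ C.mul i.1) w) = slice3 i.2 (C.mul₃ (v ⊗ₜ i.1) w) := by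
    intro w
    induction w with
    | zero => simp
    | add x y hx hy => simp only [map_add, hx, hy]
    | tmul x y => simp
  rw [key, key, h]; simp

theorem mul₃_T₂_T₂ (a b e c : A) (w : A ⊗[ℂ] A) :
    C.mul₃ (leg23 C.T₂ (leg13 C.T₂ ((a ⊗ₜ b) ⊗ₜ e))) (leg23 C.T₁ (w ⊗ₜ c)) =
      leg23 (LinearMap.rTensor A (C.mul b))
        (leg23 C.T₁ (C.mul₂ (C.T₂ (a ⊗ₜ e)) w ⊗ₜ c)) := by
  rw [leg13_tmul]
  generalize C.T₂ (a ⊗ₜ e) = t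
  induction t with
  | zero => simp
  | add x y hx hy => simp only [map_add, TensorProduct.add_tmul, LinearMap.add_apply, hx, hy]
  | tmul s t =>
    induction w with
    | zero => simp
    | add x y hx hy => simp only [map_add, TensorProduct.add_tmul, hx, hy]
    | tmul x y =>
      rw [TensorProduct.rightComm_tmul, leg23_tmul, leg23_tmul, mul₃_assoc_symm,
        TensorProduct.map₂_apply_tmul, TensorProduct.map_tmul, leg23_tmul, leg23_assoc_symm, mul₂_T₂, ← C.T₁_mul_tmul]

/-- The pentagon shows that T₁ on legs 2, 3 preserves the range of E on legs 1, 2. For the kernel,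
elements are tested by left multiplication with the range of T₂ on legs 1, 2. -/
theorem E₁_T₁_of_T₂_E₂ (h : leg12 C.T₂ * leg23 C.E₂ = leg23 C.E₂ * leg12 C.T₂) :
    leg23 C.T₁ * leg12 C.E₁ = leg12 C.E₁ * leg23 C.T₁ := by
  symm
  refine commute_of_projection (by rw [← leg12_mul, C.E₁_mul_E₁]) ?_ ?_
  · have h1 : leg23 C.T₁ * leg12 C.E₁ =
        leg12 C.T₁ * (leg13 C.T₁ * leg23 C.T₁ * leg12 C.R₁) := by
      rw [← C.T₁_R₁, leg12_mul, ← _root_.mul_assoc, ← C.pentagon₁]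
      simp only [_root_.mul_assoc]
    rw [_root_.mul_assoc, h1, ← _root_.mul_assoc, ← leg12_mul, C.E₁_T₁]
  · intro u hu
    have hT : ∀ z w c, C.E₁ w = 0 → C.mul₃ (leg12 C.T₂ z) (leg23 C.T₁ (w ⊗ₜ c)) = 0 := by
      intro z w c hw
      have h2 : ∀ v, C.mul₃ (leg23 C.T₂ (leg13 C.T₂ v)) (leg23 C.T₁ (w ⊗ₜ c)) = 0 := by
        intro v
        have hf : (C.mul₃.flip (leg23 C.T₁ (w ⊗ₜ c)) ∘ₗ leg23 C.T₂) ∘ₗ leg13 C.T₂ = 0 := by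
          ext a b e
          have h3 : C.mul₂ (C.T₂ (a ⊗ₜ e)) w = 0 := by
            rw [← C.E₂_T₂, Module.End.mul_apply, C.E_compat, hw, map_zero]
          have := C.mul₃_T₂_T₂ a b e c w
          rw [h3] at this
          simpa using this
        exact LinearMap.congr_fun hf v
      -- E on legs 2, 3 is free in front of T₁ and may be moved to the left factor. There `h` and
      -- the second pentagon yield T₂ on legs 2, 3 after T₂ on legs 1, 3, the case settled by `h2`.
      have h4 : leg23 C.T₁ (w ⊗ₜ c) = leg23 C.E₁ (leg23 C.T₁ (w ⊗ₜ c)) := by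
        rw [← Module.End.mul_apply, ← leg23_mul, C.E₁_T₁]
      rw [h4, ← mul₃_leg23]
      have h5 : leg23 C.E₂ * leg12 C.T₂ =
          leg23 C.T₂ * (leg13 C.T₂ * (leg12 C.T₂ * leg23 C.R₂)) := by
        rw [← h, ← C.T₂_R₂, leg23_mul, ← _root_.mul_assoc, ← C.pentagon₂]
        simp only [_root_.mul_assoc]
      have h6 := LinearMap.congr_fun h5 z
      simp only [Module.End.mul_apply] at h6
      rw [h6, h2]
    have hE : ∀ w c, leg12 C.E₁ (leg23 C.T₁ ((w - C.E₁ w) ⊗ₜ c)) = 0 := by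
      intro w c
      refine C.eq_zero_of_mul₃_left fun v => ?_
      rw [← mul₃_leg12, ← C.T₂_R₂, leg12_mul, Module.End.mul_apply]
      refine hT _ _ _ ?_
      rw [map_sub, ← Module.End.mul_apply, C.E₁_mul_E₁, sub_self]
    have hE' : leg12 C.E₁ ∘ₗ leg23 C.T₁ ∘ₗ (LinearMap.id - leg12 C.E₁) = 0 := by
      refine TensorProduct.ext' fun z c => ?_
      have := hE z c
      simpa [TensorProduct.sub_tmul] using this
    have := LinearMap.congr_fun hE' u
    simpa [hu] using this

/-- The range part is `leg23_T₂_leg13_T₂`. For the kernel, slicing the third leg turns T₂ on legs 2,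
3 into `tau` followed by a left multiplication, and both commute with right multiplication by E. -/
theorem E₂_T₂_of_E₂_T₁ (h : leg12 C.E₂ * leg23 C.T₁ = leg23 C.T₁ * leg12 C.E₂) :
    leg23 C.T₂ * leg13 C.E₂ = leg12 C.E₂ * leg23 C.T₂ := by
  have h1 : leg12 C.E₂ * (leg23 C.T₂ * leg13 C.E₂) = leg23 C.T₂ * leg13 C.E₂ := by
    rw [← C.T₂_R₂, leg13_mul, ← _root_.mul_assoc (leg23 C.T₂), leg23_T₂_leg13_T₂, C.T₂_R₂,
      ← _root_.mul_assoc, ← _root_.mul_assoc, ← _root_.mul_assoc, ← leg12_mul, C.E₂_T₂]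
  have h2 : ∀ w b, C.E₂ w = 0 →
      leg12 C.E₂ (leg23 C.T₂ (TensorProduct.rightComm ℂ A A A (w ⊗ₜ b))) = 0 := by
    intro w b hw
    refine slice3_ext (fun i : A × (A →ₗ[ℂ] ℂ) => i.2 ∘ₗ C.mul.flip i.1) C.separating_mul_right
      fun i => ?_
    have h3 := congrArg (slice3 i.2) (LinearMap.congr_fun h (w ⊗ₜ i.1))
    simp only [Module.End.mul_apply, slice3_leg12, slice3_leg23_T₁, leg12_tmul, hw] at h3
    have h4 : ∀ w : A ⊗[ℂ] A, slice3 (i.2 ∘ₗ C.mul.flip i.1)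
        (leg23 C.T₂ (TensorProduct.rightComm ℂ A A A (w ⊗ₜ b))) =
        LinearMap.lTensor A (C.mul b) (LinearMap.lTensor A (C.tau i.1 i.2) w) := by
      intro w
      induction w with
      | zero => simp
      | add x y hx hy => simp only [map_add, TensorProduct.add_tmul, hx, hy]
      | tmul x y =>
        simp [← sliceRight_lTensor, ← C.compat, sliceRight_rTensor, tau_apply]
    have h5 : ∀ z, C.E₂ (LinearMap.lTensor A (C.mul b) z) = LinearMap.lTensor A (C.mul b) (C.E₂ z) := by
      intro z
      refine C.ext_of_mul₂_right fun v => ?_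
      have : ∀ z v, C.mul₂ (LinearMap.lTensor A (C.mul b) z) v =
          LinearMap.lTensor A (C.mul b) (C.mul₂ z v) := by
        intro z v
        induction z with
        | zero => simp
        | add x y hx hy => simp only [map_add, LinearMap.add_apply, hx, hy]
        | tmul x y =>
          induction v with
          | zero => simp
          | add x y hx hy => simp only [map_add, hx, hy]
          | tmul s t => simp [C.assoc]
      rw [this, C.E_compat, C.E_compat, this]
    rw [slice3_leg12, h4, h5, h3]; simp
  rw [← h1]
  rw [← _root_.mul_assoc]
  ext a b c
  have h8 := h2 (C.E₂ (a ⊗ₜ c) - a ⊗ₜ c) b (by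
    rw [map_sub, ← Module.End.mul_apply, C.E₂_mul_E₂, sub_self])
  simpa [TensorProduct.sub_tmul, sub_eq_zero] using h8

end CanonicalMaps

/-! ### Source and target maps; the antipode reverses products. -/

/-- The canonical maps of a regular weak multiplier Hopf algebra, with its antipode. -/
structure HopfMaps (A : Type*) [AddCommGroup A] [Module ℂ A] extends CanonicalMaps A where
  T₁_E₁ : leg12 T₁ * leg13 E₁ = leg23 E₁ * leg12 T₁
  T₂_E₂ : leg23 T₂ * leg13 E₂ = leg12 E₂ * leg23 T₂
  T₂_E₁ : leg12 T₂ * leg23 E₁ = leg23 E₁ * leg12 T₂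
  T₁_E₂ : leg23 T₁ * leg12 E₂ = leg12 E₂ * leg23 T₁
  T₁_E₁' : leg23 T₁ * leg12 E₁ = leg12 E₁ * leg23 T₁
  T₂_E₂' : leg12 T₂ * leg23 E₂ = leg23 E₂ * leg12 T₂
  S : A ≃ₗ[ℂ] A
  S_mul : ∀ a b, sliceLeft ε (R₁ (a ⊗ₜ b)) = mul (S a) b
  mul_S : ∀ a b, sliceRight ε (R₂ (b ⊗ₜ a)) = mul b (S a)

namespace HopfMaps
variable {A : Type*} [AddCommGroup A] [Module ℂ A] (C : HopfMaps A)

/-- The opposite product with the opposite coproduct. -/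
def op : HopfMaps A where
  toCanonicalMaps := C.toCanonicalMaps.op
  T₁_E₁ := by
    simp only [CanonicalMaps.op, leg12_flipConj, leg13_flipConj, leg23_flipConj, flip3_conj_mul,
      C.T₂_E₂]
  T₂_E₂ := by
    simp only [CanonicalMaps.op, leg12_flipConj, leg13_flipConj, leg23_flipConj, flip3_conj_mul,
      C.T₁_E₁]
  T₂_E₁ := by
    simp only [CanonicalMaps.op, leg12_flipConj, leg23_flipConj, flip3_conj_mul, C.T₁_E₂]
  T₁_E₂ := by
    simp only [CanonicalMaps.op, leg12_flipConj, leg23_flipConj, flip3_conj_mul, C.T₂_E₁]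
  T₁_E₁' := by
    simp only [CanonicalMaps.op, leg12_flipConj, leg23_flipConj, flip3_conj_mul, C.T₂_E₂']
  T₂_E₂' := by
    simp only [CanonicalMaps.op, leg12_flipConj, leg23_flipConj, flip3_conj_mul, C.T₁_E₁']
  S := C.S
  S_mul a b := by simp [CanonicalMaps.op, C.mul_S]
  mul_S a b := by simp [CanonicalMaps.op, C.S_mul]

/-- `ε_s(a) b` -/
def esL : A →ₗ[ℂ] A →ₗ[ℂ] A := TensorProduct.curry (sliceLeft C.ε ∘ₗ C.G₁)

/-- `ε_t(a) b` -/
def etL : A →ₗ[ℂ] A →ₗ[ℂ] A := TensorProduct.curry (TensorProduct.lift C.mul ∘ₗ C.R₁)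

/-- `b ε_s(a)` -/
def esR : A →ₗ[ℂ] A →ₗ[ℂ] A := TensorProduct.curry (TensorProduct.lift C.mul ∘ₗ C.R₂)

/-- `b ε_t(a)` -/
def etR : A →ₗ[ℂ] A →ₗ[ℂ] A := TensorProduct.curry (sliceRight C.ε ∘ₗ C.G₂)

theorem esL_apply (a b : A) : C.esL a b = sliceLeft C.ε (C.G₁ (a ⊗ₜ b)) := rfl
theorem etL_apply (a b : A) : C.etL a b = TensorProduct.lift C.mul (C.R₁ (a ⊗ₜ b)) := rfl
theorem esR_apply (b a : A) : C.esR b a = TensorProduct.lift C.mul (C.R₂ (b ⊗ₜ a)) := rfl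
theorem etR_apply (b a : A) : C.etR b a = sliceRight C.ε (C.G₂ (b ⊗ₜ a)) := rfl

theorem op_mul (a b : A) : C.op.mul a b = C.mul b a := rfl
theorem op_T₁ (z : A ⊗[ℂ] A) :
    C.op.T₁ z = TensorProduct.comm ℂ A A (C.T₂ (TensorProduct.comm ℂ A A z)) := rfl
theorem op_T₂ (z : A ⊗[ℂ] A) :
    C.op.T₂ z = TensorProduct.comm ℂ A A (C.T₁ (TensorProduct.comm ℂ A A z)) := rfl
theorem op_R₁ (z : A ⊗[ℂ] A) :
    C.op.R₁ z = TensorProduct.comm ℂ A A (C.R₂ (TensorProduct.comm ℂ A A z)) := rfl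
theorem op_R₂ (z : A ⊗[ℂ] A) :
    C.op.R₂ z = TensorProduct.comm ℂ A A (C.R₁ (TensorProduct.comm ℂ A A z)) := rfl
theorem op_G₁ (z : A ⊗[ℂ] A) :
    C.op.G₁ z = TensorProduct.comm ℂ A A (C.G₂ (TensorProduct.comm ℂ A A z)) := rfl
theorem op_G₂ (z : A ⊗[ℂ] A) :
    C.op.G₂ z = TensorProduct.comm ℂ A A (C.G₁ (TensorProduct.comm ℂ A A z)) := rfl
theorem op_S (a : A) : C.op.S a = C.S a := rfl
theorem op_ε : C.op.ε = C.ε := rfl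
theorem op_lam (a : A) (ρ : A →ₗ[ℂ] ℂ) : C.op.lam a ρ = C.tau a ρ := C.toCanonicalMaps.op_lam a ρ
theorem op_tau (a : A) (ρ : A →ₗ[ℂ] ℂ) : C.op.tau a ρ = C.lam a ρ := C.toCanonicalMaps.op_tau a ρ

theorem lift_op (z : A ⊗[ℂ] A) :
    TensorProduct.lift C.op.mul z = TensorProduct.lift C.mul (TensorProduct.comm ℂ A A z) :=
  lift_flip C.mul z

theorem op_esL (a b : A) : C.op.esL a b = C.etR b a := by
  simp [esL_apply, etR_apply, op_G₁, op_ε]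
theorem op_etR (b a : A) : C.op.etR b a = C.esL a b := by
  simp [esL_apply, etR_apply, op_G₂, op_ε]
theorem op_etL (a b : A) : C.op.etL a b = C.esR b a := by
  simp [etL_apply, esR_apply, op_R₁, lift_op]
theorem op_esR (b a : A) : C.op.esR b a = C.etL a b := by
  simp [etL_apply, esR_apply, op_R₂, lift_op]

theorem tau_lam (a q : A) (ρ ω : A →ₗ[ℂ] ℂ) (p : A) :
    C.tau q ω (C.lam a ρ p) = C.lam a ρ (C.tau q ω p) := by
  have := C.T₁_lam a ρ (p ⊗ₜ q)
  rw [LinearMap.rTensor_tmul] at this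
  rw [CanonicalMaps.tau_apply, this, sliceRight_rTensor, CanonicalMaps.tau_apply]

/-- This is fullness of Δ. The values of `tau` are closed under scalars, so no scalar case is
needed. -/
theorem tau_induction {P : A → Prop} (h0 : P 0) (hadd : ∀ a b, P a → P b → P (a + b))
    (htau : ∀ q ω p, P (C.tau q ω p)) (a : A) : P a := by
  have : a ∈ Submodule.span ℂ {x | ∃ ω a b, x = sliceRight ω (C.T₁ (a ⊗ₜ b))} := by
    rw [C.full_left]; trivial
  induction this using Submodule.closure_induction with
  | zero => exact h0
  | add x y _ _ hx hy => exact hadd x y hx hy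
  | smul_mem r x hx =>
    obtain ⟨ω, p, q, rfl⟩ := hx
    have : r • sliceRight ω (C.T₁ (p ⊗ₜ q)) = C.tau q ω (r • p) := by
      rw [map_smul, CanonicalMaps.tau_apply]
    rw [this]; exact htau q ω _

theorem slice3_leg13_T₁ (ω : A →ₗ[ℂ] ℂ) (p b q : A) :
    slice3 ω (leg13 C.T₁ ((p ⊗ₜ b) ⊗ₜ q)) = C.tau q ω p ⊗ₜ b := by
  simp [CanonicalMaps.tau_apply]

theorem G₁_tau (q : A) (ω : A →ₗ[ℂ] ℂ) (p b : A) : C.G₁ (C.tau q ω p ⊗ₜ b) =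
    slice3 ω (leg13 C.T₁ (leg23 C.E₁ ((p ⊗ₜ b) ⊗ₜ q))) := by
  rw [← slice3_leg13_T₁, ← slice3_leg12, ← Module.End.mul_apply, C.G₁_spec, Module.End.mul_apply]

theorem E₁_lam (a : A) (ρ : A →ₗ[ℂ] ℂ) (z : A ⊗[ℂ] A) :
    C.E₁ (LinearMap.rTensor A (C.lam a ρ) z) = LinearMap.rTensor A (C.lam a ρ) (C.E₁ z) :=
  C.lam_comm_of_leg C.T₂_E₁ a ρ z

/-- By fullness it suffices to treat slices of T₁, where `G₁_tau` expresses G₁ by T₁ and E₁. -/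
theorem G₁_lam (a : A) (ρ : A →ₗ[ℂ] ℂ) (z : A ⊗[ℂ] A) :
    C.G₁ (LinearMap.rTensor A (C.lam a ρ) z) = LinearMap.rTensor A (C.lam a ρ) (C.G₁ z) := by
  induction z with
  | zero => simp
  | add x y hx hy => simp only [map_add, hx, hy]
  | tmul x b =>
    induction x using C.tau_induction with
    | h0 => simp
    | hadd x y hx hy => simp only [map_add, TensorProduct.add_tmul, hx, hy]
    | htau q ω p =>
      have h13 := CanonicalMaps.leg13_rTensor_comm (C.lam a ρ) (C.T₁_lam a ρ)
      have h23 := CanonicalMaps.leg23_rTensor_comm (C.lam a ρ) C.E₁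
      have h := LinearMap.congr_fun (h13.mul_left h23).eq ((p ⊗ₜ b) ⊗ₜ q)
      simp only [Module.End.mul_apply, leg12_tmul, LinearMap.rTensor_tmul] at h
      rw [LinearMap.rTensor_tmul, ← tau_lam, G₁_tau, G₁_tau, h, slice3_leg12]

/-- Since R₁ = R₁E₁ and R₁ = G₁R₁, the generalized inverse inherits this from T₁, E₁ and G₁. -/
theorem R₁_lam (a : A) (ρ : A →ₗ[ℂ] ℂ) (z : A ⊗[ℂ] A) :
    C.R₁ (LinearMap.rTensor A (C.lam a ρ) z) = LinearMap.rTensor A (C.lam a ρ) (C.R₁ z) := by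
  have hTR : ∀ z, C.T₁ (C.R₁ z) = C.E₁ z := LinearMap.congr_fun C.T₁_R₁
  have hRT : ∀ z, C.R₁ (C.T₁ z) = C.G₁ z := LinearMap.congr_fun C.R₁_T₁
  have hRE : ∀ z, C.R₁ (C.E₁ z) = C.R₁ z := LinearMap.congr_fun C.R₁_E₁
  have hGR : ∀ z, C.G₁ (C.R₁ z) = C.R₁ z := LinearMap.congr_fun C.G₁_R₁
  rw [← hRE, E₁_lam, ← hTR, ← C.T₁_lam, hRT, G₁_lam, hGR]

theorem sliceLeft_mul (a : A) (ρ : A →ₗ[ℂ] ℂ) (z : A ⊗[ℂ] A) : sliceLeft (ρ ∘ₗ C.mul a) z =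
    sliceLeft C.ε (LinearMap.rTensor A (C.lam a ρ) z) := by
  rw [sliceLeft_rTensor, C.ε_lam]

theorem sliceRight_mul_flip (a : A) (ρ : A →ₗ[ℂ] ℂ) (z : A ⊗[ℂ] A) :
    sliceRight (ρ ∘ₗ C.mul.flip a) z = sliceRight C.ε (LinearMap.lTensor A (C.tau a ρ) z) := by
  have := C.op.sliceLeft_mul a ρ (TensorProduct.comm ℂ A A z)
  rwa [sliceLeft_comm, op_lam, ← comm_lTensor, sliceLeft_comm] at this

theorem ext_of_comm_lam {F F' : A →ₗ[ℂ] A ⊗[ℂ] A}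
    (hF : ∀ a ρ p, F (C.lam a ρ p) = LinearMap.rTensor A (C.lam a ρ) (F p))
    (hF' : ∀ a ρ p, F' (C.lam a ρ p) = LinearMap.rTensor A (C.lam a ρ) (F' p))
    (h : ∀ p, sliceLeft C.ε (F p) = sliceLeft C.ε (F' p)) (p : A) : F p = F' p :=
  C.sliceLeft_ext_mul fun ρ a => by rw [sliceLeft_mul, sliceLeft_mul, ← hF, ← hF', h]

theorem R₂_tau (a : A) (ρ : A →ₗ[ℂ] ℂ) (z : A ⊗[ℂ] A) :
    C.R₂ (LinearMap.lTensor A (C.tau a ρ) z) = LinearMap.lTensor A (C.tau a ρ) (C.R₂ z) := by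
  have := C.op.R₁_lam a ρ (TensorProduct.comm ℂ A A z)
  rw [op_lam, ← comm_lTensor, op_R₁, op_R₁, comm_comm_apply, comm_comm_apply,
    ← comm_lTensor] at this
  exact (TensorProduct.comm ℂ A A).injective this

/-- `ε_s(a)` is the left leg of `E`. -/
theorem esL_tau (q : A) (ω : A →ₗ[ℂ] ℂ) (p b : A) : C.esL (C.tau q ω p) b =
    sliceRight (ω ∘ₗ C.mul p) (C.E₁ (b ⊗ₜ q)) := by
  rw [esL_apply, G₁_tau, leg23_tmul]
  generalize C.E₁ (b ⊗ₜ q) = z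
  induction z with
  | zero => simp
  | add x y hx hy => simp only [map_add, TensorProduct.tmul_add, hx, hy]
  | tmul x y =>
    rw [TensorProduct.assoc_symm_tmul, slice3_leg13_T₁, sliceLeft_tmul, CanonicalMaps.tau_apply,
      ← LinearMap.comp_apply, ← LinearMap.comp_apply, sliceRight_tmul]
    congr 1
    simp only [LinearMap.comp_apply]
    rw [← functional_sliceLeft, C.counit_left, TensorProduct.lift.tmul]

theorem slice3_leg23_E₁ (q : A) (ω : A →ₗ[ℂ] ℂ) (p : A) (z : A ⊗[ℂ] A) :
    slice3 (ω ∘ₗ C.mul p) (leg23 C.E₁ (z ⊗ₜ q)) = LinearMap.lTensor A (C.esL (C.tau q ω p)) z := by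
  induction z with
  | zero => simp
  | add x y hx hy => simp only [TensorProduct.add_tmul, map_add, hx, hy]
  | tmul x y => simp [esL_tau]

theorem slice3_leg13_E₁ (q : A) (ω : A →ₗ[ℂ] ℂ) (p : A) (z : A ⊗[ℂ] A) :
    slice3 (ω ∘ₗ C.mul p) (leg13 C.E₁ (z ⊗ₜ q)) = LinearMap.rTensor A (C.esL (C.tau q ω p)) z := by
  induction z with
  | zero => simp
  | add x y hx hy => simp only [TensorProduct.add_tmul, map_add, hx, hy]
  | tmul x y => simp [esL_tau]

/-- The values of ε_s are slices of E by `esL_tau`, so this is a slice of the commutation of E⊗1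
with 1⊗E. -/
theorem E₁_lTensor_esL (a : A) (z : A ⊗[ℂ] A) :
    C.E₁ (LinearMap.lTensor A (C.esL a) z) = LinearMap.lTensor A (C.esL a) (C.E₁ z) := by
  induction a using C.tau_induction with
  | h0 => simp
  | hadd x y hx hy => simp only [map_add, LinearMap.lTensor_add, LinearMap.add_apply, hx, hy]
  | htau q ω p =>
    rw [← slice3_leg23_E₁, ← slice3_leg23_E₁, ← slice3_leg12, ← leg12_tmul,
      ← Module.End.mul_apply, C.E₁_comm, Module.End.mul_apply]

/-- For x in the source algebra this reads Δ(xb) = (1⊗x)Δ(b); it is a slice of the relation for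
(Δ⊗ι)E. -/
theorem T₁_rTensor_esL (a : A) (z : A ⊗[ℂ] A) :
    C.T₁ (LinearMap.rTensor A (C.esL a) z) = LinearMap.lTensor A (C.esL a) (C.T₁ z) := by
  induction a using C.tau_induction with
  | h0 => simp
  | hadd x y hx hy =>
    simp only [map_add, LinearMap.lTensor_add, LinearMap.rTensor_add, LinearMap.add_apply, hx, hy]
  | htau q ω p =>
    rw [← slice3_leg23_E₁, ← slice3_leg13_E₁, ← slice3_leg12, ← leg12_tmul,
      ← Module.End.mul_apply, C.T₁_E₁, Module.End.mul_apply]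

theorem lift_mul_G₁ (z : A ⊗[ℂ] A) :
    TensorProduct.lift C.mul (C.G₁ z) = TensorProduct.lift C.mul z := by
  rw [← C.counit_left, ← Module.End.mul_apply, C.T₁_G₁, C.counit_left]

theorem etL_eq (a b : A) : C.etL a b = sliceLeft C.ε (C.E₁ (a ⊗ₜ b)) := by
  rw [etL_apply, ← C.counit_left, ← Module.End.mul_apply, C.T₁_R₁]

theorem sliceLeft_R₁ (z : A ⊗[ℂ] A) : sliceLeft C.ε (C.R₁ z) =
    TensorProduct.lift C.mul (LinearMap.rTensor A C.S.toLinearMap z) := by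
  induction z with
  | zero => simp
  | add x y hx hy => simp only [map_add, hx, hy]
  | tmul x y => simp [C.S_mul]

theorem sliceRight_R₂ (z : A ⊗[ℂ] A) : sliceRight C.ε (C.R₂ z) =
    TensorProduct.lift C.mul (LinearMap.lTensor A C.S.toLinearMap z) := by
  induction z with
  | zero => simp
  | add x y hx hy => simp only [map_add, hx, hy]
  | tmul x y => simp [C.mul_S]

theorem esL_eq (a b : A) : C.esL a b =
    TensorProduct.lift C.mul (LinearMap.rTensor A C.S.toLinearMap (C.T₁ (a ⊗ₜ b))) := by
  rw [← sliceLeft_R₁, esL_apply, ← C.R₁_T₁, Module.End.mul_apply]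

theorem lift_S_E₁ (z : A ⊗[ℂ] A) :
    TensorProduct.lift C.mul (LinearMap.rTensor A C.S.toLinearMap (C.E₁ z)) =
    TensorProduct.lift C.mul (LinearMap.rTensor A C.S.toLinearMap z) := by
  rw [← sliceLeft_R₁, ← Module.End.mul_apply, C.R₁_E₁, sliceLeft_R₁]

theorem esL_G₁ (z : A ⊗[ℂ] A) : TensorProduct.lift C.esL (C.R₁ z) = sliceLeft C.ε (C.R₁ z) := by
  have h : TensorProduct.lift C.esL = sliceLeft C.ε ∘ₗ C.G₁ := by ext; simp [esL_apply]
  rw [h, LinearMap.comp_apply, ← Module.End.mul_apply, C.G₁_R₁]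

/-- `(d ⊗ 1)(S ⊗ ι)T₁(a ⊗ b)` is covered by `R₂`. -/
theorem R₂_lTensor (d a b : A) : LinearMap.lTensor A (C.mul.flip b) (C.R₂ (d ⊗ₜ a)) =
    LinearMap.rTensor A (C.mul d ∘ₗ C.S.toLinearMap) (C.T₁ (a ⊗ₜ b)) := by
  refine sliceRight_ext (fun ω : A →ₗ[ℂ] ℂ => ω) eq_zero_of_forall_functional fun ω => ?_
  rw [sliceRight_lTensor, sliceRight_mul_flip, ← R₂_tau, LinearMap.lTensor_tmul, C.mul_S,
    sliceRight_rTensor, CanonicalMaps.tau_apply]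
  rfl

theorem lift_mul_lTensor_flip (b : A) (z : A ⊗[ℂ] A) :
    TensorProduct.lift C.mul (LinearMap.lTensor A (C.mul.flip b) z) =
      C.mul (TensorProduct.lift C.mul z) b := by
  induction z with
  | zero => simp
  | add x y hx hy => simp only [map_add, LinearMap.add_apply, hx, hy]
  | tmul x y => simp [C.assoc]

theorem lift_mul_rTensor_mul (d : A) (z : A ⊗[ℂ] A) :
    TensorProduct.lift C.mul (LinearMap.rTensor A (C.mul d) z) =
      C.mul d (TensorProduct.lift C.mul z) := by
  induction z with
  | zero => simp
  | add x y hx hy => simp only [map_add, hx, hy]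
  | tmul x y => simp [C.assoc]

/-- Both sides are Σ dS(a₁)a₂b, so `esL` and `esR` are the two actions of one multiplier ε_s(a). -/
theorem mul_esL (d a b : A) : C.mul d (C.esL a b) = C.mul (C.esR d a) b := by
  rw [esL_eq, ← lift_mul_rTensor_mul, ← LinearMap.comp_apply (LinearMap.rTensor A _),
    ← LinearMap.rTensor_comp, ← R₂_lTensor, lift_mul_lTensor_flip, esR_apply]

theorem mul_etL (d a b : A) : C.mul d (C.etL a b) = C.mul (C.etR d a) b := by
  have := C.op.mul_esL b a d
  rw [op_mul, op_mul, op_esL, op_esR] at this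
  exact this.symm

theorem E₁_rTensor_flip (b : A) (z : A ⊗[ℂ] A) : C.E₁ (LinearMap.rTensor A (C.mul.flip b) z) =
    LinearMap.rTensor A (C.mul.flip b) (C.E₁ z) := by
  refine C.ext_of_mul₂_left fun v => ?_
  have key : ∀ v z : A ⊗[ℂ] A, C.mul₂ v (LinearMap.rTensor A (C.mul.flip b) z) =
      LinearMap.rTensor A (C.mul.flip b) (C.mul₂ v z) := by
    intro v z
    induction v with
    | zero => simp
    | add x y hx hy => simp only [map_add, LinearMap.add_apply, hx, hy]
    | tmul x y =>
      induction z with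
      | zero => simp
      | add x y hx hy => simp only [map_add, hx, hy]
      | tmul s t => simp [C.assoc]
  rw [← C.E_compat, key, key, C.E_compat]

theorem E₁_mulLegs12 (v : (A ⊗[ℂ] A) ⊗[ℂ] A) :
    C.E₁ (mulLegs12 C.mul v) = mulLegs12 C.mul (leg13 C.E₁ v) := by
  have : C.E₁ ∘ₗ mulLegs12 C.mul = mulLegs12 C.mul ∘ₗ leg13 C.E₁ := by
    ext a b c
    simpa using C.E₁_rTensor_flip b (a ⊗ₜ c)
  exact LinearMap.congr_fun this v

theorem mulLegs12_leg12_G₁ (v : (A ⊗[ℂ] A) ⊗[ℂ] A) :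
    mulLegs12 C.mul (leg12 C.G₁ v) = mulLegs12 C.mul v := by
  induction v with
  | zero => simp
  | add x y hx hy => simp only [map_add, hx, hy]
  | tmul x y => simp [C.lift_mul_G₁]

/-- Multiplicativity of Δ, inverted. For v = a⊗b⊗c the right side is G₁ of Σ a₁b₁⊗S(b₂)S(a₂)c, so
this is anti-multiplicativity of S up to G₁. -/
theorem R₁_mulLegs12 (v : (A ⊗[ℂ] A) ⊗[ℂ] A) : C.R₁ (mulLegs12 C.mul v) =
    C.G₁ (mulLegs12 C.mul (leg23 C.R₁ (leg13 C.R₁ v))) := by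
  have h23 : ∀ v, leg23 C.T₁ (leg23 C.R₁ v) = leg23 C.E₁ v := fun v => by
    rw [← Module.End.mul_apply, ← leg23_mul, C.T₁_R₁]
  have h13 : ∀ v, leg13 C.T₁ (leg13 C.R₁ v) = leg13 C.E₁ v := fun v => by
    rw [← Module.End.mul_apply, ← leg13_mul, C.T₁_R₁]
  have hG : ∀ v, leg13 C.T₁ (leg23 C.E₁ v) = leg12 C.G₁ (leg13 C.T₁ v) := fun v =>
    (LinearMap.congr_fun C.G₁_spec v).symm
  rw [← C.R₁_T₁, Module.End.mul_apply, C.T₁_mul, h23, hG, h13, mulLegs12_leg12_G₁, ← E₁_mulLegs12,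
    ← Module.End.mul_apply, C.R₁_E₁]

theorem etL_mul (a b c : A) : C.etL (C.mul a b) c =
    TensorProduct.lift C.mul (LinearMap.lTensor A (C.etL b) (C.R₁ (a ⊗ₜ c))) := by
  have h := C.R₁_mulLegs12 ((a ⊗ₜ b) ⊗ₜ c)
  rw [mulLegs12_tmul, TensorProduct.lift.tmul] at h
  rw [etL_apply, h, lift_mul_G₁, leg13_tmul]
  generalize C.R₁ (a ⊗ₜ c) = z
  induction z with
  | zero => simp
  | add x y hx hy => simp only [map_add, TensorProduct.add_tmul, hx, hy]
  | tmul x y =>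
    rw [TensorProduct.rightComm_tmul, leg23_tmul, mulLegs12_assoc_symm, lift_mul_rTensor_mul,
      LinearMap.lTensor_tmul, TensorProduct.lift.tmul, etL_apply]

theorem esR_mul (c b a : A) : C.esR c (C.mul b a) =
    TensorProduct.lift C.mul (LinearMap.rTensor A (C.esR.flip b) (C.R₂ (c ⊗ₜ a))) := by
  have h : C.op.etL b = C.esR.flip b := by ext x; exact C.op_etL b x
  have := C.op.etL_mul a b c
  rwa [op_etL, lift_op, h, op_R₁, comm_lTensor, comm_comm_apply] at this

/-- In Sweedler notation ε_s(bc) = Σ S(c₁)ε_s(b)c₂. Anti-multiplicativity of S is not yet at hand;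
the formula comes from `etL_mul` by the mirror symmetry. -/
theorem esL_mul (b c x : A) : C.esL (C.mul b c) x =
    TensorProduct.lift C.mul (TensorProduct.map C.S.toLinearMap (C.esL b) (C.T₁ (c ⊗ₜ x))) := by
  refine C.ext_of_mul_left fun d => ?_
  have h1 : ∀ z : A ⊗[ℂ] A, LinearMap.lTensor A (C.mul.flip x)
      (LinearMap.rTensor A (C.esR.flip b) z) =
      LinearMap.rTensor A (C.esR.flip b) (LinearMap.lTensor A (C.mul.flip x) z) := by
    intro z
    rw [← LinearMap.comp_apply, ← LinearMap.comp_apply, LinearMap.lTensor_comp_rTensor,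
      LinearMap.rTensor_comp_lTensor]
  rw [mul_esL, esR_mul, ← lift_mul_lTensor_flip, h1, R₂_lTensor]
  generalize C.T₁ (c ⊗ₜ x) = z
  induction z with
  | zero => simp
  | add x y hx hy => simp only [map_add, hx, hy]
  | tmul x y => simp [← C.mul_esL, C.assoc]

/-- Apply ε⊗ι to `R₁_mulLegs12`, so that G₁ becomes ε_s and `esL_mul` applies. The E that arises
from T₁R₁ commutes with 1⊗ε_s(u) and is absorbed by S. -/
theorem S_mul_mul (a b : A) : C.S (C.mul a b) = C.mul (C.S b) (C.S a) := by
  refine C.ext_of_mul_right fun c => ?_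
  have h := C.R₁_mulLegs12 ((a ⊗ₜ b) ⊗ₜ c)
  rw [mulLegs12_tmul, TensorProduct.lift.tmul, leg13_tmul] at h
  have h1 : ∀ z, sliceLeft C.ε (C.G₁ (mulLegs12 C.mul (leg23 C.R₁
      (TensorProduct.rightComm ℂ A A A (z ⊗ₜ b))))) =
      C.mul (C.S b) (TensorProduct.lift C.esL z) := by
    intro z
    induction z with
    | zero => simp
    | add x y hx hy => simp only [map_add, TensorProduct.add_tmul, hx, hy]
    | tmul u v =>
      have h2 : ∀ w, sliceLeft C.ε (C.G₁ (LinearMap.rTensor A (C.mul u) w)) =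
          TensorProduct.lift C.mul (TensorProduct.map C.S.toLinearMap (C.esL u) (C.T₁ w)) := by
        intro w
        induction w with
        | zero => simp
        | add x y hx hy => simp only [map_add, hx, hy]
        | tmul x y => rw [LinearMap.rTensor_tmul, ← esL_apply, esL_mul]
      rw [TensorProduct.rightComm_tmul, leg23_tmul, mulLegs12_assoc_symm, h2,
        ← Module.End.mul_apply C.T₁, C.T₁_R₁, ← LinearMap.rTensor_comp_lTensor, LinearMap.comp_apply,
        ← E₁_lTensor_esL, lift_S_E₁]
      simp
  rw [← C.S_mul, h, h1, esL_G₁, C.S_mul, C.assoc]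

end HopfMaps

/-! ### The antipode reverses coproducts. -/

namespace HopfMaps
variable {A : Type*} [AddCommGroup A] [Module ℂ A] (C : HopfMaps A)

theorem lTensor_rTensor_comm (f g : A →ₗ[ℂ] A) (z : A ⊗[ℂ] A) :
    LinearMap.lTensor A f (LinearMap.rTensor A g z) =
      LinearMap.rTensor A g (LinearMap.lTensor A f z) := by
  rw [← LinearMap.comp_apply, ← LinearMap.comp_apply, LinearMap.lTensor_comp_rTensor,
      LinearMap.rTensor_comp_lTensor]

theorem esL_mul_right (a b x : A) : C.esL a (C.mul b x) = C.mul (C.esL a b) x :=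
  C.ext_of_mul_left fun d => by rw [mul_esL, ← C.assoc, ← C.assoc, mul_esL]

theorem esR_mul_left (c d a : A) : C.esR (C.mul c d) a = C.mul c (C.esR d a) :=
  C.ext_of_mul_right fun x => by rw [← mul_esL, C.assoc, C.assoc, mul_esL]

theorem slice1_leg13_G₁ (a : A) (z : A ⊗[ℂ] A) :
    slice1 C.ε (leg13 C.G₁ ((TensorProduct.assoc ℂ A A A).symm (a ⊗ₜ z))) =
      LinearMap.lTensor A (C.esL a) z := by
  induction z with
  | zero => simp
  | add x y hx hy => simp only [map_add, TensorProduct.tmul_add, hx, hy]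
  | tmul x y => simp [esL_apply]

/-- Applying ε to the first leg turns G₁ into ε_s, so by `ext_of_lam` this amounts to
`T₁_rTensor_esL`. -/
theorem T₁_G₁_leg : leg23 C.T₁ * leg12 C.G₁ = leg13 C.G₁ * leg23 C.T₁ := by
  have h12 := fun a ρ => CanonicalMaps.leg12_comm (C.G₁_lam a ρ)
  have h13 := fun a ρ => CanonicalMaps.leg13_rTensor_comm (C.lam a ρ) (C.G₁_lam a ρ)
  have h23 := fun a ρ => CanonicalMaps.leg23_rTensor_comm (C.lam a ρ) C.T₁
  refine C.ext_of_lam (fun a ρ => (h23 a ρ).mul_left (h12 a ρ))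
    (fun a ρ => (h13 a ρ).mul_left (h23 a ρ)) (fun v => ?_)
  have : slice1 C.ε ∘ₗ (leg23 C.T₁ * leg12 C.G₁) = slice1 C.ε ∘ₗ (leg13 C.G₁ * leg23 C.T₁) := by
    ext a b c
    have h := C.T₁_rTensor_esL a (b ⊗ₜ c)
    simpa [slice1_leg23, slice1_leg13_G₁, esL_apply] using h
  exact LinearMap.congr_fun this v

/-- The pentagon for the generalized inverse. It is first checked after composition with T₁ on legs
1, 2; the factor E₁ needed to insert T₁R₁ may be placed there by `T₁_E₁'`. -/
theorem R₁_R₁_T₁ : leg13 C.R₁ * leg12 C.R₁ * leg23 C.T₁ = leg23 C.T₁ * leg12 C.R₁ := by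
  have h : leg13 C.R₁ * leg12 C.R₁ * leg23 C.T₁ * leg12 C.T₁ = leg23 C.T₁ * leg12 C.G₁ := by
    calc _ = leg13 C.R₁ * leg12 C.R₁ * (leg12 C.T₁ * leg13 C.T₁ * leg23 C.T₁) := by
          rw [C.pentagon₁, _root_.mul_assoc]
      _ = leg13 C.R₁ * (leg12 C.G₁ * leg13 C.T₁) * leg23 C.T₁ := by
          rw [← C.R₁_T₁, leg12_mul]; simp only [_root_.mul_assoc]
      _ = leg13 C.G₁ * (leg23 C.E₁ * leg23 C.T₁) := by
          rw [C.G₁_spec, ← C.R₁_T₁, leg13_mul]; simp only [_root_.mul_assoc]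
      _ = leg23 C.T₁ * leg12 C.G₁ := by rw [← leg23_mul, C.E₁_T₁, T₁_G₁_leg]
  calc leg13 C.R₁ * leg12 C.R₁ * leg23 C.T₁
      = leg13 C.R₁ * (leg12 C.R₁ * leg12 C.E₁) * leg23 C.T₁ := by rw [← leg12_mul, C.R₁_E₁]
    _ = leg13 C.R₁ * leg12 C.R₁ * leg23 C.T₁ * leg12 C.T₁ * leg12 C.R₁ := by
        rw [_root_.mul_assoc _ (leg12 C.T₁), ← leg12_mul C.T₁, C.T₁_R₁, _root_.mul_assoc _ (leg23 C.T₁),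
          C.T₁_E₁']
        simp only [_root_.mul_assoc]
    _ = leg23 C.T₁ * leg12 C.R₁ := by rw [h, _root_.mul_assoc, ← leg12_mul, C.G₁_R₁]

theorem R₂_R₂_T₂ : leg13 C.R₂ * leg23 C.R₂ * leg12 C.T₂ = leg12 C.T₂ * leg23 C.R₂ := by
  have := congrArg (fun x => flip3 A * x * flip3 A) C.op.R₁_R₁_T₁
  simpa only [op, CanonicalMaps.op, leg12_flipConj, leg13_flipConj, leg23_flipConj, flip3_conj_mul,
    flip3_conj_flip3_conj] using this

theorem R₂_rTensor_S (c a e : A) : LinearMap.rTensor A (C.mul.flip (C.S e)) (C.R₂ (c ⊗ₜ a)) =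
    LinearMap.rTensor A (C.mul c ∘ₗ C.S.toLinearMap) (C.T₂ (e ⊗ₜ a)) := by
  refine C.ext_of_lTensor_mul_flip fun b => ?_
  rw [lTensor_rTensor_comm, R₂_lTensor, lTensor_rTensor_comm, ← C.compat,
    ← LinearMap.rTensor_comp_apply, ← LinearMap.rTensor_comp_apply]
  congr 2
  ext x
  simp [C.S_mul_mul, C.assoc]

theorem R₁_rTensor (d a b : A) : LinearMap.rTensor A (C.mul d) (C.R₁ (a ⊗ₜ b)) =
    LinearMap.lTensor A (C.mul.flip b ∘ₗ C.S.toLinearMap) (C.T₂ (d ⊗ₜ a)) := by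
  have h := C.op.R₂_lTensor b a d
  rw [op_R₂, op_T₁, TensorProduct.comm_tmul, TensorProduct.comm_tmul, ← comm_rTensor,
    ← comm_lTensor] at h
  exact (TensorProduct.comm ℂ A A).injective h

theorem slice3_leg13_R₂ (b : A) (z : A ⊗[ℂ] A) :
    slice3 C.ε (leg13 C.R₂ ((TensorProduct.assoc ℂ A A A).symm (b ⊗ₜ z))) =
      TensorProduct.comm ℂ A A (LinearMap.lTensor A (C.mul b ∘ₗ C.S.toLinearMap) z) := by
  induction z with
  | zero => simp
  | add x y hx hy => simp only [map_add, TensorProduct.tmul_add, hx, hy]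
  | tmul x y => simp [C.mul_S]

/-- Anti-comultiplicativity up to E. Multiplying from the left by the range of T₂ allows the inverse
pentagon for R₂ to be used, but detects elements only after E. This weak form suffices for the
relations between S, ε_s and ε_t, from which `T₁_S` removes E. -/
theorem E₁_S (a e : A) : C.T₁ (C.S a ⊗ₜ C.S e) = C.E₁ (TensorProduct.comm ℂ A A
    (TensorProduct.map C.S.toLinearMap C.S.toLinearMap (C.T₂ (e ⊗ₜ a)))) := by
  set N := TensorProduct.comm ℂ A A
    (TensorProduct.map C.S.toLinearMap C.S.toLinearMap (C.T₂ (e ⊗ₜ a))) with hN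
  have key : ∀ t : A ⊗[ℂ] A, LinearMap.lTensor A (C.mul.flip (C.S e))
      (slice3 C.ε (leg13 C.R₂ (leg23 C.R₂ (t ⊗ₜ a)))) = C.mul₂ t N := by
    intro t
    induction t with
    | zero => simp
    | add x y hx hy => simp only [map_add, TensorProduct.add_tmul, LinearMap.add_apply, hx, hy]
    | tmul b c =>
      rw [leg23_tmul, slice3_leg13_R₂, ← comm_rTensor, ← lTensor_rTensor_comm, R₂_rTensor_S, hN]
      generalize C.T₂ (e ⊗ₜ a) = y
      induction y with
      | zero => simp
      | add x y hx hy => simp only [map_add, hx, hy]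
      | tmul x y => simp
  have hT : ∀ w, C.mul₂ (C.T₂ w) (C.T₁ (C.S a ⊗ₜ C.S e)) = C.mul₂ (C.T₂ w) N := by
    intro w
    induction w with
    | zero => simp
    | add x y hx hy => simp only [map_add, LinearMap.add_apply, hx, hy]
    | tmul b c =>
      rw [C.mul₂_T₂, ← C.T₁_mul_tmul, C.compat, ← C.mul_S, ← key, ← leg12_tmul,
        ← Module.End.mul_apply (leg23 C.R₂), ← Module.End.mul_apply (leg13 C.R₂),
        ← _root_.mul_assoc, C.R₂_R₂_T₂, Module.End.mul_apply, slice3_leg12, leg23_tmul, slice3_assoc_symm]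
  refine C.ext_of_mul₂_left fun v => ?_
  have h1 : C.T₁ (C.S a ⊗ₜ C.S e) = C.E₁ (C.T₁ (C.S a ⊗ₜ C.S e)) := by
    rw [← Module.End.mul_apply, C.E₁_T₁]
  rw [h1, ← C.E_compat, ← C.E_compat, ← C.T₂_R₂, Module.End.mul_apply, hT]

theorem etR_eq (b a : A) : C.etR b a =
    TensorProduct.lift C.mul (LinearMap.lTensor A C.S.toLinearMap (C.T₂ (b ⊗ₜ a))) := by
  rw [← sliceRight_R₂, etR_apply, ← C.R₂_T₂, Module.End.mul_apply]

/-- The factor E in `E₁_S` is invisible after S on the first leg and multiplication, by `lift_S_E₁`.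
-/
theorem esL_S (b e : A) : C.esL (C.S b) (C.S e) = C.S (C.etR e b) := by
  rw [esL_eq, E₁_S, lift_S_E₁, etR_eq]
  generalize C.T₂ (e ⊗ₜ b) = y
  induction y with
  | zero => simp
  | add x y hx hy => simp only [map_add, hx, hy]
  | tmul x y => simp [C.S_mul_mul]

theorem etR_S (e b : A) : C.etR (C.S e) (C.S b) = C.S (C.esL b e) := by
  have := C.op.esL_S b e
  rwa [op_S, op_S, op_S, op_esL, op_etR] at this

theorem etL_S (b e : A) : C.etL (C.S b) (C.S e) = C.S (C.esR e b) := by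
  refine C.ext_of_mul_left fun c => ?_
  obtain ⟨c, rfl⟩ := C.S.surjective c
  rw [mul_etL, etR_S, ← S_mul_mul, ← S_mul_mul, mul_esL]

theorem T₂_lTensor_esL (c a p : A) : C.T₂ (c ⊗ₜ C.esL a p) =
    LinearMap.lTensor A (C.esL a) (C.T₂ (c ⊗ₜ p)) := by
  refine C.ext_of_lTensor_mul_flip fun b => ?_
  have h : LinearMap.lTensor A (C.mul.flip b) ∘ₗ LinearMap.lTensor A (C.esL a) =
      LinearMap.lTensor A (C.esL a) ∘ₗ LinearMap.lTensor A (C.mul.flip b) := by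
    rw [← LinearMap.lTensor_comp, ← LinearMap.lTensor_comp]
    congr 1; ext x; simp [C.esL_mul_right]
  have h1 := C.T₁_rTensor_esL a (p ⊗ₜ b)
  rw [LinearMap.rTensor_tmul] at h1
  rw [← C.compat, h1, ← LinearMap.comp_apply (LinearMap.lTensor A (C.mul.flip b)), h,
    LinearMap.comp_apply, ← C.compat, lTensor_rTensor_comm]

theorem lam_esL (c : A) (ρ : A →ₗ[ℂ] ℂ) (a p : A) :
    C.lam c ρ (C.esL a p) = C.esL a (C.lam c ρ p) := by
  rw [CanonicalMaps.lam_apply, T₂_lTensor_esL, sliceLeft_lTensor, CanonicalMaps.lam_apply]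

/-- Both sides commute with `lam`, and applying ε to the first leg gives S(ε_s(a)p)S(q) =
S(p)S(qε_s(a)). Source elements thus pass through E from one leg to the other by means of S. -/
theorem R₁_esL_tmul (a q p : A) : C.R₁ (C.esL a p ⊗ₜ C.S q) = C.R₁ (p ⊗ₜ C.S (C.esR q a)) := by
  refine C.ext_of_comm_lam
    (F := C.R₁ ∘ₗ (TensorProduct.mk ℂ A A).flip (C.S q) ∘ₗ C.esL a)
    (F' := C.R₁ ∘ₗ (TensorProduct.mk ℂ A A).flip (C.S (C.esR q a))) ?_ ?_ ?_ p
  · intro c ρ p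
    have := C.R₁_lam c ρ (C.esL a p ⊗ₜ C.S q)
    simpa [lam_esL] using this
  · intro c ρ p
    have := C.R₁_lam c ρ (p ⊗ₜ C.S (C.esR q a))
    simpa using this
  · intro p
    simp [C.S_mul, ← S_mul_mul, mul_esL]

theorem E₁_esL_tmul (a q p : A) : C.E₁ (C.esL a p ⊗ₜ C.S q) = C.E₁ (p ⊗ₜ C.S (C.esR q a)) := by
  rw [← C.T₁_R₁, Module.End.mul_apply, R₁_esL_tmul, Module.End.mul_apply]

theorem T₁_etL_tmul (p b q : A) : C.T₁ (p ⊗ₜ C.etL (C.S b) q) =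
    LinearMap.rTensor A (C.esR.flip b) (C.T₁ (p ⊗ₜ q)) := by
  refine C.ext_of_rTensor_mul_flip fun x => ?_
  obtain ⟨q, rfl⟩ := C.S.surjective q
  rw [← C.deltaLeft_tmul, etL_S, ← C.deltaLeft_E₁, ← E₁_esL_tmul, C.deltaLeft_E₁, C.deltaLeft_tmul,
    ← LinearMap.rTensor_comp_apply]
  congr 2
  ext y
  simp [mul_esL]

/-- Slices of G₁ in the second leg act on the first leg as right multiplications by source elements;
hence G₁ commutes with left multiplications on that leg. -/
theorem sliceRight_G₁ (c : A) (ρ : A →ₗ[ℂ] ℂ) (s b : A) :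
    sliceRight (ρ ∘ₗ C.mul c) (C.G₁ (s ⊗ₜ b)) = C.esR s (C.S.symm (C.lam c ρ b)) := by
  induction s using C.tau_induction with
  | h0 => simp
  | hadd x y hx hy => simp only [map_add, TensorProduct.add_tmul, LinearMap.add_apply, hx, hy]
  | htau q ω p =>
    have key : ∀ z, sliceRight (ρ ∘ₗ C.mul c) (slice3 ω (leg13 C.T₁
        ((TensorProduct.assoc ℂ A A A).symm (p ⊗ₜ z)))) =
        sliceRight ω (C.T₁ (p ⊗ₜ sliceLeft (ρ ∘ₗ C.mul c) z)) := by
      intro z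
      induction z with
      | zero => simp
      | add x y hx hy => simp only [map_add, TensorProduct.tmul_add, hx, hy]
      | tmul x y => simp
    have h2 := C.E₁_lam c ρ (b ⊗ₜ q)
    rw [LinearMap.rTensor_tmul] at h2
    rw [G₁_tau, leg23_tmul, key, sliceLeft_mul, ← h2, ← etL_eq,
      ← C.S.apply_symm_apply (C.lam c ρ b), T₁_etL_tmul, sliceRight_rTensor, C.S.apply_symm_apply]
    rfl

theorem G₁_rTensor_mul (a : A) (z : A ⊗[ℂ] A) :
    C.G₁ (LinearMap.rTensor A (C.mul a) z) = LinearMap.rTensor A (C.mul a) (C.G₁ z) := by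
  induction z with
  | zero => simp
  | add x y hx hy => simp only [map_add, hx, hy]
  | tmul s b =>
    refine C.sliceRight_ext_mul fun ρ c => ?_
    rw [LinearMap.rTensor_tmul, sliceRight_G₁, esR_mul_left, sliceRight_rTensor, sliceRight_G₁]

theorem esR_esL (a p b : A) : C.esR (C.esL a p) b = C.esL a (C.esR p b) :=
  C.ext_of_mul_right fun x => by rw [← mul_esL, ← esL_mul_right, ← esL_mul_right, mul_esL]

theorem G₁_rTensor_esL (a : A) (z : A ⊗[ℂ] A) :
    C.G₁ (LinearMap.rTensor A (C.esL a) z) = LinearMap.rTensor A (C.esL a) (C.G₁ z) := by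
  induction z with
  | zero => simp
  | add x y hx hy => simp only [map_add, hx, hy]
  | tmul s b =>
    refine C.sliceRight_ext_mul fun ρ c => ?_
    rw [LinearMap.rTensor_tmul, sliceRight_G₁, esR_esL, sliceRight_rTensor, sliceRight_G₁]

theorem R₁_lTensor_esL (a : A) (z : A ⊗[ℂ] A) :
    C.R₁ (LinearMap.lTensor A (C.esL a) z) = LinearMap.rTensor A (C.esL a) (C.R₁ z) := by
  have hTR : ∀ z, C.T₁ (C.R₁ z) = C.E₁ z := LinearMap.congr_fun C.T₁_R₁
  have hRT : ∀ z, C.R₁ (C.T₁ z) = C.G₁ z := LinearMap.congr_fun C.R₁_T₁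
  have hRE : ∀ z, C.R₁ (C.E₁ z) = C.R₁ z := LinearMap.congr_fun C.R₁_E₁
  have hGR : ∀ z, C.G₁ (C.R₁ z) = C.R₁ z := LinearMap.congr_fun C.G₁_R₁
  rw [← hRE, E₁_lTensor_esL, ← hTR, ← T₁_rTensor_esL, hRT, G₁_rTensor_esL, hGR]

theorem R₁_E₁_leg : leg12 C.R₁ * leg23 C.E₁ = leg13 C.E₁ * leg12 C.R₁ := by
  refine TensorProduct.ext' fun z q => ?_
  refine slice3_ext (fun i : A × (A →ₗ[ℂ] ℂ) => i.2 ∘ₗ C.mul i.1) C.separating_mul_left fun i => ?_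
  rw [Module.End.mul_apply, Module.End.mul_apply, slice3_leg12, slice3_leg23_E₁, leg12_tmul,
    slice3_leg13_E₁, R₁_lTensor_esL]

theorem slice1_leg13_R₁ (z : A ⊗[ℂ] A) (c : A) : slice1 C.ε (leg13 C.R₁ (z ⊗ₜ c)) =
    TensorProduct.comm ℂ A A (LinearMap.rTensor A (C.mul.flip c ∘ₗ C.S.toLinearMap) z) := by
  induction z with
  | zero => simp
  | add x y hx hy => simp only [map_add, TensorProduct.add_tmul, hx, hy]
  | tmul x y => simp [C.S_mul]

/-- On the range of T₁ this is the inverse pentagon. Neither side changes when z is replaced by Ez,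
by `deltaLeft_E₁` and `R₁_E₁_leg`. -/
theorem deltaLeft_S (a : A) (z : A ⊗[ℂ] A) : C.deltaLeft (C.S a) z =
    slice1 C.ε (leg13 C.R₁ (leg12 C.R₁ ((TensorProduct.assoc ℂ A A A).symm (a ⊗ₜ z)))) := by
  have hT : ∀ w, C.deltaLeft (C.S a) (C.T₁ w) = slice1 C.ε (leg13 C.R₁ (leg12 C.R₁
      ((TensorProduct.assoc ℂ A A A).symm (a ⊗ₜ C.T₁ w)))) := by
    intro w
    induction w with
    | zero => simp
    | add x y hx hy => simp only [map_add, TensorProduct.tmul_add, hx, hy]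
    | tmul b c =>
      rw [← C.T₁_mul_tmul, ← leg23_tmul, ← Module.End.mul_apply, ← Module.End.mul_apply, R₁_R₁_T₁,
        Module.End.mul_apply, slice1_leg23, leg12_tmul, slice1_tmul, C.S_mul]
  rw [← C.deltaLeft_E₁, ← C.T₁_R₁, Module.End.mul_apply, hT, ← Module.End.mul_apply C.T₁, C.T₁_R₁,
    ← leg23_assoc_symm, ← Module.End.mul_apply (leg12 C.R₁), R₁_E₁_leg, Module.End.mul_apply,
    ← Module.End.mul_apply (leg13 C.R₁), ← leg13_mul, C.R₁_E₁]

/-- The antipode is anti-comultiplicative. -/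
theorem T₁_S (a e : A) : C.T₁ (C.S a ⊗ₜ C.S e) = TensorProduct.comm ℂ A A
    (TensorProduct.map C.S.toLinearMap C.S.toLinearMap (C.T₂ (e ⊗ₜ a))) := by
  refine C.ext_of_rTensor_mul_flip fun x => ?_
  have h : C.mul.flip (C.S e) ∘ₗ C.S.toLinearMap = C.S.toLinearMap ∘ₗ C.mul e := by
    ext u; simp [C.S_mul_mul]
  rw [← C.deltaLeft_tmul, deltaLeft_S, TensorProduct.assoc_symm_tmul, leg12_tmul, slice1_leg13_R₁,
    h, LinearMap.rTensor_comp, LinearMap.comp_apply, R₁_rTensor]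
  generalize C.T₂ (e ⊗ₜ a) = y
  induction y with
  | zero => simp
  | add x y hx hy => simp only [map_add, hx, hy]
  | tmul x y => simp

theorem T₂_S (e a : A) : C.T₂ (C.S e ⊗ₜ C.S a) = TensorProduct.comm ℂ A A
    (TensorProduct.map C.S.toLinearMap C.S.toLinearMap (C.T₁ (a ⊗ₜ e))) := by
  have h := C.op.T₁_S a e
  rw [op_S, op_S, op_T₁, op_T₂, TensorProduct.comm_tmul, TensorProduct.comm_tmul,
    (TensorProduct.comm ℂ A A).injective.eq_iff] at h
  rw [h]
  change TensorProduct.map C.S.toLinearMap C.S.toLinearMap _ = _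
  generalize C.T₁ (a ⊗ₜ e) = y
  induction y with
  | zero => simp
  | add x y hx hy => simp only [map_add, hx, hy]
  | tmul x y => simp

end HopfMaps

/-! ### Left invariant functionals and strong invariance. -/

namespace HopfMaps
variable {A : Type*} [AddCommGroup A] [Module ℂ A] (C : HopfMaps A)

theorem op_esL_eq (s : A) : C.op.esL s = C.etR.flip s := by ext x; exact C.op_esL s x

theorem T₂_lTensor_etR (s : A) (z : A ⊗[ℂ] A) :
    C.T₂ (LinearMap.lTensor A (C.etR.flip s) z) = LinearMap.rTensor A (C.etR.flip s) (C.T₂ z) := by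
  have h := C.op.T₁_rTensor_esL s (TensorProduct.comm ℂ A A z)
  rw [op_esL_eq, op_T₁, op_T₁, ← comm_lTensor, comm_comm_apply, comm_comm_apply,
    ← comm_rTensor] at h
  exact (TensorProduct.comm ℂ A A).injective h

theorem G₂_lTensor_flip (b : A) (z : A ⊗[ℂ] A) :
    C.G₂ (LinearMap.lTensor A (C.mul.flip b) z) = LinearMap.lTensor A (C.mul.flip b) (C.G₂ z) := by
  have h := C.op.G₁_rTensor_mul b (TensorProduct.comm ℂ A A z)
  change C.op.G₁ (LinearMap.rTensor A (C.mul.flip b) _) =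
    LinearMap.rTensor A (C.mul.flip b) _ at h
  rw [op_G₁, op_G₁, ← comm_lTensor, comm_comm_apply, comm_comm_apply, ← comm_lTensor] at h
  exact (TensorProduct.comm ℂ A A).injective h

theorem G₂_R₂ : C.G₂ * C.R₂ = C.R₂ := by
  rw [← C.R₂_T₂, _root_.mul_assoc, C.T₂_R₂, C.R₂_E₂]

/-- `((d ⊗ a)E)Δ(b) = (d ⊗ a)Δ(b)`. -/
theorem T₂_lTensor_R₂ (d a b : A) : C.T₂ (LinearMap.lTensor A (C.mul.flip b) (C.R₂ (d ⊗ₜ a))) =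
    LinearMap.lTensor A (C.mul a) (C.T₂ (d ⊗ₜ b)) := by
  have h1 : ∀ z, C.op.T₁ (LinearMap.rTensor A (C.mul.flip b) z) = C.op.deltaLeft b (C.op.T₁ z) := by
    intro z
    induction z with
    | zero => simp
    | add x y hx hy => simp only [map_add, hx, hy]
    | tmul x y => exact C.op.T₁_mul_tmul b x y
  have h2 := h1 (C.op.R₁ (a ⊗ₜ d))
  have h3 : C.op.T₁ (C.op.R₁ (a ⊗ₜ d)) = C.op.E₁ (a ⊗ₜ d) :=
    LinearMap.congr_fun C.op.T₁_R₁ _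
  rw [h3, C.op.deltaLeft_E₁, C.op.deltaLeft_tmul, op_R₁,
    TensorProduct.comm_tmul, op_T₁, ← comm_lTensor, comm_comm_apply, op_T₁,
    TensorProduct.comm_tmul] at h2
  apply (TensorProduct.comm ℂ A A).injective
  rw [h2, comm_lTensor]
  rfl

/-- A functional vanishing on these elements annihilates the first leg of E, hence that of T₁ = ET₁,
and Δ is full. -/
theorem span_esL : Submodule.span ℂ {x | ∃ a b, x = C.esL a b} = ⊤ := by
  refine span_eq_top_of_functional fun ξ hξ => ?_
  have h1 : ∀ z, sliceLeft ξ (C.E₁ z) = 0 := by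
    intro z
    induction z with
    | zero => simp
    | add x y hx hy => simp only [map_add, hx, hy, add_zero]
    | tmul b q =>
      refine C.separating_mul_left _ fun i => ?_
      rw [functional_sliceLeft, ← esL_tau]
      exact hξ _ ⟨_, _, rfl⟩
  refine functional_eq_zero_of_span C.full_left fun v hv => ?_
  obtain ⟨ω, a, b, rfl⟩ := hv
  rw [← functional_sliceLeft, ← C.E₁_T₁, Module.End.mul_apply, h1, map_zero]

theorem span_etR : Submodule.span ℂ {x | ∃ b a, x = C.etR b a} = ⊤ := by
  rw [← C.op.span_esL]; congr 1; ext x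
  simp only [op_esL]
  exact ⟨fun ⟨a, b, h⟩ => ⟨b, a, h⟩, fun ⟨a, b, h⟩ => ⟨b, a, h⟩⟩

theorem lam_induction {P : A → Prop} (h0 : P 0) (hadd : ∀ a b, P a → P b → P (a + b))
    (hlam : ∀ q ω p, P (C.lam q ω p)) (a : A) : P a :=
  C.op.tau_induction h0 hadd (fun q ω p => by rw [op_tau]; exact hlam q ω p) a

theorem sliceLeft_E₁ (c : A) (ρ : A →ₗ[ℂ] ℂ) (b q : A) :
    sliceLeft (ρ ∘ₗ C.mul c) (C.E₁ (b ⊗ₜ q)) = C.etL (C.lam c ρ b) q := by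
  rw [sliceLeft_mul, ← E₁_lam, LinearMap.rTensor_tmul, etL_eq]

/-- The argument of `span_esL` on the second leg, where the counit and A² = A take the place of
fullness. -/
theorem functional_eq_zero_of_etL (ξ : A →ₗ[ℂ] ℂ) (h : ∀ a b, ξ (C.etL a b) = 0) : ξ = 0 := by
  have h1 : ∀ z, sliceRight ξ (C.E₁ z) = 0 := by
    intro z
    induction z with
    | zero => simp
    | add x y hx hy => simp only [map_add, hx, hy, add_zero]
    | tmul b q =>
      refine C.separating_mul_left _ fun i => ?_
      rw [← functional_sliceLeft, sliceLeft_E₁, h]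
  refine functional_eq_zero_of_span C.mul_span fun v hv => ?_
  obtain ⟨a, b, rfl⟩ := hv
  rw [← TensorProduct.lift.tmul (f' := C.mul), ← C.counit_left, functional_sliceLeft, ← C.E₁_T₁,
    Module.End.mul_apply, h1, map_zero]

theorem functional_eq_zero_of_esR (ξ : A →ₗ[ℂ] ℂ) (h : ∀ b a, ξ (C.esR b a) = 0) : ξ = 0 := by
  have h1 : ξ ∘ₗ C.S.symm.toLinearMap = 0 := by
    refine C.functional_eq_zero_of_etL _ fun a b => ?_
    obtain ⟨a, rfl⟩ := C.S.surjective a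
    obtain ⟨b, rfl⟩ := C.S.surjective b
    simp [etL_S, h]
  ext x
  simpa using LinearMap.congr_fun h1 (C.S x)

/-- Left invariance: for every `a`, the element `(ι ⊗ φ)Δ(a)` multiplies the target algebra
into itself. -/
def LeftInvariant (φ : A →ₗ[ℂ] ℂ) : Prop :=
  ∀ a s, ∃ s', ∀ d, sliceRight φ (C.T₂ (C.etR d s ⊗ₜ a)) = C.etR d s'

/-- `d ↦ d (ι ⊗ φ)Δ(a)` -/
def rightSlice (φ : A →ₗ[ℂ] ℂ) (a : A) : A →ₗ[ℂ] A :=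
  sliceRight φ ∘ₗ C.T₂ ∘ₗ (TensorProduct.mk ℂ A A).flip a

theorem rightSlice_apply (φ : A →ₗ[ℂ] ℂ) (a d : A) :
    C.rightSlice φ a d = sliceRight φ (C.T₂ (d ⊗ₜ a)) := rfl

theorem slice3_leg23_T₂ (φ : A →ₗ[ℂ] ℂ) (z : A ⊗[ℂ] A) (a : A) :
    slice3 φ (leg23 C.T₂ (z ⊗ₜ a)) = LinearMap.lTensor A (C.rightSlice φ a) z := by
  induction z with
  | zero => simp
  | add x y hx hy => simp only [TensorProduct.add_tmul, map_add, hx, hy]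
  | tmul x y => simp [rightSlice_apply]

theorem slice3_leg13_T₂ (φ : A →ₗ[ℂ] ℂ) (z : A ⊗[ℂ] A) (a : A) :
    slice3 φ (leg13 C.T₂ (z ⊗ₜ a)) = LinearMap.rTensor A (C.rightSlice φ a) z := by
  induction z with
  | zero => simp
  | add x y hx hy => simp only [TensorProduct.add_tmul, map_add, hx, hy]
  | tmul x y => simp [rightSlice_apply]

section Integral
variable {C} {φ : A →ₗ[ℂ] ℂ}

/-- With x = (ι⊗φ)Δ(a) this is Δ(bx) = Δ(b)(x⊗1). The rule holds for target elements, A is spanned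
by the uε_t(s), and ε_t(s)x is again a target element. -/
theorem LeftInvariant.T₂_lTensor (hφ : C.LeftInvariant φ) (a : A) (z : A ⊗[ℂ] A) :
    C.T₂ (LinearMap.lTensor A (C.rightSlice φ a) z) =
      LinearMap.rTensor A (C.rightSlice φ a) (C.T₂ z) := by
  induction z with
  | zero => simp
  | add x y hx hy => simp only [map_add, hx, hy]
  | tmul d u =>
    have hu : u ∈ Submodule.span ℂ {x | ∃ b a, x = C.etR b a} := by rw [C.span_etR]; trivial
    induction hu using Submodule.span_induction with
    | zero => simp
    | add x y _ _ hx hy => simp only [map_add, TensorProduct.tmul_add, hx, hy]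
    | smul r x _ hx => simp only [map_smul, TensorProduct.tmul_smul, hx]
    | mem x hx =>
      obtain ⟨u, s, rfl⟩ := hx
      obtain ⟨s', hs'⟩ := hφ a s
      have h1 := C.T₂_lTensor_etR s (d ⊗ₜ u)
      have h2 := C.T₂_lTensor_etR s' (d ⊗ₜ u)
      have h3 : C.etR.flip s' = C.rightSlice φ a ∘ₗ C.etR.flip s := by
        ext x; exact (hs' x).symm
      simp only [LinearMap.lTensor_tmul, LinearMap.flip_apply] at h1 h2
      rw [LinearMap.lTensor_tmul, rightSlice_apply, hs', h1, h2, h3, LinearMap.rTensor_comp_apply]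

/-- Slice `leg23_T₂_leg13_T₂` by φ in the third leg. With x = (ι⊗φ)Δ(c), invariance moves x across
T₂ and leaves T₂R₂ = E₂, and `G₂_spec` gives the same slice for G₂. -/
theorem LeftInvariant.sliceRight_T₂ (hφ : C.LeftInvariant φ) (z : A ⊗[ℂ] A) :
    sliceRight φ (C.T₂ z) = sliceRight φ (C.G₂ z) := by
  have h1 : ∀ z c, slice3 φ (leg23 C.T₂ (leg13 C.T₂ (z ⊗ₜ c))) =
      slice3 φ (leg23 C.G₂ (leg13 C.T₂ (z ⊗ₜ c))) := by
    intro z c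
    rw [← Module.End.mul_apply, ← Module.End.mul_apply (leg23 C.G₂), C.leg23_T₂_leg13_T₂, C.G₂_spec,
      Module.End.mul_apply, Module.End.mul_apply, Module.End.mul_apply, slice3_leg12, leg12_tmul,
      leg12_tmul, slice3_leg23_T₂, slice3_leg13_T₂, hφ.T₂_lTensor, ← Module.End.mul_apply C.T₂,
      C.T₂_R₂]
  have h2 : ∀ (X : Module.End ℂ (A ⊗[ℂ] A)) (a b c : A) (ρ : A →ₗ[ℂ] ℂ),
      sliceLeft ρ (slice3 φ (leg23 X (leg13 C.T₂ ((a ⊗ₜ b) ⊗ₜ c)))) =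
        sliceRight φ (X (b ⊗ₜ C.lam a ρ c)) := by
    intro X a b c ρ
    have h3 : ∀ v, sliceLeft ρ (slice3 φ v) = sliceRight φ (slice1 ρ v) := by
      intro v
      induction v with
      | zero => simp
      | add x y hx hy => simp only [map_add, hx, hy]
      | tmul x y => simp
    rw [h3, slice1_leg23, leg13_tmul, slice1_rightComm]
    rfl
  induction z with
  | zero => simp
  | add x y hx hy => simp only [map_add, hx, hy]
  | tmul b x =>
    induction x using C.lam_induction with
    | h0 => simp
    | hadd x y hx hy => simp only [map_add, TensorProduct.tmul_add, hx, hy]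
    | hlam a ρ c => rw [← h2, ← h2, h1]

/-- Strong invariance. -/
theorem LeftInvariant.mul_S_tau (hφ : C.LeftInvariant φ) (d a b : A) :
    C.mul d (C.S (C.tau b φ a)) = sliceRight (φ ∘ₗ C.mul a) (C.T₂ (d ⊗ₜ b)) := by
  -- (d⊗a)Δ(b) is T₂ applied to R₂(d⊗a)(1⊗b). Under φ this T₂ may be replaced by G₂, and G₂R₂ = R₂
  -- leaves Σ dS(a₁)⊗a₂b.
  rw [← sliceRight_lTensor, ← T₂_lTensor_R₂, hφ.sliceRight_T₂, G₂_lTensor_flip,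
    ← Module.End.mul_apply C.G₂, G₂_R₂, R₂_lTensor, sliceRight_rTensor]
  rfl

/-- Strong invariance transported by S, which reverses both product and coproduct: Σ ψ(bc₁)S(c₂)d =
Σ ψ(b₁c)b₂d for ψ = φ∘S. -/
theorem LeftInvariant.S_lam_mul (hφ : C.LeftInvariant φ) (b c d : A) :
    C.mul (C.S (C.lam b (φ ∘ₗ C.S.toLinearMap) c)) d =
      sliceLeft ((φ ∘ₗ C.S.toLinearMap) ∘ₗ C.mul.flip c) (C.T₁ (b ⊗ₜ d)) := by
  apply C.S.injective
  have h := hφ.mul_S_tau (C.S d) (C.S c) (C.S b)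
  have h1 : C.tau (C.S b) φ (C.S c) = C.S (C.lam b (φ ∘ₗ C.S.toLinearMap) c) := by
    rw [CanonicalMaps.tau_apply, T₁_S, CanonicalMaps.lam_apply]
    generalize C.T₂ (b ⊗ₜ c) = y
    induction y with
    | zero => simp
    | add x y hx hy => simp only [map_add, hx, hy]
    | tmul x y => simp
  rw [h1, ← S_mul_mul] at h
  rw [h, T₂_S]
  generalize C.T₁ (b ⊗ₜ d) = y
  induction y with
  | zero => simp
  | add x y hx hy => simp only [map_add, hx, hy]
  | tmul x y => simp [← S_mul_mul]

end Integral

theorem sliceRight_comp_mul_flip (φ : A →ₗ[ℂ] ℂ) (c a b : A) :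
    sliceRight (φ ∘ₗ C.mul.flip b) (C.T₂ (c ⊗ₜ a)) = C.mul c (C.tau b φ a) := by
  rw [← sliceRight_lTensor, ← C.compat, sliceRight_rTensor, CanonicalMaps.tau_apply]

theorem lam_mul (φ : A →ₗ[ℂ] ℂ) (b c y : A) :
    C.mul (C.lam b φ c) y = sliceLeft (φ ∘ₗ C.mul b) (C.T₁ (c ⊗ₜ y)) := by
  rw [← sliceLeft_rTensor, C.compat, sliceLeft_lTensor, CanonicalMaps.lam_apply]
  rfl

theorem R₁_lTensor_S (e a c : A) : LinearMap.lTensor A (C.mul (C.S e)) (C.R₁ (a ⊗ₜ c)) =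
    LinearMap.lTensor A (C.mul.flip c ∘ₗ C.S.toLinearMap) (C.T₁ (a ⊗ₜ e)) := by
  have h := C.op.R₂_rTensor_S c a e
  rw [op_R₂, op_T₂, TensorProduct.comm_tmul, TensorProduct.comm_tmul, ← comm_lTensor,
    ← comm_lTensor] at h
  exact (TensorProduct.comm ℂ A A).injective h

/-- The functional `b ↦ φ(b p)`. -/
def mulRight (φ : A →ₗ[ℂ] ℂ) : A →ₗ[ℂ] A →ₗ[ℂ] ℂ := C.mul.flip.compr₂ φ

/-- The functional `b ↦ φ(p b)`. -/
def mulLeft (φ : A →ₗ[ℂ] ℂ) : A →ₗ[ℂ] A →ₗ[ℂ] ℂ := C.mul.compr₂ φ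

theorem mulRight_apply (φ : A →ₗ[ℂ] ℂ) (p b : A) : C.mulRight φ p b = φ (C.mul b p) := rfl

theorem mulLeft_apply (φ : A →ₗ[ℂ] ℂ) (p b : A) : C.mulLeft φ p b = φ (C.mul p b) := rfl

theorem range_le_of_span {V W : Type*} [AddCommGroup V] [Module ℂ V] [AddCommGroup W] [Module ℂ W]
    {f g : V →ₗ[ℂ] W} {ι : Type*} (D e : ι → V)
    (hD : ∀ ξ : V →ₗ[ℂ] ℂ, (∀ i, ξ (D i) = 0) → ξ = 0) (h : ∀ i, f (D i) = g (e i)) :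
    LinearMap.range f ≤ LinearMap.range g := by
  have hs : Submodule.span ℂ (Set.range D) = ⊤ :=
    span_eq_top_of_functional fun ξ hξ => hD ξ fun i => hξ _ ⟨i, rfl⟩
  rw [LinearMap.range_eq_map, ← hs, Submodule.map_span, Submodule.span_le]
  rintro _ ⟨_, ⟨i, rfl⟩, rfl⟩
  exact ⟨e i, (h i).symm⟩

end HopfMaps

/-! ### Comparison of two left integrals. -/

namespace HopfMaps
variable {A : Type*} [AddCommGroup A] [Module ℂ A] (C : HopfMaps A)

section Faithful
variable {C} {φ φ₁ : A →ₗ[ℂ] ℂ}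

theorem S_symm_mul (a b : A) : C.S.symm (C.mul a b) = C.mul (C.S.symm b) (C.S.symm a) := by
  apply C.S.injective
  rw [S_mul_mul]; simp

/-- With ψ = φ∘S and e = S⁻¹(d)c, strong invariance of φ₁ and then of ψ gives Σ ψ(S⁻¹(da₁)c)φ₁(ba₂)
= Σ ψ(b₁e)φ₁(b₂a) = Σ ψ(be₁)φ₁(S(e₂)a). -/
theorem mulRight_S_symm (hφ : C.LeftInvariant φ) (hφ₁ : C.LeftInvariant φ₁) (d c a : A) :
    C.mulRight φ₁ (sliceLeft (((φ ∘ₗ C.S.toLinearMap) ∘ₗ C.mul.flip c) ∘ₗ C.S.symm.toLinearMap)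
      (C.T₂ (d ⊗ₜ a))) =
    C.mulRight (φ ∘ₗ C.S.toLinearMap)
      (sliceRight φ₁ (C.R₁ (C.mul (C.S.symm d) c ⊗ₜ a))) := by
  ext b
  rw [mulRight_apply, mulRight_apply, ← LinearMap.comp_apply φ₁, functional_sliceLeft,
    ← hφ₁.mul_S_tau]
  have h1 : (((φ ∘ₗ C.S.toLinearMap) ∘ₗ C.mul.flip c) ∘ₗ C.S.symm.toLinearMap)
      (C.mul d (C.S (C.tau a φ₁ b))) =
      ((φ ∘ₗ C.S.toLinearMap) ∘ₗ C.mul.flip (C.mul (C.S.symm d) c)) (C.tau a φ₁ b) := by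
    simp only [LinearMap.comp_apply, LinearEquiv.coe_coe, LinearMap.flip_apply, S_symm_mul,
      LinearEquiv.symm_apply_apply, C.assoc]
  have h2 := C.R₁_lam b (φ ∘ₗ C.S.toLinearMap) (C.mul (C.S.symm d) c ⊗ₜ a)
  rw [LinearMap.rTensor_tmul] at h2
  rw [h1, CanonicalMaps.tau_apply, ← functional_sliceLeft, ← hφ.S_lam_mul, ← C.S_mul, h2,
    ← sliceLeft_mul, functional_sliceLeft]
  rfl

theorem LeftInvariant.S_tau (hφ : C.LeftInvariant φ) (a b : A) : C.S (C.tau b φ a) =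
    sliceRight (φ ∘ₗ C.S.symm.toLinearMap) (C.R₁ (b ⊗ₜ C.S a)) := by
  refine C.ext_of_mul_left fun d => ?_
  rw [hφ.mul_S_tau, ← sliceRight_rTensor, R₁_rTensor, sliceRight_lTensor]
  congr 2
  ext q
  simp [S_symm_mul]

theorem LeftInvariant.sliceLeft_R₁ (hφ : C.LeftInvariant φ) (b c x : A) :
    sliceLeft ((φ ∘ₗ C.S.toLinearMap) ∘ₗ C.mul.flip c) (C.R₁ (b ⊗ₜ x)) =
      C.mul (C.S (C.S (C.lam b (φ ∘ₗ C.S.toLinearMap) c))) x := by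
  refine C.ext_of_mul_left fun e => ?_
  obtain ⟨e, rfl⟩ := C.S.surjective e
  rw [← sliceLeft_lTensor, R₁_lTensor_S, sliceLeft_lTensor, ← hφ.S_lam_mul, ← C.assoc,
    ← S_mul_mul]
  rfl

/-- With ψ = φ∘S and e = S(d)c, the computation is Σ ψ(S(da₁)c)φ₁(a₂b) = Σ ψ(b₁e)φ₁(ab₂) = Σ
ψ(be₁)φ₁(aS(e₂)). -/
theorem mulLeft_S (hφ : C.LeftInvariant φ) (hφ₁ : C.LeftInvariant φ₁) (d c a : A) :
    C.mulLeft φ₁ (sliceLeft (((φ ∘ₗ C.S.toLinearMap) ∘ₗ C.mul.flip c) ∘ₗ C.S.toLinearMap)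
      (C.T₂ (d ⊗ₜ a))) =
    C.mulRight (φ ∘ₗ C.S.toLinearMap)
      (sliceRight (φ₁ ∘ₗ C.S.toLinearMap) (C.T₁ (C.mul (C.S d) c ⊗ₜ C.S.symm a))) := by
  ext b
  have h0 : ∀ D, C.mulLeft φ₁ D b = (φ₁ ∘ₗ C.mul.flip b) D := fun D => rfl
  have h1 : (((φ ∘ₗ C.S.toLinearMap) ∘ₗ C.mul.flip c) ∘ₗ C.S.toLinearMap)
      (C.mul d (C.tau b φ₁ a)) =
      ((φ ∘ₗ C.S.toLinearMap) ∘ₗ C.mul.flip (C.mul (C.S d) c)) (C.S (C.tau b φ₁ a)) := by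
    simp only [LinearMap.comp_apply, LinearEquiv.coe_coe, LinearMap.flip_apply, S_mul_mul, C.assoc]
  have h2 : ∀ w : A, (φ₁ ∘ₗ C.S.symm.toLinearMap) (C.mul (C.S (C.S w)) (C.S a)) =
      (φ₁ ∘ₗ C.S.toLinearMap) (C.mul w (C.S.symm a)) := by
    intro w
    simp [S_symm_mul, S_mul_mul]
  rw [h0, functional_sliceLeft, sliceRight_comp_mul_flip, h1, hφ₁.S_tau, ← functional_sliceLeft,
    hφ.sliceLeft_R₁, h2, lam_mul, functional_sliceLeft]
  rfl

theorem eq_zero_of_sliceRight_T₂ (ξ : A →ₗ[ℂ] ℂ) (h : ∀ d a, sliceRight ξ (C.T₂ (d ⊗ₜ a)) = 0) :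
    ξ = 0 := by
  refine functional_eq_zero_of_span C.full_right fun v hv => ?_
  obtain ⟨ω, a, b, rfl⟩ := hv
  rw [functional_sliceLeft, h, map_zero]

theorem eq_zero_of_sliceLeft_T₁ (ξ : A →ₗ[ℂ] ℂ) (h : ∀ d a, sliceLeft ξ (C.T₁ (d ⊗ₜ a)) = 0) :
    ξ = 0 := by
  refine functional_eq_zero_of_span C.full_left fun v hv => ?_
  obtain ⟨ω, a, b, rfl⟩ := hv
  rw [← functional_sliceLeft, h, map_zero]

theorem eq_zero_of_S_mul (hf : ∀ a, (∀ b, φ (C.mul b a) = 0) → a = 0) (a : A)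
    (h : ∀ c, φ (C.S (C.mul a c)) = 0) : a = 0 := by
  have : C.S a = 0 := hf _ fun b => by
    obtain ⟨b, rfl⟩ := C.S.surjective b
    rw [← S_mul_mul, h]
  simpa using this

/-- The elements on the left of both comparison formulas span A: the functionals φ(S(· c)) separate
points, and Δ is full. Here σ is S⁻¹ for `mulRight_S_symm` and S for `mulLeft_S`. -/
theorem eq_zero_of_sliceLeft_T₂ (hf : ∀ a, (∀ b, φ (C.mul b a) = 0) → a = 0) (σ : A ≃ₗ[ℂ] A)
    (ξ : A →ₗ[ℂ] ℂ) (h : ∀ i : A × A × A,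
      ξ (sliceLeft (((φ ∘ₗ C.S.toLinearMap) ∘ₗ C.mul.flip i.2.1) ∘ₗ σ.toLinearMap)
        (C.T₂ (i.1 ⊗ₜ i.2.2))) = 0) : ξ = 0 := by
  refine C.eq_zero_of_sliceRight_T₂ ξ fun d a => ?_
  have : σ (sliceRight ξ (C.T₂ (d ⊗ₜ a))) = 0 := eq_zero_of_S_mul hf _ fun c => by
    have := h (d, c, a)
    rwa [functional_sliceLeft] at this
  simpa using this

theorem functional_eq_zero_of_mul_surjective (σ : A ≃ₗ[ℂ] A) (f : A →ₗ[ℂ] ℂ)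
    (h : ∀ d c, f (C.mul (σ d) c) = 0) : f = 0 := by
  refine functional_eq_zero_of_span C.mul_span fun v hv => ?_
  obtain ⟨a, b, rfl⟩ := hv
  simpa using h (σ.symm a) b

/-- The second leg of R₁ is stable under right multiplication, so faithfulness gives (ξ⊗ι)R₁ = 0 and
hence (ξ⊗ι)G₁ = 0. By `sliceRight_G₁`, ξ then vanishes on all sε_s(b), which span A. -/
theorem eq_zero_of_sliceRight_R₁ (hf : ∀ a, (∀ b, φ (C.mul a b) = 0) → a = 0)
    (ξ : A →ₗ[ℂ] ℂ) (h : ∀ i : A × A × A,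
      ξ (sliceRight φ (C.R₁ (C.mul (C.S.symm i.1) i.2.1 ⊗ₜ i.2.2))) = 0) : ξ = 0 := by
  have h1 : ∀ c a, φ (sliceLeft ξ (C.R₁ (c ⊗ₜ a))) = 0 := by
    intro c a
    refine LinearMap.congr_fun (f := φ ∘ₗ sliceLeft ξ ∘ₗ C.R₁ ∘ₗ (TensorProduct.mk ℂ A A).flip a)
      (C.functional_eq_zero_of_mul_surjective C.S.symm _ fun d c' => ?_) c
    have := h (d, c', a)
    rwa [← functional_sliceLeft] at this
  have hR : ∀ c a x, C.R₁ (c ⊗ₜ C.mul a x) = LinearMap.lTensor A (C.mul.flip x) (C.R₁ (c ⊗ₜ a)) := by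
    intro c a x
    refine C.ext_of_rTensor_mul fun d => ?_
    rw [R₁_rTensor, ← lTensor_rTensor_comm, R₁_rTensor, ← LinearMap.lTensor_comp_apply]
    congr 2
    ext y
    simp [C.assoc]
  have h2 : ∀ z, sliceLeft ξ (C.R₁ z) = 0 := by
    intro z
    induction z with
    | zero => simp
    | add x y hx hy => simp only [map_add, hx, hy, add_zero]
    | tmul c a =>
      refine hf _ fun x => ?_
      have := h1 c (C.mul a x)
      rwa [hR, sliceLeft_lTensor] at this
  refine C.functional_eq_zero_of_esR ξ fun s b => ?_
  obtain ⟨b, rfl⟩ := C.S.symm.surjective b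
  induction b using C.lam_induction with
  | h0 => simp
  | hadd x y hx hy => rw [map_add, map_add, map_add, hx, hy, add_zero]
  | hlam c ρ b =>
    rw [← sliceRight_G₁, ← functional_sliceLeft, ← C.R₁_T₁, Module.End.mul_apply, h2, map_zero]

theorem eq_zero_of_sliceRight_T₁ (hf : ∀ a, (∀ b, φ (C.mul b a) = 0) → a = 0)
    (ξ : A →ₗ[ℂ] ℂ) (h : ∀ i : A × A × A, ξ (sliceRight (φ ∘ₗ C.S.toLinearMap)
      (C.T₁ (C.mul (C.S i.1) i.2.1 ⊗ₜ C.S.symm i.2.2))) = 0) : ξ = 0 := by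
  have h1 : ∀ c a, φ (C.S (sliceLeft ξ (C.T₁ (c ⊗ₜ a)))) = 0 := by
    intro c a
    refine LinearMap.congr_fun
      (f := (φ ∘ₗ C.S.toLinearMap) ∘ₗ sliceLeft ξ ∘ₗ C.T₁ ∘ₗ (TensorProduct.mk ℂ A A).flip a)
      (C.functional_eq_zero_of_mul_surjective C.S _ fun d c' => ?_) c
    have := h (d, c', C.S a)
    rw [← functional_sliceLeft] at this
    simpa using this
  refine C.eq_zero_of_sliceLeft_T₁ ξ fun c a => eq_zero_of_S_mul hf _ fun x => ?_
  have h2 := C.T₁_lTensor x (c ⊗ₜ a)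
  have h3 := h1 c (C.mul a x)
  rw [LinearMap.lTensor_tmul, LinearMap.flip_apply] at h2
  rwa [h2, sliceLeft_lTensor] at h3

theorem range_mulRight_le (hf : ∀ a, (∀ b, φ (C.mul b a) = 0) → a = 0)
    (hφ : C.LeftInvariant φ) (hφ₁ : C.LeftInvariant φ₁) :
    LinearMap.range (C.mulRight φ₁) ≤ LinearMap.range (C.mulRight (φ ∘ₗ C.S.toLinearMap)) :=
  range_le_of_span _ _ (C.eq_zero_of_sliceLeft_T₂ hf C.S.symm)
    fun i => mulRight_S_symm hφ hφ₁ i.1 i.2.1 i.2.2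

theorem range_mulLeft_le (hf : ∀ a, (∀ b, φ (C.mul b a) = 0) → a = 0)
    (hφ : C.LeftInvariant φ) (hφ₁ : C.LeftInvariant φ₁) :
    LinearMap.range (C.mulLeft φ₁) ≤ LinearMap.range (C.mulRight (φ ∘ₗ C.S.toLinearMap)) :=
  range_le_of_span _ _ (C.eq_zero_of_sliceLeft_T₂ hf C.S)
    fun i => mulLeft_S hφ hφ₁ i.1 i.2.1 i.2.2

theorem range_mulRight_S_le_mulRight (hf : ∀ a, (∀ b, φ (C.mul a b) = 0) → a = 0)
    (hφ : C.LeftInvariant φ) :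
    LinearMap.range (C.mulRight (φ ∘ₗ C.S.toLinearMap)) ≤ LinearMap.range (C.mulRight φ) :=
  range_le_of_span _ _ (C.eq_zero_of_sliceRight_R₁ hf)
    fun i => (mulRight_S_symm hφ hφ i.1 i.2.1 i.2.2).symm

theorem range_mulRight_S_le_mulLeft (hf : ∀ a, (∀ b, φ (C.mul b a) = 0) → a = 0)
    (hφ : C.LeftInvariant φ) :
    LinearMap.range (C.mulRight (φ ∘ₗ C.S.toLinearMap)) ≤ LinearMap.range (C.mulLeft φ) :=
  range_le_of_span _ _ (C.eq_zero_of_sliceRight_T₁ hf)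
    fun i => (mulLeft_S hφ hφ i.1 i.2.1 i.2.2).symm

/-- A left integral is `φ(· y)` for a multiplier `y` with left action `L` and right action `θ`. -/
theorem exists_multiplier (hf : ∀ a, (∀ b, φ (C.mul a b) = 0) → a = 0)
    (hf' : ∀ a, (∀ b, φ (C.mul b a) = 0) → a = 0)
    (hφ : C.LeftInvariant φ) (hφ₁ : C.LeftInvariant φ₁) :
    ∃ L θ : A →ₗ[ℂ] A, (∀ p q, C.mul (θ p) q = C.mul p (L q)) ∧ ∀ x, φ₁ x = φ (θ x) := by
  have hinj : Function.Injective (C.mulRight φ) := by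
    rw [injective_iff_map_eq_zero]
    exact fun a ha => hf' a fun b => LinearMap.congr_fun ha b
  -- The element t is to be py.
  have h1 : ∀ p, ∃ t, C.mulRight φ t = C.mulRight φ₁ p := fun p =>
    range_mulRight_S_le_mulRight hf hφ (range_mulRight_le hf' hφ hφ₁ ⟨p, rfl⟩)
  choose θ hθ using h1
  -- The element l is to be yq. With φ(· q) = φ(q' ·) and φ₁(q' ·) = φ(· l) one has φ(xθ(p)q) =
  -- φ(q'xθ(p)) = φ₁(q'xp) = φ(xpl).
  have h2 : ∀ q, ∃ l, ∀ p, C.mul (θ p) q = C.mul p l := by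
    intro q
    obtain ⟨q', hq'⟩ := range_mulRight_S_le_mulLeft hf' hφ (range_mulRight_le hf' hφ hφ ⟨q, rfl⟩)
    obtain ⟨l, hl⟩ := range_mulRight_S_le_mulRight hf hφ (range_mulLeft_le hf' hφ hφ₁ ⟨q', rfl⟩)
    refine ⟨l, fun p => hinj (LinearMap.ext fun x => ?_)⟩
    have e1 := LinearMap.congr_fun hq' (C.mul x (θ p))
    have e2 := LinearMap.congr_fun (hθ p) (C.mul q' x)
    have e3 := LinearMap.congr_fun hl (C.mul x p)
    simp only [mulRight_apply, mulLeft_apply, C.assoc] at e1 e2 e3 ⊢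
    rw [← e1, e2, ← e3]
  choose L hL using h2
  refine ⟨{ toFun := L, map_add' := fun a b => C.ext_of_mul_left fun c => ?_,
            map_smul' := fun r a => C.ext_of_mul_left fun c => ?_ },
    { toFun := θ, map_add' := fun a b => hinj ?_, map_smul' := fun r a => hinj ?_ },
    fun p q => hL q p, fun x => ?_⟩
  · rw [map_add, ← hL, ← hL, ← hL, map_add]
  · rw [RingHom.id_apply, map_smul, ← hL, ← hL, map_smul]
  · rw [map_add, hθ, hθ, hθ, map_add]
  · rw [RingHom.id_apply, map_smul, hθ, hθ, map_smul]
  · have hθ' : ∀ a b, θ (C.mul a b) = C.mul a (θ b) := fun a b =>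
      C.ext_of_mul_right fun c => by rw [hL, C.assoc, C.assoc, hL]
    have hx : x ∈ Submodule.span ℂ {x | ∃ a b, x = C.mul a b} := by rw [C.mul_span]; trivial
    induction hx using Submodule.closure_induction with
    | zero => simp only [map_zero]
    | add a b _ _ ha hb => rw [map_add, map_add, map_add, ha, hb]
    | smul_mem r x hx =>
      obtain ⟨a, b, rfl⟩ := hx
      have e := LinearMap.congr_fun (hθ b) a
      simp only [mulRight_apply] at e
      simp only [LinearMap.coe_mk, AddHom.coe_mk, map_smul, hθ', e]

end Faithful
end HopfMaps

/-! ### The multiplier y preserves the source algebra. -/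

namespace HopfMaps
variable {A : Type*} [AddCommGroup A] [Module ℂ A] {C : HopfMaps A}
variable {φ φ₁ : A →ₗ[ℂ] ℂ} {L θ : A →ₗ[ℂ] A}

theorem right_mul_left (hLθ : ∀ p q, C.mul (θ p) q = C.mul p (L q)) (a b : A) :
    θ (C.mul a b) = C.mul a (θ b) :=
  C.ext_of_mul_right fun c => by rw [hLθ, C.assoc, C.assoc, hLθ]

theorem left_mul_right (hLθ : ∀ p q, C.mul (θ p) q = C.mul p (L q)) (a b : A) :
    L (C.mul a b) = C.mul (L a) b :=
  C.ext_of_mul_left fun c => by rw [← hLθ, ← C.assoc, ← C.assoc, hLθ]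

theorem lTensor_mul_flip_right (hLθ : ∀ p q, C.mul (θ p) q = C.mul p (L q)) (q : A)
    (z : A ⊗[ℂ] A) : LinearMap.lTensor A (C.mul.flip q) (LinearMap.lTensor A θ z) =
      LinearMap.lTensor A (C.mul.flip (L q)) z := by
  rw [← LinearMap.lTensor_comp_apply]
  congr 2
  ext p
  simp [hLθ]

theorem T₁_tmul_right (hLθ : ∀ p q, C.mul (θ p) q = C.mul p (L q)) (a b : A) :
    C.T₁ (a ⊗ₜ θ b) = LinearMap.lTensor A θ (C.T₁ (a ⊗ₜ b)) := by
  refine C.ext_of_lTensor_mul_flip fun q => ?_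
  rw [lTensor_mul_flip_right hLθ, ← C.T₁_lTensor, ← C.T₁_lTensor]
  simp [hLθ]

/-- `Δ(b y) = Δ(b)(1 ⊗ y)` -/
theorem T₂_tmul_right (hLθ : ∀ p q, C.mul (θ p) q = C.mul p (L q)) (hy : ∀ x, φ₁ x = φ (θ x))
    (hf : ∀ a, (∀ b, φ (C.mul b a) = 0) → a = 0)
    (hφ : C.LeftInvariant φ) (hφ₁ : C.LeftInvariant φ₁) (d b : A) :
    C.T₂ (d ⊗ₜ θ b) = LinearMap.lTensor A θ (C.T₂ (d ⊗ₜ b)) := by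
  have hφ₁' : φ₁ = φ ∘ₗ θ := LinearMap.ext hy
  refine sliceRight_ext (fun a => φ ∘ₗ C.mul a) hf fun a => ?_
  -- Since φ₁ = φ(· y), the slices (ι⊗φ₁)(Δ(a)(1⊗b)) and (ι⊗φ)(Δ(a)(1⊗by)) agree. Strong invariance
  -- of φ₁ and of φ turns this into equality of the two sides under φ(a ·) on the second leg.
  have h1 : C.tau b φ₁ a = C.tau (θ b) φ a := by
    rw [CanonicalMaps.tau_apply, CanonicalMaps.tau_apply, T₁_tmul_right hLθ, hφ₁',
      sliceRight_lTensor]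
  rw [sliceRight_lTensor, ← hφ.mul_S_tau, ← h1, hφ₁.mul_S_tau, hφ₁']
  congr 2
  ext x
  simp [right_mul_left hLθ]

/-- In Δ(ay) = Δ(a)(1⊗y) the factor y sits on the second leg, so it comes out of Σ S(a₁)a₂ on the
right. -/
theorem esL_right (hLθ : ∀ p q, C.mul (θ p) q = C.mul p (L q))
    (hΔ : ∀ d b, C.T₂ (d ⊗ₜ θ b) = LinearMap.lTensor A θ (C.T₂ (d ⊗ₜ b))) (a b : A) :
    C.esL (θ a) b = C.esL a (L b) := by
  have : C.T₁ (θ a ⊗ₜ b) = C.T₁ (a ⊗ₜ L b) := by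
    refine C.ext_of_rTensor_mul fun c => ?_
    rw [C.compat, C.compat, hΔ, lTensor_mul_flip_right hLθ]
  rw [esL_eq, esL_eq, this]

/-- Under Δ, right multiplication by a target element acts on the first leg and right multiplication
by y on the second, so the two commute; the counit recovers the products. -/
theorem right_etR (hΔ : ∀ d b, C.T₂ (d ⊗ₜ θ b) = LinearMap.lTensor A θ (C.T₂ (d ⊗ₜ b)))
    (u s : A) : θ (C.etR u s) = C.etR (θ u) s := by
  refine C.ext_of_mul_left fun d => ?_
  have h1 := C.T₂_lTensor_etR s (d ⊗ₜ u)
  have h2 := C.T₂_lTensor_etR s (d ⊗ₜ θ u)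
  simp only [LinearMap.lTensor_tmul, LinearMap.flip_apply] at h1 h2
  rw [← TensorProduct.lift.tmul (f' := C.mul), ← TensorProduct.lift.tmul (f' := C.mul),
    ← C.counit_right, ← C.counit_right, hΔ, h1, h2, hΔ, lTensor_rTensor_comm]

theorem left_etL (hLθ : ∀ p q, C.mul (θ p) q = C.mul p (L q))
    (hΔ : ∀ d b, C.T₂ (d ⊗ₜ θ b) = LinearMap.lTensor A θ (C.T₂ (d ⊗ₜ b))) (a b : A) :
    L (C.etL a b) = C.etL a (L b) :=
  C.ext_of_mul_left fun p => by rw [← hLθ, mul_etL, mul_etL, ← right_etR hΔ, hLθ]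

/-- Slices of E in the first leg are target elements by `sliceLeft_E₁`, and y commutes with these.
-/
theorem E₁_lTensor_left (hLθ : ∀ p q, C.mul (θ p) q = C.mul p (L q))
    (hΔ : ∀ d b, C.T₂ (d ⊗ₜ θ b) = LinearMap.lTensor A θ (C.T₂ (d ⊗ₜ b))) (z : A ⊗[ℂ] A) :
    C.E₁ (LinearMap.lTensor A L z) = LinearMap.lTensor A L (C.E₁ z) := by
  induction z with
  | zero => simp
  | add x y hx hy => simp only [map_add, hx, hy]
  | tmul b q =>
    refine C.sliceLeft_ext_mul fun ρ c => ?_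
    rw [sliceLeft_lTensor, sliceLeft_E₁, LinearMap.lTensor_tmul, sliceLeft_E₁, left_etL hLθ hΔ]

theorem mul₂_lTensor_right (hLθ : ∀ p q, C.mul (θ p) q = C.mul p (L q)) (z w : A ⊗[ℂ] A) :
    C.mul₂ (LinearMap.lTensor A θ z) w = C.mul₂ z (LinearMap.lTensor A L w) := by
  induction z with
  | zero => simp
  | add x y hx hy => simp only [map_add, LinearMap.add_apply, hx, hy]
  | tmul x y =>
    induction w with
    | zero => simp
    | add x y hx hy => simp only [map_add, hx, hy]
    | tmul s t => simp [hLθ]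

/-- `Δ(y x) = (1 ⊗ y)Δ(x)` -/
theorem T₁_left_tmul (hLθ : ∀ p q, C.mul (θ p) q = C.mul p (L q))
    (hΔ : ∀ d b, C.T₂ (d ⊗ₜ θ b) = LinearMap.lTensor A θ (C.T₂ (d ⊗ₜ b))) (x e : A) :
    C.T₁ (L x ⊗ₜ e) = LinearMap.lTensor A L (C.T₁ (x ⊗ₜ e)) := by
  have hE : ∀ z, C.E₁ (C.T₁ z) = C.T₁ z := LinearMap.congr_fun C.E₁_T₁
  -- Against (d⊗1)Δ(b) the claim follows from Δ(by)Δ(x) = Δ(b)Δ(yx). Since E commutes with 1⊗y,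
  -- testing against the range of T₂ is enough.
  have key : ∀ w, C.mul₂ (C.T₂ w) (C.T₁ (L x ⊗ₜ e)) =
      C.mul₂ (C.T₂ w) (LinearMap.lTensor A L (C.T₁ (x ⊗ₜ e))) := by
    intro w
    induction w with
    | zero => simp
    | add x y hx hy => simp only [map_add, LinearMap.add_apply, hx, hy]
    | tmul d b =>
      rw [← mul₂_lTensor_right hLθ, ← hΔ, C.mul₂_T₂, C.mul₂_T₂, ← C.T₁_mul_tmul, ← C.T₁_mul_tmul,
        hLθ]
  refine C.ext_of_mul₂_left fun v => ?_
  rw [← hE (L x ⊗ₜ e), ← hE (x ⊗ₜ e), ← E₁_lTensor_left hLθ hΔ, ← C.E_compat, ← C.E_compat,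
    ← C.T₂_R₂, Module.End.mul_apply, key]

/-- `S⁻¹(y S(a))` -/
def leftConj (C : HopfMaps A) (L : A →ₗ[ℂ] A) : A →ₗ[ℂ] A :=
  C.S.symm.toLinearMap ∘ₗ L ∘ₗ C.S.toLinearMap

theorem S_leftConj (a : A) : C.S (C.leftConj L a) = L (C.S a) := by simp [leftConj]

theorem leftConj_mul (hLθ : ∀ p q, C.mul (θ p) q = C.mul p (L q)) (c x : A) :
    C.leftConj L (C.mul c x) = C.mul c (C.leftConj L x) := by
  apply C.S.injective
  rw [S_leftConj, S_mul_mul, S_mul_mul, S_leftConj, left_mul_right hLθ]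

/-- `leftConj` plays the role of right multiplication by S⁻¹(y). As S reverses coproducts, the
factor y on the second leg in Δ(yx) = (1⊗y)Δ(x) goes to the first. -/
theorem T₁_leftConj (hLθ : ∀ p q, C.mul (θ p) q = C.mul p (L q))
    (hΔ : ∀ d b, C.T₂ (d ⊗ₜ θ b) = LinearMap.lTensor A θ (C.T₂ (d ⊗ₜ b))) (a b : A) :
    C.T₁ (C.leftConj L a ⊗ₜ b) = LinearMap.rTensor A (C.leftConj L) (C.T₁ (a ⊗ₜ b)) := by
  have h2 : ∀ e, C.T₂ (e ⊗ₜ C.leftConj L a) =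
      LinearMap.rTensor A (C.leftConj L) (C.T₂ (e ⊗ₜ a)) := by
    intro e
    have h3 := T₁_left_tmul hLθ hΔ (C.S a) (C.S e)
    rw [← S_leftConj, T₁_S, T₁_S, ← comm_rTensor] at h3
    have h4 : ∀ z, LinearMap.rTensor A L (TensorProduct.map C.S.toLinearMap C.S.toLinearMap z) =
        TensorProduct.map C.S.toLinearMap C.S.toLinearMap
          (LinearMap.rTensor A (C.leftConj L) z) := by
      intro z
      induction z with
      | zero => simp
      | add x y hx hy => simp only [map_add, hx, hy]
      | tmul x y => simp [S_leftConj]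
    rw [h4] at h3
    have hinj : Function.Injective (TensorProduct.map C.S.toLinearMap C.S.toLinearMap) :=
      (TensorProduct.congr C.S C.S).injective
    exact hinj ((TensorProduct.comm ℂ A A).injective h3)
  refine C.ext_of_rTensor_mul fun c => ?_
  have h5 : C.mul c ∘ₗ C.leftConj L = C.leftConj L ∘ₗ C.mul c := by
    ext x; simp [leftConj_mul hLθ]
  rw [C.compat, h2, ← LinearMap.rTensor_comp_apply, h5, LinearMap.rTensor_comp_apply, C.compat,
    lTensor_rTensor_comm]

/-- With m(a) = S⁻¹(yS(a)) one has Σ yS(a₁)a₂ = Σ S(m(a₁))a₂, and m acts on the first leg of Δ. -/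
theorem left_esL (hLθ : ∀ p q, C.mul (θ p) q = C.mul p (L q))
    (hΔ : ∀ d b, C.T₂ (d ⊗ₜ θ b) = LinearMap.lTensor A θ (C.T₂ (d ⊗ₜ b))) (a b : A) :
    L (C.esL a b) = C.esL (C.leftConj L a) b := by
  rw [esL_eq, esL_eq, T₁_leftConj hLθ hΔ]
  generalize C.T₁ (a ⊗ₜ b) = z
  induction z with
  | zero => simp
  | add x y hx hy => simp only [map_add, hx, hy]
  | tmul x y => simp [S_leftConj, left_mul_right hLθ]

end HopfMaps

/-! ### Non-degeneracy of tensor products and module properties of multipliers. -/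

section Nondegenerate

variable {A B : Type*}
  [NonUnitalRing A] [Module ℂ A] [IsScalarTower ℂ A A] [SMulCommClass ℂ A A]
  [NonUnitalRing B] [Module ℂ B] [IsScalarTower ℂ B B] [SMulCommClass ℂ B B]

theorem tensor_nondeg_left (hA : ∀ a : A, (∀ b, a * b = 0) → a = 0)
    (hB : ∀ a : B, (∀ b, a * b = 0) → a = 0) (z : A ⊗[ℂ] B)
    (h : ∀ a b, z * (a ⊗ₜ b) = 0) : z = 0 := by
  refine eq_zero_of_separating_left
    (fun i : A × (A →ₗ[ℂ] ℂ) => i.2 ∘ₗ LinearMap.mulRight ℂ i.1)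
    (fun a ha => hA a fun b => eq_zero_of_forall_functional _ fun ρ => ha (b, ρ)) z fun i => ?_
  refine hB _ fun d => ?_
  have key : ∀ z : A ⊗[ℂ] B, TensorProduct.lid ℂ B (LinearMap.rTensor B
      (i.2 ∘ₗ LinearMap.mulRight ℂ i.1) z) * d =
      TensorProduct.lid ℂ B (LinearMap.rTensor B i.2 (z * (i.1 ⊗ₜ d))) := by
    intro z
    induction z with
    | zero => simp
    | add x y hx hy => simp only [map_add, add_mul, hx, hy]
    | tmul x y => simp [smul_mul_assoc]
  rw [key, h]; simp

theorem tensor_nondeg_right (hA : ∀ a : A, (∀ b, b * a = 0) → a = 0)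
    (hB : ∀ a : B, (∀ b, b * a = 0) → a = 0) (z : A ⊗[ℂ] B)
    (h : ∀ a b, (a ⊗ₜ b) * z = 0) : z = 0 := by
  refine eq_zero_of_separating_left
    (fun i : A × (A →ₗ[ℂ] ℂ) => i.2 ∘ₗ LinearMap.mulLeft ℂ i.1)
    (fun a ha => hA a fun b => eq_zero_of_forall_functional _ fun ρ => ha (b, ρ)) z fun i => ?_
  refine hB _ fun d => ?_
  have key : ∀ z : A ⊗[ℂ] B, d * TensorProduct.lid ℂ B (LinearMap.rTensor B
      (i.2 ∘ₗ LinearMap.mulLeft ℂ i.1) z) =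
      TensorProduct.lid ℂ B (LinearMap.rTensor B i.2 ((i.1 ⊗ₜ d) * z)) := by
    intro z
    induction z with
    | zero => simp
    | add x y hx hy => simp only [map_add, mul_add, hx, hy]
    | tmul x y => simp [mul_smul_comm]
  rw [key, h]; simp

theorem Mult.left_mul_right (hB : ∀ a : B, (∀ b, b * a = 0) → a = 0) (m : Mult B) (x y : B) :
    m.left (x * y) = m.left x * y := by
  refine sub_eq_zero.1 (hB _ fun u => ?_)
  rw [mul_sub, ← mul_assoc, ← m.compat, ← m.compat, mul_assoc, sub_self]

theorem Mult.right_mul_left (hB : ∀ a : B, (∀ b, a * b = 0) → a = 0) (m : Mult B) (x y : B) :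
    m.right (x * y) = x * m.right y := by
  refine sub_eq_zero.1 (hB _ fun u => ?_)
  rw [sub_mul, mul_assoc, m.compat, m.compat, mul_assoc, sub_self]

theorem Mult.mul_left (m n : Mult B) (x : B) : (m * n).left x = m.left (n.left x) := rfl

theorem Mult.mul_right (m n : Mult B) (x : B) : (m * n).right x = n.right (m.right x) := rfl

theorem map₂_mul (z w : A ⊗[ℂ] A) :
    TensorProduct.map₂ (LinearMap.mul ℂ A) (LinearMap.mul ℂ A) z w = z * w := by
  induction z with
  | zero => simp
  | add x y hx hy => simp only [map_add, LinearMap.add_apply, add_mul, hx, hy]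
  | tmul x y =>
    induction w with
    | zero => simp
    | add x y hx hy => simp only [map_add, mul_add, hx, hy]
    | tmul s t => simp

theorem lTensor_mulRight_mul (b : A) (z w : A ⊗[ℂ] A) :
    LinearMap.lTensor A (LinearMap.mulRight ℂ b) z * w =
      z * LinearMap.lTensor A (LinearMap.mulLeft ℂ b) w := by
  induction z with
  | zero => simp
  | add x y hx hy => simp only [map_add, add_mul, hx, hy]
  | tmul x y =>
    induction w with
    | zero => simp
    | add x y hx hy => simp only [map_add, mul_add, hx, hy]
    | tmul s t => simp [mul_assoc]

theorem rTensor_mulRight_mul (b : A) (z w : A ⊗[ℂ] A) :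
    LinearMap.rTensor A (LinearMap.mulRight ℂ b) z * w =
      z * LinearMap.rTensor A (LinearMap.mulLeft ℂ b) w := by
  induction z with
  | zero => simp
  | add x y hx hy => simp only [map_add, add_mul, hx, hy]
  | tmul x y =>
    induction w with
    | zero => simp
    | add x y hx hy => simp only [map_add, mul_add, hx, hy]
    | tmul s t => simp [mul_assoc]

theorem rTensor_mulLeft_mul (b : A) (z w : A ⊗[ℂ] A) :
    LinearMap.rTensor A (LinearMap.mulLeft ℂ b) z * w =
      LinearMap.rTensor A (LinearMap.mulLeft ℂ b) (z * w) := by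
  induction z with
  | zero => simp
  | add x y hx hy => simp only [map_add, add_mul, hx, hy]
  | tmul x y =>
    induction w with
    | zero => simp
    | add x y hx hy => simp only [map_add, mul_add, hx, hy]
    | tmul s t => simp [mul_assoc]

theorem tmul_mul_eq (x y : A) (w : A ⊗[ℂ] A) : LinearMap.lTensor A (LinearMap.mulLeft ℂ y)
    (LinearMap.rTensor A (LinearMap.mulLeft ℂ x) w) = (x ⊗ₜ y) * w := by
  induction w with
  | zero => simp
  | add x y hx hy => simp only [map_add, mul_add, hx, hy]
  | tmul s t => simp

theorem mul_tmul_eq (x y : A) (w : A ⊗[ℂ] A) : LinearMap.rTensor A (LinearMap.mulRight ℂ x)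
    (LinearMap.lTensor A (LinearMap.mulRight ℂ y) w) = w * (x ⊗ₜ y) := by
  induction w with
  | zero => simp
  | add x y hx hy => simp only [map_add, add_mul, hx, hy]
  | tmul s t => simp

end Nondegenerate

/-! ### Canonical maps from the axioms. -/

namespace WeakMultiplierHopfAlgebra

variable {A : Type*}
  [NonUnitalRing A] [Module ℂ A] [IsScalarTower ℂ A A] [SMulCommClass ℂ A A]

theorem ext_right₂ (H : WeakMultiplierHopfAlgebra A) {z w : A ⊗[ℂ] A} (h : ∀ v, z * v = w * v) : z = w :=
  sub_eq_zero.1 (tensor_nondeg_left H.nondeg_left H.nondeg_left _ fun a b => by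
    rw [sub_mul, h, sub_self])

theorem ext_left₂ (H : WeakMultiplierHopfAlgebra A) {z w : A ⊗[ℂ] A} (h : ∀ v, v * z = v * w) : z = w :=
  sub_eq_zero.1 (tensor_nondeg_right H.nondeg_right H.nondeg_right _ fun a b => by
    rw [mul_sub, h, sub_self])

theorem nondeg_left₂ (H : WeakMultiplierHopfAlgebra A) (z : A ⊗[ℂ] A) (h : ∀ v, z * v = 0) : z = 0 :=
  H.ext_right₂ fun v => by rw [h, zero_mul]

theorem nondeg_right₂ (H : WeakMultiplierHopfAlgebra A) (z : A ⊗[ℂ] A) (h : ∀ v, v * z = 0) : z = 0 :=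
  H.ext_left₂ fun v => by rw [h, mul_zero]

theorem ext_right₃ (H : WeakMultiplierHopfAlgebra A) {z w : (A ⊗[ℂ] A) ⊗[ℂ] A}
    (h : ∀ v d, z * (v ⊗ₜ d) = w * (v ⊗ₜ d)) : z = w :=
  sub_eq_zero.1 (tensor_nondeg_left H.nondeg_left₂ H.nondeg_left _ fun a b => by
    rw [sub_mul, h, sub_self])

theorem ext_left₃ (H : WeakMultiplierHopfAlgebra A) {z w : (A ⊗[ℂ] A) ⊗[ℂ] A}
    (h : ∀ v d, (v ⊗ₜ d) * z = (v ⊗ₜ d) * w) : z = w :=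
  sub_eq_zero.1 (tensor_nondeg_right H.nondeg_right₂ H.nondeg_right _ fun a b => by
    rw [mul_sub, h, sub_self])

theorem nondeg_left₃ (H : WeakMultiplierHopfAlgebra A) (z : (A ⊗[ℂ] A) ⊗[ℂ] A) (h : ∀ v, z * v = 0) : z = 0 :=
  H.ext_right₃ fun v d => by rw [h, zero_mul]

theorem nondeg_right₃ (H : WeakMultiplierHopfAlgebra A) (z : (A ⊗[ℂ] A) ⊗[ℂ] A) (h : ∀ v, v * z = 0) : z = 0 :=
  H.ext_left₃ fun v d => by rw [h, mul_zero]

variable (H : WeakMultiplierHopfAlgebra A)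

theorem T₁_mul_apply (a b : A) (w : A ⊗[ℂ] A) : H.T₁ (a ⊗ₜ b) * w =
    (H.Δ a).left (LinearMap.lTensor A (LinearMap.mulLeft ℂ b) w) :=
  LinearMap.congr_fun (congrArg Mult.left (H.T₁_spec a b)) w

theorem mul_T₂_apply (a b : A) (w : A ⊗[ℂ] A) : w * H.T₂ (a ⊗ₜ b) =
    (H.Δ b).right (LinearMap.rTensor A (LinearMap.mulRight ℂ a) w) :=
  LinearMap.congr_fun (congrArg Mult.right (H.T₂_spec a b)) w

theorem T₂_mul_apply (a b : A) (w : A ⊗[ℂ] A) : H.T₂ (a ⊗ₜ b) * w =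
    LinearMap.rTensor A (LinearMap.mulLeft ℂ a) ((H.Δ b).left w) :=
  LinearMap.congr_fun (congrArg Mult.left (H.T₂_spec a b)) w

theorem Δ_left_tmul (a x y : A) : (H.Δ a).left (x ⊗ₜ y) =
    LinearMap.rTensor A (LinearMap.mulRight ℂ x) (H.T₁ (a ⊗ₜ y)) :=
  H.ext_right₂ fun w => by
    rw [rTensor_mulRight_mul, T₁_mul_apply, tmul_mul_eq, Mult.left_mul_right H.nondeg_right₂]

theorem Δ_right_tmul (b x y : A) : (H.Δ b).right (x ⊗ₜ y) =
    LinearMap.lTensor A (LinearMap.mulLeft ℂ y) (H.T₂ (x ⊗ₜ b)) :=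
  H.ext_left₂ fun w => by
    rw [← lTensor_mulRight_mul, mul_T₂_apply, mul_tmul_eq, Mult.right_mul_left H.nondeg_left₂]

theorem T₁_mul_tmul (a b c : A) : H.T₁ ((a * b) ⊗ₜ c) = (H.Δ a).left (H.T₁ (b ⊗ₜ c)) :=
  H.ext_right₂ fun w => by
    rw [T₁_mul_apply, ← Mult.left_mul_right H.nondeg_right₂, T₁_mul_apply, map_mul, Mult.mul_left]

theorem T₂_tmul_mul (a b c : A) : H.T₂ (a ⊗ₜ (b * c)) = (H.Δ c).right (H.T₂ (a ⊗ₜ b)) :=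
  H.ext_left₂ fun w => by
    rw [mul_T₂_apply, ← Mult.right_mul_left H.nondeg_left₂, mul_T₂_apply, map_mul, Mult.mul_right]

theorem E_T₁ (z : A ⊗[ℂ] A) : H.E.left (H.T₁ z) = H.T₁ z := by
  obtain ⟨u, hu⟩ : H.T₁ z ∈ LinearMap.range H.E.left :=
    H.range_T₁ ▸ LinearMap.mem_range_self H.T₁ z
  rw [← hu, ← Mult.mul_left, H.E_idem]

theorem E_T₂ (z : A ⊗[ℂ] A) : H.E.right (H.T₂ z) = H.T₂ z := by
  obtain ⟨u, hu⟩ : H.T₂ z ∈ LinearMap.range H.E.right :=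
    H.range_T₂ ▸ LinearMap.mem_range_self H.T₂ z
  rw [← hu, ← Mult.mul_right, H.E_idem]

theorem E_Δ_left (a : A) (z : A ⊗[ℂ] A) : H.E.left ((H.Δ a).left z) = (H.Δ a).left z := by
  induction z with
  | zero => simp
  | add x y hx hy => simp only [map_add, hx, hy]
  | tmul x y =>
    refine H.ext_right₂ fun w => ?_
    rw [← Mult.left_mul_right H.nondeg_right₂, Δ_left_tmul, rTensor_mulRight_mul,
      Mult.left_mul_right H.nondeg_right₂, E_T₁]

theorem E_Δ_right (a : A) (z : A ⊗[ℂ] A) : H.E.right ((H.Δ a).right z) = (H.Δ a).right z := by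
  induction z with
  | zero => simp
  | add x y hx hy => simp only [map_add, hx, hy]
  | tmul x y =>
    refine H.ext_left₂ fun w => ?_
    rw [← Mult.right_mul_left H.nondeg_left₂, Δ_right_tmul, ← lTensor_mulRight_mul,
      Mult.right_mul_left H.nondeg_left₂, E_T₂]

theorem deltaId_left_tmul (a c : A) (w : A ⊗[ℂ] A) (d : A) :
    (deltaId H.Δ (a ⊗ₜ c)).left (w ⊗ₜ d) = (H.Δ a).left w ⊗ₜ (c * d) := rfl

theorem deltaId_right_tmul (a c : A) (w : A ⊗[ℂ] A) (d : A) :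
    (deltaId H.Δ (a ⊗ₜ c)).right (w ⊗ₜ d) = (H.Δ a).right w ⊗ₜ (d * c) := rfl

theorem tmulOne_left (E : Mult (A ⊗[ℂ] A)) : (tmulOne E).left = leg12 E.left := rfl
theorem tmulOne_right (E : Mult (A ⊗[ℂ] A)) : (tmulOne E).right = leg12 E.right := rfl
theorem oneTmul_left (E : Mult (A ⊗[ℂ] A)) : (oneTmul E).left = leg23 E.left := rfl
theorem oneTmul_right (E : Mult (A ⊗[ℂ] A)) : (oneTmul E).right = leg23 E.right := rfl

theorem deltaId_add (z w : A ⊗[ℂ] A) (v : (A ⊗[ℂ] A) ⊗[ℂ] A) : (deltaId H.Δ (z + w)).left v =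
    (deltaId H.Δ z).left v + (deltaId H.Δ w).left v := by rw [map_add]; rfl

theorem deltaId_add_right (z w : A ⊗[ℂ] A) (v : (A ⊗[ℂ] A) ⊗[ℂ] A) :
    (deltaId H.Δ (z + w)).right v = (deltaId H.Δ z).right v + (deltaId H.Δ w).right v := by
  rw [map_add]; rfl

theorem deltaId_zero (v : (A ⊗[ℂ] A) ⊗[ℂ] A) : (deltaId H.Δ 0).left v = 0 := by
  rw [map_zero]; rfl

theorem deltaId_zero_right (v : (A ⊗[ℂ] A) ⊗[ℂ] A) : (deltaId H.Δ 0).right v = 0 := by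
  rw [map_zero]; rfl

theorem leg12_E_deltaId (z : A ⊗[ℂ] A) (v : (A ⊗[ℂ] A) ⊗[ℂ] A) :
    leg12 H.E.left ((deltaId H.Δ z).left v) = (deltaId H.Δ z).left v := by
  induction z with
  | zero => rw [deltaId_zero]; simp
  | add x y hx hy => rw [deltaId_add, map_add, hx, hy]
  | tmul x y =>
    induction v with
    | zero => simp
    | add x y hx hy => simp only [map_add, hx, hy]
    | tmul x y => rw [deltaId_left_tmul, leg12_tmul, E_Δ_left]

theorem leg12_E_deltaId_right (z : A ⊗[ℂ] A) (v : (A ⊗[ℂ] A) ⊗[ℂ] A) :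
    leg12 H.E.right ((deltaId H.Δ z).right v) = (deltaId H.Δ z).right v := by
  induction z with
  | zero => rw [deltaId_zero_right]; simp
  | add x y hx hy => rw [deltaId_add_right, map_add, hx, hy]
  | tmul x y =>
    induction v with
    | zero => simp
    | add x y hx hy => simp only [map_add, hx, hy]
    | tmul x y => rw [deltaId_right_tmul, leg12_tmul, E_Δ_right]

/-- In (Δ⊗ι)(Ez) = (1⊗E)(E⊗1)(Δ⊗ι)(z) the factor E⊗1 is absorbed, because EΔ(a) = Δ(a). -/
theorem leg23_E_deltaId (z : A ⊗[ℂ] A) (v : (A ⊗[ℂ] A) ⊗[ℂ] A) :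
    leg23 H.E.left ((deltaId H.Δ z).left v) = (deltaId H.Δ (H.E.left z)).left v := by
  rw [← H.delta_E_left, H.E_comm, Mult.mul_left, Mult.mul_left, tmulOne_left, leg12_E_deltaId,
    oneTmul_left]

theorem leg23_E_deltaId_right (z : A ⊗[ℂ] A) (v : (A ⊗[ℂ] A) ⊗[ℂ] A) :
    leg23 H.E.right ((deltaId H.Δ z).right v) = (deltaId H.Δ (H.E.right z)).right v := by
  rw [← H.delta_E_right, Mult.mul_right, Mult.mul_right, tmulOne_right, leg12_E_deltaId_right,
    oneTmul_right]

theorem leg12_T₁_mul (z : A ⊗[ℂ] A) (b : A) (w : A ⊗[ℂ] A) (d : A) :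
    leg12 H.T₁ (TensorProduct.rightComm ℂ A A A (z ⊗ₜ b)) * (w ⊗ₜ d) =
      (deltaId H.Δ z).left (LinearMap.lTensor A (LinearMap.mulLeft ℂ b) w ⊗ₜ d) := by
  induction z with
  | zero => rw [deltaId_zero]; simp
  | add x y hx hy =>
    rw [TensorProduct.add_tmul, map_add, map_add, add_mul, hx, hy, deltaId_add]
  | tmul x y =>
    rw [TensorProduct.rightComm_tmul, leg12_tmul, deltaId_left_tmul, ← T₁_mul_apply,
      Algebra.TensorProduct.tmul_mul_tmul]

theorem leg12_T₂_mul (z : A ⊗[ℂ] A) (a : A) (w : A ⊗[ℂ] A) (d : A) :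
    leg12 H.T₂ ((TensorProduct.assoc ℂ A A A).symm (a ⊗ₜ z)) * (w ⊗ₜ d) =
      leg12 (LinearMap.rTensor A (LinearMap.mulLeft ℂ a)) ((deltaId H.Δ z).left (w ⊗ₜ d)) := by
  induction z with
  | zero => rw [deltaId_zero]; simp
  | add x y hx hy =>
    rw [TensorProduct.tmul_add, map_add, map_add, add_mul, hx, hy, deltaId_add, map_add]
  | tmul x y =>
    rw [TensorProduct.assoc_symm_tmul, leg12_tmul, deltaId_left_tmul, leg12_tmul, ← T₂_mul_apply,
      Algebra.TensorProduct.tmul_mul_tmul]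

theorem mul_leg12_T₂ (z : A ⊗[ℂ] A) (a : A) (w : A ⊗[ℂ] A) (d : A) :
    (w ⊗ₜ d) * leg12 H.T₂ ((TensorProduct.assoc ℂ A A A).symm (a ⊗ₜ z)) =
      (deltaId H.Δ z).right (LinearMap.rTensor A (LinearMap.mulRight ℂ a) w ⊗ₜ d) := by
  induction z with
  | zero => rw [deltaId_zero_right]; simp
  | add x y hx hy =>
    rw [TensorProduct.tmul_add, map_add, map_add, mul_add, hx, hy, deltaId_add_right]
  | tmul x y =>
    rw [TensorProduct.assoc_symm_tmul, leg12_tmul, deltaId_right_tmul, ← mul_T₂_apply,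
      Algebra.TensorProduct.tmul_mul_tmul]

/-- On a⊗b⊗c the map T₁ on legs 1, 2 gives (Δ⊗ι)(a⊗c)(1⊗b⊗1), so this is `leg23_E_deltaId` with
covered legs. -/
theorem T₁_E_left : leg12 H.T₁ * leg13 H.E.left = leg23 H.E.left * leg12 H.T₁ := by
  ext a b c
  refine H.ext_right₃ fun w d => ?_
  have h1 := Mult.left_mul_right H.nondeg_right₃ (oneTmul H.E)
  rw [oneTmul_left] at h1
  have h2 := H.leg12_T₁_mul (a ⊗ₜ c) b w d
  rw [TensorProduct.rightComm_tmul] at h2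
  change leg12 H.T₁ (leg13 H.E.left ((a ⊗ₜ b) ⊗ₜ c)) * _ =
    leg23 H.E.left (leg12 H.T₁ ((a ⊗ₜ b) ⊗ₜ c)) * _
  rw [leg13_tmul, leg12_T₁_mul, ← h1, h2, leg23_E_deltaId]

theorem T₂_E_left : leg12 H.T₂ * leg23 H.E.left = leg23 H.E.left * leg12 H.T₂ := by
  ext a b c
  refine H.ext_right₃ fun w d => ?_
  have h1 := Mult.left_mul_right H.nondeg_right₃ (oneTmul H.E)
  rw [oneTmul_left] at h1
  have h2 := H.leg12_T₂_mul (b ⊗ₜ c) a w d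
  rw [TensorProduct.assoc_symm_tmul] at h2
  have h3 := fun v => LinearMap.congr_fun
    (CanonicalMaps.leg23_rTensor_comm (LinearMap.mulLeft ℂ a) H.E.left).eq v
  simp only [Module.End.mul_apply] at h3
  change leg12 H.T₂ (leg23 H.E.left ((a ⊗ₜ b) ⊗ₜ c)) * _ =
    leg23 H.E.left (leg12 H.T₂ ((a ⊗ₜ b) ⊗ₜ c)) * _
  rw [leg23_tmul, leg12_T₂_mul, ← h1, h2, h3, leg23_E_deltaId]

theorem T₂_E_right : leg12 H.T₂ * leg23 H.E.right = leg23 H.E.right * leg12 H.T₂ := by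
  ext a b c
  refine H.ext_left₃ fun w d => ?_
  have h1 := Mult.right_mul_left H.nondeg_left₃ (oneTmul H.E)
  rw [oneTmul_right] at h1
  have h2 := H.mul_leg12_T₂ (b ⊗ₜ c) a w d
  rw [TensorProduct.assoc_symm_tmul] at h2
  change _ * leg12 H.T₂ (leg23 H.E.right ((a ⊗ₜ b) ⊗ₜ c)) =
    _ * leg23 H.E.right (leg12 H.T₂ ((a ⊗ₜ b) ⊗ₜ c))
  rw [leg23_tmul, mul_leg12_T₂, ← h1, h2, leg23_E_deltaId_right]

/-- The canonical maps of a weak multiplier Hopf algebra. -/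
def canonicalMaps : CanonicalMaps A where
  mul := LinearMap.mul ℂ A
  assoc := mul_assoc
  nondeg_left := H.nondeg_left
  nondeg_right := H.nondeg_right
  mul_span := by
    rw [eq_top_iff, ← H.idempotent]
    rintro _ ⟨z, rfl⟩
    induction z with
    | zero => simp
    | add x y hx hy => rw [map_add]; exact Submodule.add_mem _ hx hy
    | tmul x y => exact Submodule.subset_span ⟨x, y, rfl⟩
  ε := H.ε
  T₁ := H.T₁
  T₂ := H.T₂
  E₁ := H.E.left
  E₂ := H.E.right
  G₁ := H.G₁
  G₂ := H.G₂
  R₁ := H.R₁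
  R₂ := H.R₂
  T₁_lTensor c z := by
    induction z with
    | zero => simp
    | add x y hx hy => simp only [map_add, hx, hy]
    | tmul a b =>
      refine H.ext_right₂ fun w => ?_
      change H.T₁ (a ⊗ₜ (b * c)) * w =
        LinearMap.lTensor A (LinearMap.mulRight ℂ c) (H.T₁ (a ⊗ₜ b)) * w
      rw [lTensor_mulRight_mul, T₁_mul_apply, T₁_mul_apply, ← LinearMap.lTensor_comp_apply]
      congr 2
      ext x
      simp
  T₂_rTensor c z := by
    induction z with
    | zero => simp
    | add x y hx hy => simp only [map_add, hx, hy]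
    | tmul a b =>
      refine H.ext_right₂ fun w => ?_
      change H.T₂ ((c * a) ⊗ₜ b) * w =
        LinearMap.rTensor A (LinearMap.mulLeft ℂ c) (H.T₂ (a ⊗ₜ b)) * w
      rw [rTensor_mulLeft_mul, T₂_mul_apply, T₂_mul_apply, ← LinearMap.rTensor_comp_apply]
      congr 2
      ext x
      simp
  T₁_mul v := by
    have h1 : ∀ (a : A) (w : A ⊗[ℂ] A), (H.Δ a).left w = mulLegs12 (LinearMap.mul ℂ A)
        (leg13 H.T₁ ((TensorProduct.assoc ℂ A A A).symm (a ⊗ₜ w))) := by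
      intro a w
      induction w with
      | zero => simp
      | add x y hx hy => simp only [map_add, TensorProduct.tmul_add, hx, hy]
      | tmul x y =>
        rw [TensorProduct.assoc_symm_tmul, leg13_tmul, mulLegs12_rightComm, Δ_left_tmul]
        rfl
    have h2 : H.T₁ ∘ₗ mulLegs12 (LinearMap.mul ℂ A) =
        mulLegs12 (LinearMap.mul ℂ A) ∘ₗ leg13 H.T₁ ∘ₗ leg23 H.T₁ := by
      ext a b c
      simp [T₁_mul_tmul, h1]
    exact LinearMap.congr_fun h2 v
  T₂_mul v := by
    have h1 : ∀ (c : A) (w : A ⊗[ℂ] A), (H.Δ c).right w = mulLegs23 (LinearMap.mul ℂ A)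
        (leg13 H.T₂ (w ⊗ₜ c)) := by
      intro c w
      induction w with
      | zero => simp
      | add x y hx hy => simp only [map_add, TensorProduct.add_tmul, hx, hy]
      | tmul x y =>
        rw [leg13_tmul, Δ_right_tmul]
        generalize H.T₂ (x ⊗ₜ c) = z
        induction z with
        | zero => simp
        | add x y hx hy => simp only [map_add, TensorProduct.add_tmul, hx, hy]
        | tmul x y => simp [mulLegs23]
    have h2 : H.T₂ ∘ₗ mulLegs23 (LinearMap.mul ℂ A) =
        mulLegs23 (LinearMap.mul ℂ A) ∘ₗ leg13 H.T₂ ∘ₗ leg12 H.T₂ := by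
      ext a b c
      simp [T₂_tmul_mul, h1, mulLegs23]
    exact LinearMap.congr_fun h2 v
  compat a b c := by
    refine H.ext_right₂ fun w => ?_
    change LinearMap.rTensor A (LinearMap.mulLeft ℂ c) (H.T₁ (a ⊗ₜ b)) * w =
      LinearMap.lTensor A (LinearMap.mulRight ℂ b) (H.T₂ (c ⊗ₜ a)) * w
    rw [rTensor_mulLeft_mul, T₁_mul_apply, lTensor_mulRight_mul, T₂_mul_apply]
  coassoc := H.coassoc
  full_left := H.full_left
  full_right := H.full_right
  counit_left z := by
    have h : sliceLeft H.ε ∘ₗ H.T₁ = TensorProduct.lift (LinearMap.mul ℂ A) := by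
      ext a b; exact H.counit_left a b
    exact LinearMap.congr_fun h z
  counit_right z := by
    have h : sliceRight H.ε ∘ₗ H.T₂ = TensorProduct.lift (LinearMap.mul ℂ A) := by
      ext a b; exact H.counit_right a b
    exact LinearMap.congr_fun h z
  T₁_R₁ := H.existsUnique_R₁.choose_spec.1.1
  R₁_T₁ := H.existsUnique_R₁.choose_spec.1.2.1
  R₁_E₁ := by
    rw [← H.existsUnique_R₁.choose_spec.1.1]
    exact H.existsUnique_R₁.choose_spec.1.2.2
  E₁_T₁ := LinearMap.ext H.E_T₁
  T₂_R₂ := H.existsUnique_R₂.choose_spec.1.1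
  R₂_T₂ := H.existsUnique_R₂.choose_spec.1.2.1
  R₂_E₂ := by
    rw [← H.existsUnique_R₂.choose_spec.1.1]
    exact H.existsUnique_R₂.choose_spec.1.2.2
  E₂_T₂ := LinearMap.ext H.E_T₂
  G₁_spec := H.G₁_spec
  G₂_spec := H.G₂_spec
  E_compat z w := by rw [map₂_mul, map₂_mul, H.E.compat]
  E₁_comm := congrArg Mult.left H.E_comm
  E₂_comm := (congrArg Mult.right H.E_comm).symm

/-- The canonical maps of a regular weak multiplier Hopf algebra with antipode `S`. -/
def hopfMaps (S : A ≃ₗ[ℂ] A) (hS : ∀ a b : A,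
    H.antipodeLeft (a ⊗ₜ b) = S a * b ∧ H.antipodeRight (b ⊗ₜ a) = b * S a) : HopfMaps A where
  toCanonicalMaps := H.canonicalMaps
  T₁_E₁ := H.T₁_E_left
  -- `T₁_E₁`, `T₂_E₁` and `T₂_E₂'` express the axiom on (Δ⊗ι)E; the other three relations are the
  -- derived ones for ι⊗Δ.
  T₂_E₂ := H.canonicalMaps.E₂_T₂_of_E₂_T₁ (H.canonicalMaps.E₂_T₁_of_T₁_E₁ H.T₁_E_left)
  T₂_E₁ := H.T₂_E_left
  T₁_E₂ := (H.canonicalMaps.E₂_T₁_of_T₁_E₁ H.T₁_E_left).symm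
  T₁_E₁' := H.canonicalMaps.E₁_T₁_of_T₂_E₂ H.T₂_E_right
  T₂_E₂' := H.T₂_E_right
  S := S
  S_mul a b := (hS a b).1
  mul_S a b := (hS a b).2

variable {H} {S : A ≃ₗ[ℂ] A} (hS : ∀ a b : A,
    H.antipodeLeft (a ⊗ₜ b) = S a * b ∧ H.antipodeRight (b ⊗ₜ a) = b * S a)

theorem antipodeLeft_T₁ (a b : A) : H.antipodeLeft (H.T₁ (a ⊗ₜ b)) = (H.hopfMaps S hS).esL a b :=
  congrArg (sliceLeft H.ε) (LinearMap.congr_fun H.existsUnique_R₁.choose_spec.1.2.1 (a ⊗ₜ b))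

theorem antipodeRight_T₂ (b a : A) : H.antipodeRight (H.T₂ (b ⊗ₜ a)) = (H.hopfMaps S hS).etR b a :=
  congrArg (sliceRight H.ε) (LinearMap.congr_fun H.existsUnique_R₂.choose_spec.1.2.1 (b ⊗ₜ a))

theorem leftInvariant_hopfMaps {φ : A →ₗ[ℂ] ℂ} (hφ : H.IsLeftInvariant φ) :
    (H.hopfMaps S hS).LeftInvariant φ := by
  intro a s
  obtain ⟨x, hx, hxφ, -⟩ := hφ a
  let t : Mult A := Mult.mk ((H.hopfMaps S hS).etL s) ((H.hopfMaps S hS).etR.flip s)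
    fun c d => ((H.hopfMaps S hS).mul_etL c s d).symm
  have ht : t ∈ H.targetAlgebra := ⟨s, fun b => (antipodeRight_T₂ hS b s).symm⟩
  obtain ⟨s', hs'⟩ := (hx t ht).2
  refine ⟨s', fun d => ?_⟩
  rw [← antipodeRight_T₂ hS d s', ← hs', Mult.mul_right, hxφ]
  rfl

end WeakMultiplierHopfAlgebra

end WMHopf

end

theorem mainTheorem8 {A : Type*} [NonUnitalRing A] [Module ℂ A] [IsScalarTower ℂ A A]
    [SMulCommClass ℂ A A] (H : WMHopf.WeakMultiplierHopfAlgebra A) (hreg : H.IsRegular)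
    (φ φ₁ : A →ₗ[ℂ] ℂ) (hφ : H.IsLeftIntegral φ) (hφ₁ : H.IsLeftIntegral φ₁)
    (hfaith : WMHopf.IsFaithful φ) :
    ∃ y ∈ H.As, ∀ x : A, φ₁ x = φ (y.right x) := by
  obtain ⟨S, hS⟩ := hreg
  have hf : ∀ a, (∀ b, φ ((H.hopfMaps S hS).mul a b) = 0) → a = 0 := fun a h => hfaith a (Or.inl h)
  have hf' : ∀ a, (∀ b, φ ((H.hopfMaps S hS).mul b a) = 0) → a = 0 :=
    fun a h => hfaith a (Or.inr h)
  have hφ' := WMHopf.WeakMultiplierHopfAlgebra.leftInvariant_hopfMaps hS hφ.2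
  have hφ₁' := WMHopf.WeakMultiplierHopfAlgebra.leftInvariant_hopfMaps hS hφ₁.2
  obtain ⟨L, θ, hLθ, hy⟩ := WMHopf.HopfMaps.exists_multiplier hf hf' hφ' hφ₁'
  have hΔ := WMHopf.HopfMaps.T₂_tmul_right hLθ hy hf' hφ' hφ₁'
  refine ⟨WMHopf.Mult.mk L θ hLθ, fun x hx => ?_, hy⟩
  obtain ⟨a, ha⟩ := hx
  -- The witnesses express yε_s(a) = ε_s(S⁻¹(yS(a))) and ε_s(a)y = ε_s(ay).
  refine ⟨⟨(H.hopfMaps S hS).leftConj L a, fun b => ?_⟩, ⟨θ a, fun b => ?_⟩⟩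
  · rw [WMHopf.WeakMultiplierHopfAlgebra.antipodeLeft_T₁ hS, ← WMHopf.HopfMaps.left_esL hLθ hΔ,
      ← WMHopf.WeakMultiplierHopfAlgebra.antipodeLeft_T₁ hS, ← ha]
    rfl
  · rw [WMHopf.WeakMultiplierHopfAlgebra.antipodeLeft_T₁ hS, WMHopf.HopfMaps.esL_right hLθ hΔ,
      ← WMHopf.WeakMultiplierHopfAlgebra.antipodeLeft_T₁ hS, ← ha]
    rfl
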